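/- Let $X=\mathbb F_2^{n}$ with Hamming distance $d$ (the scheme $H(n,2)$), and let $X_r=\{x\in X: d(x,0)=r\}$. Let $L_j(X)$ be the column space of the $j$-th primitive idempotent, i.e. the real span of the functions $x\mapsto(-1)^{\sum_{i\in T}x_i}$ with $T\subseteq\{1,\dots,n\}$, $|T|=j$. For $r_1<r_2$ put $S=X_{r_1}\cup X_{r_2}$. A relative $4$-design on the two shells $X_{r_1},X_{r_2}$ (with respect to $0$) is a pair $(Y,w)$ with $Y\subseteq S$ meeting both shells and $w:Y\to\mathbb R_{>0}$ such that $$\sum_{\nu=1}^{2}\frac{w(Y\cap X_{r_\nu})}{|X_{r_\nu}|}\sum_{x\in X_{r_\nu}}f(x)=\sum_{y\in Y}w(y)f(y)\qquad\text{for all } f\in L_j(X),\ 1\le j\le 4,$$ where $w(A)=\sum_{y\in A}w(y)$. It is tight if $|Y|=\dim\bigl(L_2(S)+L_1(S)\bigr)$, where $L_j(S)$ is the space of restrictions of $L_j(X)$ to $S$. Subsets of $\{1,\dots,n\}$ are identified with their indicator vectors in $X$. Two subsets of $X$ are called isomorphic if they differ by a permutation of the coordinates. Theorem. Let $n=22$,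 and consider tight relative $4$-designs $(Y,w)$ on two shells $X_{r_1},X_{r_2}$ with $2\le r_1<r_2\le n-2=20$. (1) The weight $w$ is constant on $Y$; that is, there are no tight relative $4$-designs with non-constant weight. (2) Up to isomorphism of $Y$ (and scaling of the constant weight), there are exactly four tight relative $4$-designs with constant weight. They have $(r_1,r_2)=(6,7)$, $(6,15)$, $(7,16)$ and $(15,16)$, one for each pair. (3) A $4$-$(23,7,1)$ design exists. For every $4$-$(23,7,1)$ design on the points $\{1,\dots,22\}\cup\{\infty\}$ (the Witt design), let $\mathcal D=\{B\setminus\{\infty\}:\infty\in B\}$ and $\mathcal R=\{B:\infty\notin B\}$, with $B$ ranging over the blocks, be its derived and residual designs at $\infty$, and let $\mathcal D^c,\mathcal R^c$ be the complementary designs, consisting of the complements in $\{1,\dots,22\}$ of the blocks of $\mathcal D$ and $\mathcal R$. With any positive constant weight, $\mathcal D\cup\mathcal R$, $\mathcal D\cup\mathcal R^c$, $\mathcal R\cup\mathcal D^c$ and $\mathcal R^c\cup\mathcal D^c$ are tight relative $4$-designs with $(r_1,r_2)=(6,7)$, $(6,15)$, $(7,16)$ and $(15,16)$, respectively. Every tight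 relative $4$-design with constant weight is isomorphic to the one of these four that lies on the same two shells. -/

import Mathlib

open Finset

namespace RelDesign

/-! ### Combinatorial designs -/

/-- A (simple) `t`-`(v, k, lam)` design on the point set `V`: `V` has `v` points, every block has
`k` points, and every `t`-subset of `V` lies in exactly `lam` blocks. -/
structure IsDesign {V : Type*} [Fintype V] [DecidableEq V] (t v k lam : ℕ)
    (B : Finset (Finset V)) : Prop where
  card_points : Fintype.card V = v
  card_block : ∀ b ∈ B, #b = k
  balanced : ∀ T : Finset V, #T = t → #{b ∈ B | T ⊆ b} = lam

/-- The derived design at the point `∞ = none` of `Option V`: the blocks through `∞`, with `∞`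
removed. -/
def derived {V : Type*} [DecidableEq V] (B : Finset (Finset (Option V))) : Finset (Finset V) :=
  {b ∈ B | none ∈ b}.image Finset.eraseNone

/-- The residual design at the point `∞ = none` of `Option V`: the blocks that miss `∞`. -/
def residual {V : Type*} [DecidableEq V] (B : Finset (Finset (Option V))) : Finset (Finset V) :=
  {b ∈ B | none ∉ b}.image Finset.eraseNone

/-- The complementary design: its blocks are the complements of the blocks of `B`. -/
def complementary {V : Type*} [Fintype V] [DecidableEq V] (B : Finset (Finset V)) :
    Finset (Finset V) :=
  B.image (fun b => bᶜ)

/-! ### The binary Hamming scheme `H(n,2)` -/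

/-- The vertex set `F_2^n` of `H(n,2)`. The relation `R_i` is `hammingDist x y = i`. -/
abbrev Cube (n : ℕ) : Type := Fin n → ZMod 2

/-- The shell `X_r` around `u₀`. -/
def shell {n : ℕ} (u₀ : Cube n) (r : ℕ) : Finset (Cube n) :=
  {x | hammingDist x u₀ = r}

/-- The additive character `x ↦ (-1)^{∑_{i ∈ T} x_i}` of `F_2^n`. -/
def character {n : ℕ} (T : Finset (Fin n)) (x : Cube n) : ℝ :=
  ∏ i ∈ T, if x i = 1 then -1 else 1

/-- The `l`-th primitive idempotent `E_l` of `H(n,2)` in its usual Q-polynomial ordering: the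
orthogonal projection onto the span of the characters of weight `l`. -/
noncomputable def primitiveIdempotent (n l : ℕ) : Matrix (Cube n) (Cube n) ℝ :=
  Matrix.of fun x u =>
    ((2 : ℝ) ^ n)⁻¹ * ∑ T ∈ (univ : Finset (Fin n)).powersetCard l, character T x * character T u

/-- The space `L_l(X)` of functions on `X = F_2^n`: the column space of `E_l`, spanned by the
columns `φ_u^{(l)}` of `|X| E_l`. -/
noncomputable def harmonicSpace (n l : ℕ) : Submodule ℝ (Cube n → ℝ) :=
  Submodule.span ℝ
    (Set.range fun (u : Cube n) (x : Cube n) => (2 : ℝ) ^ n * primitiveIdempotent n l x u)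

/-- The space `L_l(S)` of restrictions of `L_l(X)` to the union `S` of the shells `X_r`, `r ∈ R`. -/
noncomputable def harmonicSpaceOn {n : ℕ} (u₀ : Cube n) (R : Finset ℕ) (l : ℕ) :
    Submodule ℝ ({x : Cube n // hammingDist x u₀ ∈ R} → ℝ) :=
  (harmonicSpace n l).map (LinearMap.funLeft ℝ ℝ Subtype.val)

/-- `(Y, w)` is a relative `t`-design (of the Q-structure of `H(n,2)`) with respect to `u₀`, on the
shells `X_r`, `r ∈ R` (`R` is the set of indices of the shells that `Y` meets). Only the values of
`w` on `Y` matter. -/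
structure IsRelativeDesign {n : ℕ} (u₀ : Cube n) (t : ℕ) (R : Finset ℕ)
    (Y : Finset (Cube n)) (w : Cube n → ℝ) : Prop where
  pos : ∀ y ∈ Y, 0 < w y
  shells : Y.image (fun y => hammingDist y u₀) = R
  average : ∀ j, 1 ≤ j → j ≤ t → ∀ f ∈ harmonicSpace n j,
    ∑ r ∈ R, (∑ y ∈ Y ∩ shell u₀ r, w y) / (#(shell u₀ r) : ℝ) * ∑ x ∈ shell u₀ r, f x =
      ∑ y ∈ Y, w y * f y

/-- A relative `2e`-design on `p = |R|` shells is tight if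
`|Y| = dim (L_e(S) + L_{e-1}(S) + ⋯ + L_{e-p+1}(S))`. -/
structure IsTightRelativeDesign {n : ℕ} (u₀ : Cube n) (e : ℕ) (R : Finset ℕ)
    (Y : Finset (Cube n)) (w : Cube n → ℝ) : Prop where
  isRelativeDesign : IsRelativeDesign u₀ (2 * e) R Y w
  card_eq : #Y = Module.finrank ℝ
    ↥(⨆ l : {l : ℕ // l ≤ e ∧ e < l + #R}, harmonicSpaceOn u₀ R (l : ℕ))

/-! ### Blocks versus vertices, and isomorphism -/

/-- The vertex `x_B` of `H(n,2)`: the indicator vector of the block `B`. -/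
def vertexOf {n : ℕ} (b : Finset (Fin n)) : Cube n := fun i => if i ∈ b then 1 else 0

/-- The set of vertices of `H(n,2)` that corresponds to a set of blocks. -/
def verticesOf {n : ℕ} (B : Finset (Finset (Fin n))) : Finset (Cube n) := B.image vertexOf

/-- The image of a set of vertices under a permutation of the coordinates. These permutations are
the automorphisms of `H(n,2)` that fix `0`. -/
def permute {n : ℕ} (σ : Equiv.Perm (Fin n)) (Y : Finset (Cube n)) : Finset (Cube n) :=
  Y.image (fun x i => x (σ.symm i))

/-- Isomorphism of sets of vertices: equality up to a permutation of the coordinates. -/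
def Isomorphic {n : ℕ} (Y Y' : Finset (Cube n)) : Prop :=
  ∃ σ : Equiv.Perm (Fin n), permute σ Y = Y'

theorem permute_mul {n : ℕ} (σ τ : Equiv.Perm (Fin n)) (Y : Finset (Cube n)) :
    permute (σ * τ) Y = permute σ (permute τ Y) := by
  simp only [permute, Finset.image_image]
  rfl

theorem permute_one {n : ℕ} (Y : Finset (Cube n)) : permute 1 Y = Y := by
  simp only [permute]
  exact Finset.image_id

/-- The isomorphism relation as a setoid. -/
def isoSetoid (n : ℕ) : Setoid (Finset (Cube n)) where
  r := Isomorphic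
  iseqv :=
    { refl := fun Y => ⟨1, permute_one Y⟩
      symm := by
        rintro Y _ ⟨σ, rfl⟩
        exact ⟨σ⁻¹, by rw [← permute_mul, inv_mul_cancel, permute_one]⟩
      trans := by
        rintro Y _ _ ⟨σ, rfl⟩ ⟨τ, rfl⟩
        exact ⟨τ * σ, permute_mul τ σ Y⟩ }

/-- `Y` is, for some constant positive weight, a tight relative `4`-design of `H(22,2)` with respect
to `0` on two shells `X_{r₁} ∪ X_{r₂}` with `2 ≤ r₁ < r₂ ≤ 20`. -/
def IsConstantWeightTight (Y : Finset (Cube 22)) : Prop :=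
  ∃ r₁ r₂ : ℕ, 2 ≤ r₁ ∧ r₁ < r₂ ∧ r₂ ≤ 20 ∧
    ∃ c : ℝ, IsTightRelativeDesign (0 : Cube 22) 2 {r₁, r₂} Y (fun _ => c)

end RelDesign

open RelDesign

/-! Vertices are read as subsets of a 22-set and relative designs as quadrature rules that are exact
for functions of degree at most four (`isRelativeDesign_iff`). A function of degree two that
vanishes on a tight design has a square of degree four, hence mean square zero on both shells. So
restriction to the design is injective, by tightness bijective, and every point has a dual function
of degree two (`exists_dual_of_tight`).

On two shells the functions of degree at most two consist of those of degree at most one on each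
shell separately (22 + 22 dimensions) and one copy of the degree-two harmonics shared by both shells
(209 dimensions). Their reproducing kernel is explicit: a linear kernel plus a Hahn polynomial in
the intersection size. Tested against dual functions it satisfies w(x) K(y,x) = δ
(`TwoShell.kernel_eq`). The diagonal determines the weight and the size of each shell. The vanishing
off the diagonal gives quadratic equations for the intersection numbers.

Two intersection numbers must occur between the shells, and two integral roots of the cross equation
leave four pairs of shells (`TwoShell.shells`). The equations within the shells force 77 and 176
points, and then the weights agree. Complementing large sets and adjoining ∞ to those from shell 6
or 16 yields 253 sevens that meet pairwise in at most three points. Counting 4-subsets turns these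
into a 4-(23,7,1) design (`TwoShell.isDesign`).

Such a design is unique with ∞ fixed (`exists_equiv_wittDesign`). The symmetric difference of two
blocks meeting in one point is a 12-set D. Eleven blocks through ∞ that meet D in two points cut out
a biplane on the eleven points outside D; the biplane is unique, and parity recovers every block
from its trace outside D and its value at ∞. The resulting words form the binary Golay code, whose
words of weight seven also prove existence.

Conversely, the derived and residual designs are each exact in degree three and jointly exact in
degree four. Complementation multiplies a character of weight four by +1, so complementing either
part keeps the joint exactness (`ShellPair.compl`). The intersection numbers supply dual functions,
and 253 = 22 + 231 points then match the dimension. -/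

namespace RelDesign

/-! ### Functions of bounded degree on the subsets of a finite set -/

/-- The indicator function of the subsets that contain `U`. -/
def inc {n : ℕ} (U b : Finset (Fin n)) : ℝ := if U ⊆ b then 1 else 0

/-- The functions of degree at most `t` on the subsets of `Fin n`. -/
def Pol (n t : ℕ) : Submodule ℝ (Finset (Fin n) → ℝ) :=
  Submodule.span ℝ (inc '' {U | #U ≤ t})

/-- The character of `F_2^n` attached to `T`, as a function of subsets. -/
def sgn {n : ℕ} (T b : Finset (Fin n)) : ℝ := ∏ i ∈ T, if i ∈ b then -1 else 1

theorem inc_mem_Pol {n t : ℕ} {U : Finset (Fin n)} (h : #U ≤ t) : inc U ∈ Pol n t :=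
  Submodule.subset_span ⟨U, h, rfl⟩

theorem inc_mul_inc {n : ℕ} (U V : Finset (Fin n)) : inc U * inc V = inc (U ∪ V) := by
  ext b
  simp only [inc, Pi.mul_apply, union_subset_iff]
  split_ifs <;> simp_all

theorem Pol_mono {n s t : ℕ} (h : s ≤ t) : Pol n s ≤ Pol n t :=
  Submodule.span_mono (Set.image_mono fun _ hU => le_trans hU h)

theorem mul_mem_Pol {n s t u : ℕ} {f g : Finset (Fin n) → ℝ} (hf : f ∈ Pol n s) (hg : g ∈ Pol n t)
    (hu : s + t = u) : f * g ∈ Pol n u := by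
  subst hu
  have h := Submodule.mul_mem_mul hf hg
  rw [Pol, Pol, Submodule.span_mul_span] at h
  refine Submodule.span_le.2 ?_ h
  rintro _ ⟨_, ⟨U, hU, rfl⟩, _, ⟨V, hV, rfl⟩, rfl⟩
  simp only [inc_mul_inc]
  exact inc_mem_Pol ((card_union_le _ _).trans (add_le_add hU hV))

theorem inc_empty {n : ℕ} : inc (∅ : Finset (Fin n)) = 1 := by
  ext b; simp [inc]

theorem one_mem_Pol {n t : ℕ} : (1 : Finset (Fin n) → ℝ) ∈ Pol n t := by
  rw [← inc_empty]; exact inc_mem_Pol (by simp)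

theorem const_mem_Pol {n t : ℕ} (c : ℝ) : (fun _ : Finset (Fin n) => c) ∈ Pol n t := by
  have := (Pol n t).smul_mem c one_mem_Pol
  convert this using 1
  ext; simp

theorem sgn_singleton {n : ℕ} (i : Fin n) : sgn {i} = 1 - (2 : ℝ) • inc {i} := by
  ext b
  by_cases h : i ∈ b <;> simp [sgn, inc, h]
  norm_num

theorem sgn_insert {n : ℕ} {i : Fin n} {T : Finset (Fin n)} (h : i ∉ T) :
    sgn (insert i T) = sgn {i} * sgn T := by
  ext b
  simp only [sgn, prod_insert h, Pi.mul_apply, prod_singleton]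

theorem sgn_mem_Pol {n : ℕ} (T : Finset (Fin n)) : sgn T ∈ Pol n #T := by
  induction T using Finset.induction_on with
  | empty => convert one_mem_Pol; ext; simp [sgn]
  | insert i T h ih =>
    rw [sgn_insert h, card_insert_of_notMem h, add_comm, sgn_singleton]
    refine mul_mem_Pol
      (Submodule.sub_mem _ one_mem_Pol (Submodule.smul_mem _ _ (inc_mem_Pol ?_))) ih rfl
    simp

/-- Since `sgn {i}` squares to one, multiplying by it toggles `i` in the index set, so the degree
rises by at most one. -/
theorem sgn_singleton_mul_mem {n t : ℕ} (i : Fin n) {f : Finset (Fin n) → ℝ}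
    (hf : f ∈ Submodule.span ℝ (sgn '' {T : Finset (Fin n) | #T ≤ t})) :
    sgn {i} * f ∈ Submodule.span ℝ (sgn '' {T : Finset (Fin n) | #T ≤ t + 1}) := by
  have h := Submodule.mul_mem_mul
    (Submodule.subset_span (R := ℝ) (Set.mem_singleton (sgn ({i} : Finset (Fin n))))) hf
  rw [Submodule.span_mul_span] at h
  refine Submodule.span_le.2 ?_ h
  rintro _ ⟨_, rfl, _, ⟨T, hT, rfl⟩, rfl⟩
  by_cases hi : i ∈ T
  · refine Submodule.subset_span ⟨T.erase i, ?_, ?_⟩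
    · simp only [Set.mem_ofPred_eq, card_erase_of_mem hi] at hT ⊢; omega
    · conv_rhs => rw [← insert_erase hi, sgn_insert (notMem_erase i T)]
      ext b
      by_cases hb : i ∈ b <;> simp [sgn, hb]
  · refine Submodule.subset_span ⟨insert i T, ?_, sgn_insert hi⟩
    simp only [Set.mem_ofPred_eq, card_insert_of_notMem hi] at hT ⊢; omega

/-- Change of basis from monomials to characters through `inc {i} = (1 - sgn {i}) / 2`, applied one
point at a time. -/
theorem Pol_eq_span_sgn (n t : ℕ) :
    Pol n t = Submodule.span ℝ (sgn '' {T : Finset (Fin n) | #T ≤ t}) := by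
  apply le_antisymm
  · refine Submodule.span_le.2 ?_
    rintro _ ⟨U, hU, rfl⟩
    have key : inc U ∈ Submodule.span ℝ (sgn '' {T : Finset (Fin n) | #T ≤ #U}) := by
      clear hU
      induction U using Finset.induction_on with
      | empty =>
        refine Submodule.subset_span ⟨∅, by simp, ?_⟩
        ext b; simp [sgn, inc]
      | insert i U h ih =>
        have e : inc (insert i U) = (1 / 2 : ℝ) • (inc U - sgn {i} * inc U) := by
          rw [sgn_singleton, insert_eq, ← inc_mul_inc]
          ext b; simp; ring
        rw [e, card_insert_of_notMem h]
        refine Submodule.smul_mem _ _ (Submodule.sub_mem _ ?_ (sgn_singleton_mul_mem i ih))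
        exact Submodule.span_mono (Set.image_mono fun T (hT : #T ≤ #U) => Nat.le_succ_of_le hT) ih
    exact Submodule.span_mono (Set.image_mono fun T (hT : #T ≤ #U) => le_trans hT hU) key
  · refine Submodule.span_le.2 ?_
    rintro _ ⟨T, hT, rfl⟩
    exact Pol_mono hT (sgn_mem_Pol T)

/-- The average over all `r`-subsets. -/
noncomputable def avg {n : ℕ} (r : ℕ) : (Finset (Fin n) → ℝ) →ₗ[ℝ] ℝ :=
  ((n.choose r : ℝ)⁻¹) • ∑ x ∈ powersetCard r (univ : Finset (Fin n)), LinearMap.proj x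

theorem avg_apply {n r : ℕ} (f : Finset (Fin n) → ℝ) :
    avg r f = (n.choose r : ℝ)⁻¹ * ∑ x ∈ powersetCard r (univ : Finset (Fin n)), f x := by
  simp [avg]

theorem avg_congr {n r : ℕ} {f g : Finset (Fin n) → ℝ} (h : ∀ x, #x = r → f x = g x) :
    avg r f = avg r g := by
  rw [avg_apply, avg_apply]
  congr 1
  exact sum_congr rfl fun x hx => h x (mem_powersetCard.1 hx).2

theorem avg_const {n r : ℕ} (hr : r ≤ n) : avg r (1 : Finset (Fin n) → ℝ) = 1 := by
  rw [avg_apply]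
  have : (n.choose r : ℝ) ≠ 0 := by exact_mod_cast (Nat.choose_pos hr).ne'
  simp [this]

theorem card_powersetCard_filter_subset {n r : ℕ} (U : Finset (Fin n)) (h : #U ≤ r) :
    #{x ∈ powersetCard r (univ : Finset (Fin n)) | U ⊆ x} = (n - #U).choose (r - #U) := by
  have : (n - #U).choose (r - #U) = #(powersetCard (r - #U) Uᶜ) := by
    rw [card_powersetCard, card_compl, Fintype.card_fin]
  rw [this]
  refine card_bij' (fun x _ => x \ U) (fun x _ => x ∪ U) ?_ ?_ ?_ ?_
  · intro x hx
    simp only [mem_filter, mem_powersetCard] at hx ⊢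
    refine ⟨fun i => by simp, ?_⟩
    rw [card_sdiff_of_subset hx.2, hx.1.2]
  · intro x hx
    simp only [mem_filter, mem_powersetCard] at hx ⊢
    refine ⟨⟨subset_univ _, ?_⟩, subset_union_right⟩
    rw [card_union_of_disjoint (disjoint_left.2 fun i hi => by simpa using hx.1 hi), hx.2]
    omega
  · intro x hx
    exact sdiff_union_of_subset (mem_filter.1 hx).2
  · intro x hx
    exact union_sdiff_cancel_right
      (disjoint_left.2 fun i hi => by simpa using (mem_powersetCard.1 hx).1 hi)

/-- With falling factorials the formula needs no case distinction: the numerator vanishes by itself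
when `#U` exceeds `r`. -/
theorem avg_inc {n r : ℕ} (hr : r ≤ n) (U : Finset (Fin n)) :
    avg r (inc U) = (r.descFactorial #U : ℝ) / n.descFactorial #U := by
  have hn : #U ≤ n := by simpa using card_le_univ U
  have h0 : (n.choose r : ℝ) ≠ 0 := by exact_mod_cast (Nat.choose_pos hr).ne'
  have h1 : (n.descFactorial #U : ℝ) ≠ 0 := by
    exact_mod_cast (Nat.pos_of_ne_zero (by rw [Ne, Nat.descFactorial_eq_zero_iff_lt]; omega)).ne'
  rw [avg_apply]
  simp only [inc]
  rw [sum_boole]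
  by_cases h : #U ≤ r
  · rw [card_powersetCard_filter_subset U h, inv_mul_eq_div, div_eq_div_iff h0 h1]
    norm_cast
    rw [Nat.descFactorial_eq_factorial_mul_choose, Nat.descFactorial_eq_factorial_mul_choose]
    have := Nat.choose_mul (n := n) (k := r) (s := #U) h
    calc _ = (#U).factorial * (n.choose #U * (n - #U).choose (r - #U)) := by ring
      _ = _ := by rw [← this]; ring
  · rw [Nat.descFactorial_of_lt (by omega)]
    have : #{x ∈ powersetCard r (univ : Finset (Fin n)) | U ⊆ x} = 0 := by
      rw [card_eq_zero, filter_eq_empty_iff]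
      intro x hx hU
      have := card_le_card hU
      rw [(mem_powersetCard.1 hx).2] at this
      omega
    simp [this]

/-! ### Vertices of the cube as subsets -/

/-- The support of a vertex of the cube. -/
def supp {n : ℕ} (x : Cube n) : Finset (Fin n) := {i | x i = 1}

theorem supp_vertexOf {n : ℕ} (b : Finset (Fin n)) : supp (vertexOf b) = b := by
  ext i; simp [supp, vertexOf]

theorem vertexOf_supp {n : ℕ} (x : Cube n) : vertexOf (supp x) = x := by
  ext i
  have : x i = 0 ∨ x i = 1 := by
    generalize x i = a; revert a; decide
  rcases this with h | h <;> simp [supp, vertexOf, h]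

theorem vertexOf_injective {n : ℕ} : Function.Injective (vertexOf (n := n)) :=
  Function.LeftInverse.injective supp_vertexOf

theorem verticesOf_image_supp {n : ℕ} (Y : Finset (Cube n)) : verticesOf (Y.image supp) = Y := by
  simp only [verticesOf, image_image]
  rw [show vertexOf ∘ supp = (id : Cube n → Cube n) from funext vertexOf_supp, image_id]

theorem hammingDist_zero {n : ℕ} (x : Cube n) : hammingDist x 0 = #(supp x) := by
  rw [hammingDist, supp]
  congr 1
  ext i
  have : x i = 0 ∨ x i = 1 := by
    generalize x i = a; revert a; decide
  rcases this with h | h <;> simp [h]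

theorem hammingDist_vertexOf {n : ℕ} (b : Finset (Fin n)) : hammingDist (vertexOf b) 0 = #b := by
  rw [hammingDist_zero, supp_vertexOf]

theorem character_eq {n : ℕ} (T : Finset (Fin n)) (x : Cube n) :
    character T x = sgn T (supp x) := by
  simp [character, sgn, supp]

theorem shell_zero {n : ℕ} (r : ℕ) :
    shell (0 : Cube n) r = (powersetCard r univ).image vertexOf := by
  ext x
  simp only [shell, mem_filter, mem_univ, true_and, mem_image, mem_powersetCard, subset_univ,
    hammingDist_zero]
  constructor
  · intro h; exact ⟨supp x, h, vertexOf_supp x⟩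
  · rintro ⟨b, hb, rfl⟩; rwa [supp_vertexOf]

theorem sum_character_mul {n : ℕ} (T T' : Finset (Fin n)) :
    ∑ u : Cube n, character T u * character T' u = if T = T' then (2 : ℝ) ^ n else 0 := by
  have e : ∀ (T : Finset (Fin n)) (u : Cube n),
      character T u = ∏ i, if i ∈ T then (if u i = 1 then -1 else 1) else (1 : ℝ) := by
    intro T u
    rw [character, prod_ite_mem, univ_inter]
  simp only [e, ← prod_mul_distrib]
  rw [← Fintype.piFinset_univ, ← Finset.prod_univ_sum (fun _ => (univ : Finset (ZMod 2)))
    (fun i a => (if i ∈ T then (if a = 1 then -1 else 1) else (1 : ℝ)) *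
      (if i ∈ T' then (if a = 1 then -1 else 1) else (1 : ℝ)))]
  have s : ∀ i, ∑ a : ZMod 2, (if i ∈ T then (if a = 1 then -1 else 1) else (1 : ℝ)) *
      (if i ∈ T' then (if a = 1 then -1 else 1) else (1 : ℝ)) =
      if (i ∈ T ↔ i ∈ T') then 2 else 0 := by
    intro i
    rw [show (univ : Finset (ZMod 2)) = {0, 1} from rfl, sum_pair (by decide)]
    by_cases h : i ∈ T <;> by_cases h' : i ∈ T' <;> simp [h, h'] <;> norm_num
  simp only [s]
  split_ifs with h
  · subst h; simp
  · have : ∃ i, ¬ (i ∈ T ↔ i ∈ T') := by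
      by_contra! hc; exact h (Finset.ext hc)
    obtain ⟨i, hi⟩ := this
    exact prod_eq_zero (mem_univ i) (by simp [hi])

/-- The columns are combinations of characters, and orthogonality of the characters inverts this
expansion. -/
theorem harmonicSpace_eq (n l : ℕ) :
    harmonicSpace n l = Submodule.span ℝ (character '' {T : Finset (Fin n) | #T = l}) := by
  have col : ∀ u : Cube n, (fun x : Cube n => (2 : ℝ) ^ n * primitiveIdempotent n l x u) =
      ∑ T ∈ (univ : Finset (Fin n)).powersetCard l, character T u • character T := by
    intro u; ext x
    simp only [primitiveIdempotent, Matrix.of_apply, Finset.sum_apply, Pi.smul_apply, smul_eq_mul]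
    rw [mul_inv_cancel_left₀ (by positivity)]
    exact sum_congr rfl fun T _ => mul_comm _ _
  apply le_antisymm
  · refine Submodule.span_le.2 ?_
    rintro _ ⟨u, rfl⟩
    simp only [col]
    refine Submodule.sum_mem _ fun T hT => Submodule.smul_mem _ _ ?_
    exact Submodule.subset_span ⟨T, (mem_powersetCard.1 hT).2, rfl⟩
  · refine Submodule.span_le.2 ?_
    rintro _ ⟨T, hT, rfl⟩
    have e : character T = ((2 : ℝ) ^ n)⁻¹ • ∑ u : Cube n, character T u •
        (fun x : Cube n => (2 : ℝ) ^ n * primitiveIdempotent n l x u) := by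
      simp only [col, smul_sum, smul_smul]
      rw [sum_comm]
      simp only [← sum_smul, ← mul_sum, sum_character_mul]
      rw [sum_eq_single T]
      · simp
      · intro b _ hb; simp [Ne.symm hb]
      · intro h; exact absurd (mem_powersetCard.2 ⟨subset_univ _, hT⟩) h
    rw [e]
    exact Submodule.smul_mem _ _ (Submodule.sum_mem _ fun u _ =>
      Submodule.smul_mem _ _ (Submodule.subset_span ⟨u, rfl⟩))

theorem comp_vertexOf_mem_Pol {n l : ℕ} {f : Cube n → ℝ} (hf : f ∈ harmonicSpace n l) :
    (fun b => f (vertexOf b)) ∈ Pol n l := by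
  rw [harmonicSpace_eq] at hf
  have : Submodule.span ℝ (character '' {T : Finset (Fin n) | #T = l}) ≤
      (Pol n l).comap (LinearMap.funLeft ℝ ℝ vertexOf) := by
    refine Submodule.span_le.2 ?_
    rintro _ ⟨T, hT, rfl⟩
    have : LinearMap.funLeft ℝ ℝ vertexOf (character T) = sgn T := by
      ext b; simp [LinearMap.funLeft_apply, character_eq, supp_vertexOf]
    simp only [SetLike.mem_coe, Submodule.mem_comap, this]
    exact hT ▸ sgn_mem_Pol T
  exact this hf

/-- The definition tests degrees `1` to `t` only. Degree zero comes for free, because constants are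
averaged exactly on every shell, and the characters of weight at most `t` then span `Pol n t`. -/
theorem isRelativeDesign_iff {n t : ℕ} {R : Finset ℕ} {B : Finset (Finset (Fin n))}
    {w : Cube n → ℝ} :
    IsRelativeDesign 0 t R (verticesOf B) w ↔ (∀ b ∈ B, 0 < w (vertexOf b)) ∧ B.image card = R ∧
      ∀ f ∈ Pol n t, ∑ b ∈ B, w (vertexOf b) * avg #b f = ∑ b ∈ B, w (vertexOf b) * f b := by
  have himg : (verticesOf B).image (fun y => hammingDist y 0) = B.image card := by
    rw [verticesOf, image_image]
    exact image_congr fun b _ => hammingDist_vertexOf b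
  have hsh : ∀ r, verticesOf B ∩ shell 0 r = {b ∈ B | #b = r}.image vertexOf := by
    intro r
    ext x
    simp only [verticesOf, shell, mem_inter, mem_image, mem_filter, mem_univ, true_and]
    constructor
    · rintro ⟨⟨b, hb, rfl⟩, h⟩
      rw [hammingDist_vertexOf] at h
      exact ⟨b, ⟨hb, h⟩, rfl⟩
    · rintro ⟨b, ⟨hb, h⟩, rfl⟩
      exact ⟨⟨b, hb, rfl⟩, by rw [hammingDist_vertexOf, h]⟩
  have hcard : ∀ r, #(shell (0 : Cube n) r) = n.choose r := by
    intro r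
    rw [shell_zero, card_image_of_injective _ vertexOf_injective, card_powersetCard, card_univ,
      Fintype.card_fin]
  have key : B.image card = R → ∀ f : Cube n → ℝ,
      ∑ r ∈ R, (∑ y ∈ verticesOf B ∩ shell 0 r, w y) / (#(shell (0 : Cube n) r) : ℝ) *
        ∑ x ∈ shell 0 r, f x =
      ∑ b ∈ B, w (vertexOf b) * avg #b (fun b => f (vertexOf b)) := by
    intro hR f
    rw [← sum_fiberwise_of_maps_to (s := B) (t := R) (g := card)
      (fun b hb => hR ▸ mem_image_of_mem _ hb)]
    refine sum_congr rfl fun r _ => ?_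
    rw [hsh, hcard, shell_zero, sum_image fun _ _ _ _ h => vertexOf_injective h,
      sum_image fun _ _ _ _ h => vertexOf_injective h]
    have e : ∀ b ∈ {b ∈ B | #b = r}, w (vertexOf b) * avg #b (fun b => f (vertexOf b)) =
        w (vertexOf b) * avg r (fun b => f (vertexOf b)) :=
      fun b hb => by rw [(mem_filter.1 hb).2]
    rw [sum_congr rfl e, ← sum_mul, avg_apply]
    ring
  have key2 : ∀ f : Cube n → ℝ, ∑ y ∈ verticesOf B, w y * f y =
      ∑ b ∈ B, w (vertexOf b) * f (vertexOf b) := fun f => by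
    rw [verticesOf, sum_image fun _ _ _ _ h => vertexOf_injective h]
  constructor
  · intro h
    have hR := himg ▸ h.shells
    refine ⟨fun b hb => h.pos _ (mem_image_of_mem _ hb), hR, ?_⟩
    have : Pol n t ≤ LinearMap.eqLocus
        (∑ b ∈ B, w (vertexOf b) • avg #b : (Finset (Fin n) → ℝ) →ₗ[ℝ] ℝ)
        (∑ b ∈ B, w (vertexOf b) • LinearMap.proj b) := by
      rw [Pol_eq_span_sgn]
      refine Submodule.span_le.2 ?_
      rintro _ ⟨T, hT, rfl⟩
      simp only [SetLike.mem_coe, LinearMap.mem_eqLocus, LinearMap.sum_apply, LinearMap.smul_apply,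
        smul_eq_mul, LinearMap.proj_apply]
      have e : (fun b => character T (vertexOf b)) = sgn T := by
        ext b; rw [character_eq, supp_vertexOf]
      rcases Nat.eq_zero_or_pos #T with h0 | h0
      · rw [card_eq_zero] at h0
        have e1 : sgn (∅ : Finset (Fin n)) = 1 := by ext; simp [sgn]
        subst h0
        rw [e1]
        refine sum_congr rfl fun b _ => ?_
        rw [avg_const (by simpa using card_le_univ b)]; rfl
      · have := h.average #T h0 hT (character T)
          (by rw [harmonicSpace_eq]; exact Submodule.subset_span ⟨T, rfl, rfl⟩)
        rw [key hR, key2, e] at this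
        rw [this]
        exact sum_congr rfl fun b _ => by rw [← e]
    intro f hf
    simpa [LinearMap.mem_eqLocus] using this hf
  · rintro ⟨hpos, hR, h⟩
    refine ⟨?_, himg.trans hR, ?_⟩
    · intro y hy
      obtain ⟨b, hb, rfl⟩ := mem_image.1 hy
      exact hpos b hb
    · intro j _ hj f hf
      rw [key hR, key2]
      exact h _ (Pol_mono hj (comp_vertexOf_mem_Pol hf))

/-! ### The dimension condition -/

/-- This inclusion suffices for the passage from a tight design to dual functions. The reverse one
needs a condition on the shells, see `exists_mem_iSup_harmonicSpaceOn`. -/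
theorem iSup_harmonicSpaceOn_le {n e : ℕ} (R : Finset ℕ) :
    (⨆ l : {l : ℕ // l ≤ e ∧ e < l + #R}, harmonicSpaceOn (0 : Cube n) R (l : ℕ)) ≤
      (Pol n e).map (LinearMap.funLeft ℝ ℝ
        fun x : {x : Cube n // hammingDist x 0 ∈ R} => supp x.1) := by
  refine iSup_le ?_
  rintro ⟨l, hl, _⟩
  rintro _ ⟨f, hf, rfl⟩
  refine ⟨_, Pol_mono hl (comp_vertexOf_mem_Pol hf), ?_⟩
  ext x
  exact congrArg f (vertexOf_supp x.1)

theorem avg_mul_self_nonneg {n r : ℕ} (f : Finset (Fin n) → ℝ) : 0 ≤ avg r (f * f) := by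
  rw [avg_apply]
  exact mul_nonneg (by positivity) (sum_nonneg fun x _ => mul_self_nonneg (f x))

theorem eq_zero_of_avg_mul_self {n r : ℕ} (hr : r ≤ n) {f : Finset (Fin n) → ℝ}
    (h : avg r (f * f) = 0) {x : Finset (Fin n)} (hx : #x = r) : f x = 0 := by
  rw [avg_apply] at h
  have h0 : (n.choose r : ℝ)⁻¹ ≠ 0 :=
    inv_ne_zero (by exact_mod_cast (Nat.choose_pos hr).ne')
  have := (sum_eq_zero_iff_of_nonneg fun x _ => mul_self_nonneg (f x)).1
    ((mul_eq_zero.1 h).resolve_left h0) x (mem_powersetCard.2 ⟨subset_univ _, hx⟩)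
  exact mul_self_eq_zero.1 this

/-- The functions of degree at most `e` separate the points of a tight relative `2e`-design. -/
theorem exists_dual_of_tight {n e : ℕ} {R : Finset ℕ} {B : Finset (Finset (Fin n))}
    {w : Cube n → ℝ} (h : IsTightRelativeDesign 0 e R (verticesOf B) w) {y : Finset (Fin n)}
    (hy : y ∈ B) : ∃ f ∈ Pol n e, f y = 1 ∧ ∀ x ∈ B, x ≠ y → f x = 0 := by
  obtain ⟨hpos, hR, hbal⟩ := isRelativeDesign_iff.1 h.isRelativeDesign
  set V := ⨆ l : {l : ℕ // l ≤ e ∧ e < l + #R}, harmonicSpaceOn (0 : Cube n) R (l : ℕ) with hV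
  have hmem : ∀ b : B, hammingDist (vertexOf b.1) 0 ∈ R := fun b => by
    rw [hammingDist_vertexOf, ← hR]; exact mem_image_of_mem _ b.2
  let ρ : V →ₗ[ℝ] (B → ℝ) :=
    (LinearMap.funLeft ℝ ℝ fun b : B =>
      (⟨vertexOf b.1, hmem b⟩ : {x : Cube n // hammingDist x 0 ∈ R})) ∘ₗ
      V.subtype
  have hinj : Function.Injective ρ := by
    rw [← LinearMap.ker_eq_bot, LinearMap.ker_eq_bot']
    rintro ⟨g, hg⟩ h0
    obtain ⟨f, hf, rfl⟩ := iSup_harmonicSpaceOn_le R hg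
    have hf0 : ∀ b ∈ B, f b = 0 := by
      intro b hb
      have := congrFun h0 ⟨b, hb⟩
      change f (supp (vertexOf b)) = 0 at this
      rwa [supp_vertexOf] at this
    -- `f` vanishes on the design and `f * f` has degree `2 * e`, so the mean square of `f` is zero
    -- on every shell that is met.
    have hs := hbal (f * f) (mul_mem_Pol hf hf (two_mul e).symm)
    rw [sum_eq_zero (s := B) (f := fun b => w (vertexOf b) * (f * f) b)
      fun b hb => by simp [hf0 b hb]] at hs
    rw [sum_eq_zero_iff_of_nonneg
      fun b hb => mul_nonneg (hpos b hb).le (avg_mul_self_nonneg f)] at hs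
    ext ⟨x, hx⟩
    rw [hammingDist_zero, ← hR, mem_image] at hx
    obtain ⟨b, hb, hbx⟩ := hx
    have h1 := (mul_eq_zero.1 (hs b hb)).resolve_left (hpos b hb).ne'
    exact
      eq_zero_of_avg_mul_self (by simpa using card_le_univ b) h1 hbx.symm
  have hfin : Module.finrank ℝ V = Module.finrank ℝ (B → ℝ) := by
    rw [← h.card_eq, Module.finrank_fintype_fun_eq_card, Fintype.card_coe, verticesOf,
      card_image_of_injective _ vertexOf_injective]
  -- Tightness equates the two dimensions, so injectivity turns into interpolation.
  have hsurj := (LinearMap.injective_iff_surjective_of_finrank_eq_finrank hfin).1 hinj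
  obtain ⟨⟨g, hg⟩, hgy⟩ := hsurj (Pi.single ⟨y, hy⟩ 1)
  obtain ⟨f, hf, rfl⟩ := iSup_harmonicSpaceOn_le R hg
  have hval : ∀ b (hb : b ∈ B), f b = (Pi.single (⟨y, hy⟩ : B) (1 : ℝ) : B → ℝ) ⟨b, hb⟩ := by
    intro b hb
    have := congrFun hgy ⟨b, hb⟩
    change f (supp (vertexOf b)) = _ at this
    rwa [supp_vertexOf] at this
  refine ⟨f, hf, by simp [hval y hy], fun x hx hxy => ?_⟩
  rw [hval x hx, Pi.single_eq_of_ne]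
  simpa using hxy

theorem finrank_harmonicSpaceOn_le {n : ℕ} (R : Finset ℕ) (l : ℕ) :
    Module.finrank ℝ (harmonicSpaceOn (0 : Cube n) R l) ≤ n.choose l := by
  refine (Submodule.finrank_map_le _ _).trans ?_
  have : (character '' {T : Finset (Fin n) | #T = l}) =
      ((powersetCard l (univ : Finset (Fin n))).image character : Set (Cube n → ℝ)) := by
    ext f; simp
  rw [harmonicSpace_eq, this]
  refine (finrank_span_finset_le_card _).trans (card_image_le.trans ?_)
  simp

theorem sum_sgn_singleton {n : ℕ} (b : Finset (Fin n)) :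
    ∑ i, sgn {i} b = (n : ℝ) - 2 * #b := by
  simp only [sgn, prod_singleton]
  have : ∀ i, (if i ∈ b then (-1 : ℝ) else 1) = 1 - 2 * if i ∈ b then 1 else 0 := by
    intro i; split_ifs <;> norm_num
  simp only [this, sum_sub_distrib, ← mul_sum]
  simp

theorem sgn_pair {n : ℕ} {i j : Fin n} (h : i ≠ j) : sgn {i, j} = sgn {i} * sgn {j} :=
  sgn_insert (by simpa using h)

/-- On two shells with `(n - 2 r₁) (n - 2 r₂) ≠ -n`, every function of degree at most two is a
combination of characters of weight one and two. -/
theorem exists_mem_iSup_harmonicSpaceOn {n r₁ r₂ : ℕ} (h12 : r₁ ≠ r₂)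
    (hc : (n : ℝ) + (n - 2 * r₁) * (n - 2 * r₂) ≠ 0) {f : Finset (Fin n) → ℝ} (hf : f ∈ Pol n 2) :
    (fun x : {x : Cube n // hammingDist x 0 ∈ ({r₁, r₂} : Finset ℕ)} => f (supp x.1)) ∈
      ⨆ l : {l : ℕ // l ≤ 2 ∧ 2 < l + #({r₁, r₂} : Finset ℕ)},
        harmonicSpaceOn (0 : Cube n) {r₁, r₂} (l : ℕ) := by
  set V := ⨆ l : {l : ℕ // l ≤ 2 ∧ 2 < l + #({r₁, r₂} : Finset ℕ)},
        harmonicSpaceOn (0 : Cube n) {r₁, r₂} (l : ℕ) with hV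
  set res := LinearMap.funLeft ℝ ℝ
    fun x : {x : Cube n // hammingDist x 0 ∈ ({r₁, r₂} : Finset ℕ)} => supp x.1 with hres
  have hT : ∀ T : Finset (Fin n), #T = 1 ∨ #T = 2 → res (sgn T) ∈ V := by
    intro T hT
    have hl : #T ≤ 2 ∧ 2 < #T + #({r₁, r₂} : Finset ℕ) := by
      rw [card_pair h12]; omega
    refine Submodule.mem_iSup_of_mem
      (⟨#T, hl⟩ : {l : ℕ // l ≤ 2 ∧ 2 < l + #({r₁, r₂} : Finset ℕ)}) ?_
    refine ⟨character T, ?_, ?_⟩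
    · rw [SetLike.mem_coe, harmonicSpace_eq]
      exact Submodule.subset_span ⟨T, rfl, rfl⟩
    · ext x
      exact character_eq T x.1
  have h1 : res 1 ∈ V := by
    have hl : res (∑ i, sgn {i}) ∈ V := by
      rw [map_sum]
      exact Submodule.sum_mem _ fun i _ => hT _ (by simp)
    have hq : res (∑ i, ∑ j ∈ univ.erase i, sgn {i, j}) ∈ V := by
      rw [map_sum]
      refine Submodule.sum_mem _ fun i _ => ?_
      rw [map_sum]
      exact Submodule.sum_mem _ fun j hj => hT _ (Or.inr (card_pair (mem_erase.1 hj).1.symm))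
    -- Let s = n - 2|x|, with values s₁, s₂ on the shells. The pair sum is s² - n, and s² - (s₁ +
    -- s₂)s = -s₁s₂ on both shells. Hence the pair sum minus (s₁ + s₂)s is the constant -(n + s₁s₂),
    -- nonzero by `hc`.
    have e : res 1 = (-((n : ℝ) + (n - 2 * r₁) * (n - 2 * r₂))⁻¹) •
        (res (∑ i, ∑ j ∈ univ.erase i, sgn {i, j}) -
          (((n : ℝ) - 2 * r₁) + (n - 2 * r₂)) • res (∑ i, sgn {i})) := by
      ext ⟨x, hx⟩
      simp only [res, LinearMap.funLeft_apply, Pi.smul_apply, Pi.sub_apply, smul_eq_mul,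
        Finset.sum_apply, Pi.one_apply, sum_sgn_singleton]
      have hq' : ∑ i, ∑ j ∈ univ.erase i, sgn {i, j} (supp x) =
          ((n : ℝ) - 2 * #(supp x)) ^ 2 - n := by
        have e1 : ∀ i, ∑ j ∈ univ.erase i, sgn {i, j} (supp x) =
            sgn {i} (supp x) * ((n : ℝ) - 2 * #(supp x)) - 1 := by
          intro i
          rw [← sum_sgn_singleton, ← add_sum_erase univ _ (mem_univ i), mul_add, mul_sum,
            sum_congr rfl fun j hj => by rw [sgn_pair (mem_erase.1 hj).1.symm]]
          have : sgn {i} (supp x) * sgn {i} (supp x) = 1 := by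
            simp only [sgn, prod_singleton]; split_ifs <;> norm_num
          rw [this]
          simp
        simp only [e1, sum_sub_distrib, ← sum_mul, sum_sgn_singleton]
        simp; ring
      rw [hq']
      rw [hammingDist_zero, mem_insert, mem_singleton] at hx
      rw [neg_mul, eq_comm, neg_eq_iff_eq_neg, inv_mul_eq_iff_eq_mul₀ hc]
      rcases hx with hx | hx <;> rw [hx] <;> ring
    rw [e]
    exact V.smul_mem _ (V.sub_mem hq (V.smul_mem _ hl))
  have : Pol n 2 ≤ V.comap res := by
    rw [Pol_eq_span_sgn]
    refine Submodule.span_le.2 ?_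
    rintro _ ⟨T, hT2, rfl⟩
    rcases Nat.eq_zero_or_pos #T with h0 | h0
    · rw [card_eq_zero] at h0
      have e1 : sgn (∅ : Finset (Fin n)) = 1 := by ext; simp [sgn]
      rw [h0, e1]; exact h1
    · have : #T ≤ 2 := hT2
      exact hT T (by omega)
  exact this hf

/-- A set of `n + n(n-1)/2` points on two shells, separated by the functions of degree at most two,
has the cardinality of a tight relative `4`-design. -/
theorem card_eq_finrank {n r₁ r₂ : ℕ} (h12 : r₁ ≠ r₂)
    (hc : (n : ℝ) + (n - 2 * r₁) * (n - 2 * r₂) ≠ 0) {B : Finset (Finset (Fin n))}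
    (hcard : #B = n + n.choose 2) (hR : B.image card = {r₁, r₂})
    (hdual : ∀ y ∈ B, ∃ f ∈ Pol n 2, f y ≠ 0 ∧ ∀ x ∈ B, x ≠ y → f x = 0) :
    #(verticesOf B) = Module.finrank ℝ
      ↥(⨆ l : {l : ℕ // l ≤ 2 ∧ 2 < l + #({r₁, r₂} : Finset ℕ)},
        harmonicSpaceOn (0 : Cube n) {r₁, r₂} (l : ℕ)) := by
  set V := ⨆ l : {l : ℕ // l ≤ 2 ∧ 2 < l + #({r₁, r₂} : Finset ℕ)},
        harmonicSpaceOn (0 : Cube n) {r₁, r₂} (l : ℕ) with hV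
  rw [verticesOf, card_image_of_injective _ vertexOf_injective]
  apply le_antisymm
  -- Lower bound for the dimension: the dual functions restrict to multiples of the unit vectors, so
  -- restriction to `B` is onto.
  · have hmem : ∀ b : B, hammingDist (vertexOf b.1) 0 ∈ ({r₁, r₂} : Finset ℕ) := fun b => by
      rw [hammingDist_vertexOf, ← hR]; exact mem_image_of_mem _ b.2
    let ρ : V →ₗ[ℝ] (B → ℝ) :=
      (LinearMap.funLeft ℝ ℝ fun b : B => (⟨vertexOf b.1, hmem b⟩ :
        {x : Cube n // hammingDist x 0 ∈ ({r₁, r₂} : Finset ℕ)})) ∘ₗ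
        V.subtype
    have hsurj : Function.Surjective ρ := by
      rw [← LinearMap.range_eq_top, eq_top_iff, ← (Pi.basisFun ℝ B).span_eq]
      refine Submodule.span_le.2 ?_
      rintro _ ⟨⟨y, hy⟩, rfl⟩
      obtain ⟨f, hf, h0, hv⟩ := hdual y hy
      refine ⟨(f y)⁻¹ • ⟨_, exists_mem_iSup_harmonicSpaceOn h12 hc hf⟩, ?_⟩
      ext ⟨b, hb⟩
      simp only [map_smul, Pi.smul_apply, smul_eq_mul, Pi.basisFun_apply, ρ, LinearMap.comp_apply,
        Submodule.subtype_apply, LinearMap.funLeft_apply, supp_vertexOf]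
      by_cases hby : b = y
      · subst hby; simp [h0]
      · rw [hv b hb hby, Pi.single_eq_of_ne (by simpa using hby), mul_zero]
    have := LinearMap.finrank_le_finrank_of_surjective hsurj
    rwa [Module.finrank_fintype_fun_eq_card, Fintype.card_coe] at this
  · have hle : V ≤ harmonicSpaceOn (0 : Cube n) {r₁, r₂} 1 ⊔
        harmonicSpaceOn (0 : Cube n) {r₁, r₂} 2 := by
      refine iSup_le ?_
      rintro ⟨l, hl, hl'⟩
      rw [card_pair h12] at hl'
      obtain rfl | rfl : l = 1 ∨ l = 2 := by omega
      · exact le_sup_left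
      · exact le_sup_right
    have h1 := finrank_harmonicSpaceOn_le (n := n) {r₁, r₂} 1
    have h2 := finrank_harmonicSpaceOn_le (n := n) {r₁, r₂} 2
    have h3 := Submodule.finrank_add_le_finrank_add_finrank
      (harmonicSpaceOn (0 : Cube n) {r₁, r₂} 1) (harmonicSpaceOn (0 : Cube n) {r₁, r₂} 2)
    have h4 := Submodule.finrank_mono hle
    rw [Nat.choose_one_right] at h1
    omega

/-! ### Moments of intersection sizes over a shell -/

theorem cast_card_inter {n : ℕ} (x y : Finset (Fin n)) : (#(x ∩ y) : ℝ) = ∑ i ∈ y, inc {i} x := by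
  simp [inc, inter_comm]

theorem card_inter_mul_inc {n : ℕ} (y P : Finset (Fin n)) :
    (fun x => (#(x ∩ y) : ℝ) * inc P x) = ∑ i ∈ y, inc (insert i P) := by
  ext x
  rw [cast_card_inter, Finset.sum_apply, sum_mul]
  exact sum_congr rfl fun i _ => by rw [insert_eq, ← inc_mul_inc]; rfl

theorem sum_card_insert {n : ℕ} (y P : Finset (Fin n)) (F : ℕ → ℝ) :
    ∑ i ∈ y, F #(insert i P) = #(P ∩ y) * F #P + (#y - #(P ∩ y)) * F (#P + 1) := by
  have e1 : ∀ i ∈ {i ∈ y | i ∈ P}, F #(insert i P) = F #P := fun i hi => by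
    rw [insert_eq_of_mem (mem_filter.1 hi).2]
  have e2 : ∀ i ∈ {i ∈ y | i ∉ P}, F #(insert i P) = F (#P + 1) := fun i hi => by
    rw [card_insert_of_notMem (mem_filter.1 hi).2]
  rw [← sum_filter_add_sum_filter_not y (· ∈ P), sum_congr rfl e1, sum_congr rfl e2, sum_const,
    sum_const, nsmul_eq_mul, nsmul_eq_mul]
  have h := card_filter_add_card_filter_not (s := y) (· ∈ P)
  rw [filter_mem_eq_inter, inter_comm] at *
  rw [← h]; push_cast; ring

theorem avg_card_inter_mul_inc {n r : ℕ} (hr : r ≤ n) (y P : Finset (Fin n)) :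
    avg r (fun x => (#(x ∩ y) : ℝ) * inc P x) =
      #(P ∩ y) * ((r.descFactorial #P : ℝ) / n.descFactorial #P) +
      (#y - #(P ∩ y)) * ((r.descFactorial (#P + 1) : ℝ) / n.descFactorial (#P + 1)) := by
  rw [card_inter_mul_inc, map_sum]
  simp only [avg_inc hr]
  exact sum_card_insert y P fun k => (r.descFactorial k : ℝ) / n.descFactorial k

/-- One factor `#(x ∩ y)` is expanded over the points `i` of `y`, and each `i` is absorbed into `P`.
The cases `i ∈ P` and `i ∉ P` reduce to the first moment. -/
theorem avg_card_inter_sq_mul_inc {n r : ℕ} (hr : r ≤ n) (y P : Finset (Fin n)) :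
    avg r (fun x => (#(x ∩ y) : ℝ) ^ 2 * inc P x) =
      #(P ∩ y) * (#(P ∩ y) * ((r.descFactorial #P : ℝ) / n.descFactorial #P) +
        (#y - #(P ∩ y)) * ((r.descFactorial (#P + 1) : ℝ) / n.descFactorial (#P + 1))) +
      (#y - #(P ∩ y)) * ((#(P ∩ y) + 1) *
          ((r.descFactorial (#P + 1) : ℝ) / n.descFactorial (#P + 1)) +
        (#y - (#(P ∩ y) + 1)) *
          ((r.descFactorial (#P + 2) : ℝ) / n.descFactorial (#P + 2))) := by
  have e : (fun x => (#(x ∩ y) : ℝ) ^ 2 * inc P x) =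
      ∑ i ∈ y, fun x => (#(x ∩ y) : ℝ) * inc (insert i P) x := by
    ext x
    have h : (#(x ∩ y) : ℝ) * inc P x = ∑ i ∈ y, inc (insert i P) x := by
      rw [← Finset.sum_apply, ← card_inter_mul_inc]
    rw [Finset.sum_apply, ← mul_sum, ← h]; ring
  have h := card_filter_add_card_filter_not (s := y) (· ∈ P)
  have h2 : {i ∈ y | i ∈ P} = P ∩ y := by rw [filter_mem_eq_inter, inter_comm]
  have h3 : (#{i ∈ y | i ∉ P} : ℝ) = #y - #(P ∩ y) := by rw [← h, h2]; push_cast; ring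
  have e1 : ∀ i ∈ {i ∈ y | i ∈ P}, avg r (fun x => (#(x ∩ y) : ℝ) * inc (insert i P) x) =
      #(P ∩ y) * ((r.descFactorial #P : ℝ) / n.descFactorial #P) +
        (#y - #(P ∩ y)) * ((r.descFactorial (#P + 1) : ℝ) / n.descFactorial (#P + 1)) :=
    fun i hi => by rw [avg_card_inter_mul_inc hr, insert_eq_of_mem (mem_filter.1 hi).2]
  have e2 : ∀ i ∈ {i ∈ y | i ∉ P}, avg r (fun x => (#(x ∩ y) : ℝ) * inc (insert i P) x) =
      (#(P ∩ y) + 1) * ((r.descFactorial (#P + 1) : ℝ) / n.descFactorial (#P + 1)) +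
        (#y - (#(P ∩ y) + 1)) *
          ((r.descFactorial (#P + 2) : ℝ) / n.descFactorial (#P + 2)) := fun i hi => by
    have hi' := mem_filter.1 hi
    rw [avg_card_inter_mul_inc hr, card_insert_of_notMem hi'.2, insert_inter_of_mem hi'.1,
      card_insert_of_notMem fun hh => hi'.2 (mem_inter.1 hh).1]
    push_cast; rfl
  rw [e, map_sum, ← sum_filter_add_sum_filter_not y (· ∈ P), sum_congr rfl e1, sum_congr rfl e2,
    sum_const, sum_const, nsmul_eq_mul, nsmul_eq_mul, h2, h3]

theorem cast_descFactorial_succ (r k : ℕ) :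
    (r.descFactorial (k + 1) : ℝ) = (r - k) * r.descFactorial k := by
  rw [Nat.descFactorial_succ]
  rcases le_or_gt k r with h | h
  · push_cast [h]; ring
  · simp [Nat.descFactorial_of_lt h]

/-! ### The reproducing kernel of two shells of the 22-cube -/

/-- The degree-two Hahn polynomial for a `q`-set against `r`-sets of a 22-set. -/
noncomputable def hahn (q r u : ℝ) : ℝ :=
  u * (u - 1) - (q - 1) * (r - 1) / 10 * u + q * (q - 1) * r * (r - 1) / 420

/-- The degree-one part of the kernel on a shell. -/
noncomputable def linKer (q u : ℝ) : ℝ := 1 + 21 * (1 - (q - u) * 22 / (q * (22 - q)))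

/-- The norm of the degree-two harmonics on a shell, up to a constant. -/
def shellNorm (r : ℝ) : ℝ := r * (r - 1) * (22 - r) * (21 - r)

theorem quadratic_mul_inc_eq {n : ℕ} (y P : Finset (Fin n)) (α β γ : ℝ) :
    (fun x => (α * (#(x ∩ y) : ℝ) ^ 2 + β * #(x ∩ y) + γ) * inc P x) =
      α • (fun x => (#(x ∩ y) : ℝ) ^ 2 * inc P x) + β • (fun x => (#(x ∩ y) : ℝ) * inc P x) +
        γ • inc P := by
  ext x; simp; ring

/-- The Hahn polynomial is orthogonal to degree at most one, and against degree two the shell enters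
only through the factor `shellNorm r`. The pairings on the two shells are therefore proportional, so
one multiple of the Hahn polynomial can serve both. Here 209 = C(22,2) - 22 and 420 = 21 · 20. -/
theorem avg_hahn_mul_inc {r : ℕ} (hr : r ≤ 22) (y P : Finset (Fin 22)) (hP : #P ≤ 2) :
    avg r (fun x => hahn #y r #(x ∩ y) * inc P x) = shellNorm r *
      if #P = 2 then
        (if #(P ∩ y) = 2 then (21 - #y) * (22 - #y) else
          if #(P ∩ y) = 1 then -((#y - 1) * (21 - #y)) else #y * (#y - 1) : ℝ) / (209 * 420 * 420)
      else 0 := by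
  have e : (fun x => hahn #y r #(x ∩ y) * inc P x) =
      fun x => (1 * (#(x ∩ y) : ℝ) ^ 2 + (-1 - ((#y : ℝ) - 1) * (r - 1) / 10) * #(x ∩ y) +
        #y * (#y - 1) * r * (r - 1) / 420) * inc P x := by
    ext x; rw [hahn]; ring
  have hj : #(P ∩ y) ≤ #P := card_le_card inter_subset_left
  rw [e, quadratic_mul_inc_eq, map_add, map_add, map_smul, map_smul, map_smul,
    avg_card_inter_sq_mul_inc hr, avg_card_inter_mul_inc hr, avg_inc hr, shellNorm]
  generalize #P = p at *
  generalize #(P ∩ y) = j at *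
  interval_cases p <;> interval_cases j <;>
    simp [cast_descFactorial_succ, -Nat.descFactorial_succ] <;> ring

/-- The linear kernel reproduces degree at most one. Its defect in degree two is a multiple of the
pairing in `avg_hahn_mul_inc`, so a Hahn term can repair it. -/
theorem avg_linKer_mul_inc {y : Finset (Fin 22)} (h0 : 0 < #y) (h1 : #y < 22)
    (P : Finset (Fin 22)) (hP : #P ≤ 2) :
    avg #y (fun x => linKer #y #(x ∩ y) * inc P x) = inc P y -
      if #P = 2 then
        (if #(P ∩ y) = 2 then (21 - #y) * (22 - #y) else
          if #(P ∩ y) = 1 then -((#y - 1) * (21 - #y)) else #y * (#y - 1) : ℝ) / 420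
      else 0 := by
  have e : (fun x => linKer #y #(x ∩ y) * inc P x) =
      fun x => (0 * (#(x ∩ y) : ℝ) ^ 2 + (462 / ((#y : ℝ) * (22 - #y))) * #(x ∩ y) +
        (22 - 462 / (22 - #y))) * inc P x := by
    ext x
    have h0' : (#y : ℝ) ≠ 0 := by positivity
    have h1' : (22 - #y : ℝ) ≠ 0 := by
      have : (#y : ℝ) < 22 := by exact_mod_cast h1
      linarith
    rw [linKer]; field_simp; ring
  have hj : #(P ∩ y) ≤ #P := card_le_card inter_subset_left
  have hi : inc P y = if #(P ∩ y) = #P then (1 : ℝ) else 0 := by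
    rw [inc]
    congr 1
    rw [← inter_eq_left, eq_iff_iff]
    exact ⟨fun h => by rw [h], fun h => eq_of_subset_of_card_le inter_subset_left h.ge⟩
  rw [e, quadratic_mul_inc_eq, map_add, map_add, map_smul, map_smul, map_smul,
    avg_card_inter_sq_mul_inc h1.le, avg_card_inter_mul_inc h1.le, avg_inc h1.le, hi]
  have h0' : (#y : ℝ) ≠ 0 := by positivity
  have h1' : (22 - #y : ℝ) ≠ 0 := by
    have : (#y : ℝ) < 22 := by exact_mod_cast h1
    linarith
  generalize (#y : ℕ) = q at *
  generalize #P = p at *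
  generalize #(P ∩ y) = j at *
  interval_cases p <;> interval_cases j <;>
    simp [cast_descFactorial_succ, -Nat.descFactorial_succ] <;> field_simp <;> ring

theorem card_inter_mem_Pol {n t : ℕ} (ht : 1 ≤ t) (y : Finset (Fin n)) :
    (fun x : Finset (Fin n) => (#(x ∩ y) : ℝ)) ∈ Pol n t := by
  have : (fun x : Finset (Fin n) => (#(x ∩ y) : ℝ)) = ∑ i ∈ y, inc {i} := by
    ext x; rw [cast_card_inter, Finset.sum_apply]
  rw [this]
  exact Submodule.sum_mem _ fun i _ => inc_mem_Pol (by simpa using ht)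

/-- Quadratic functions of `#(x ∩ y)`, whose lower coefficients may depend on the shell of `x`, have
degree at most two. -/
theorem exists_quadratic_mem_Pol {n r₁ r₂ : ℕ} (h : r₁ ≠ r₂) (y : Finset (Fin n))
    (c a₁ a₂ b₁ b₂ : ℝ) : ∃ f ∈ Pol n 2, ∀ x : Finset (Fin n),
      (#x = r₁ → f x = c * (#(x ∩ y) : ℝ) ^ 2 + a₁ * #(x ∩ y) + b₁) ∧
      (#x = r₂ → f x = c * (#(x ∩ y) : ℝ) ^ 2 + a₂ * #(x ∩ y) + b₂) := by
  have h' : (r₂ : ℝ) - r₁ ≠ 0 := sub_ne_zero.2 (by exact_mod_cast h.symm)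
  let u : Finset (Fin n) → ℝ := fun x => #(x ∩ y)
  let s : Finset (Fin n) → ℝ := fun x => #(x ∩ univ)
  have hu : u ∈ Pol n 1 := card_inter_mem_Pol le_rfl y
  have hs : s ∈ Pol n 1 := card_inter_mem_Pol le_rfl univ
  -- Since `#x` has degree one, Lagrange interpolation in it gives degree-one functions that agree
  -- with the indicators of the two shells there. The coefficient of the square cannot vary with the
  -- shell without raising the degree.
  let e₁ : Finset (Fin n) → ℝ := ((r₂ : ℝ) - r₁)⁻¹ • ((fun _ => (r₂ : ℝ)) - s)
  let e₂ : Finset (Fin n) → ℝ := ((r₂ : ℝ) - r₁)⁻¹ • (s - fun _ => (r₁ : ℝ))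
  have he₁ : e₁ ∈ Pol n 1 := Submodule.smul_mem _ _ (Submodule.sub_mem _ (const_mem_Pol _) hs)
  have he₂ : e₂ ∈ Pol n 1 := Submodule.smul_mem _ _ (Submodule.sub_mem _ hs (const_mem_Pol _))
  refine ⟨u * (c • u + (a₁ • e₁ + a₂ • e₂)) + (b₁ • e₁ + b₂ • e₂), ?_, fun x => ⟨?_, ?_⟩⟩
  · refine Submodule.add_mem _ (mul_mem_Pol hu ?_ one_add_one_eq_two) (Pol_mono one_le_two ?_)
    · exact Submodule.add_mem _ (Submodule.smul_mem _ _ hu)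
        (Submodule.add_mem _ (Submodule.smul_mem _ _ he₁) (Submodule.smul_mem _ _ he₂))
    · exact Submodule.add_mem _ (Submodule.smul_mem _ _ he₁) (Submodule.smul_mem _ _ he₂)
  · intro hx
    have h1 : e₁ x = 1 := by simp [e₁, s, hx, h']
    have h2 : e₂ x = 0 := by simp [e₂, s, hx]
    simp [h1, h2, u]; ring
  · intro hx
    have h1 : e₁ x = 0 := by simp [e₁, s, hx]
    have h2 : e₂ x = 1 := by simp [e₂, s, hx, h']
    simp [h1, h2, u]; ring

/-! ### Consequences of tightness: weights, shell sizes and intersection numbers -/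

/-- The properties of a tight relative `4`-design on two shells of the 22-cube that are used in the
classification. -/
structure TwoShell (r₁ r₂ : ℕ) (B : Finset (Finset (Fin 22))) (v : Finset (Fin 22) → ℝ) :
    Prop where
  ne : r₁ ≠ r₂
  two_le₁ : 2 ≤ r₁
  two_le₂ : 2 ≤ r₂
  le₁ : r₁ ≤ 20
  le₂ : r₂ ≤ 20
  pos : ∀ b ∈ B, 0 < v b
  sizes : B.image card = {r₁, r₂}
  bal : ∀ f ∈ Pol 22 4, ∑ b ∈ B, v b * avg #b f = ∑ b ∈ B, v b * f b
  dual : ∀ y ∈ B, ∃ f ∈ Pol 22 2, f y = 1 ∧ ∀ x ∈ B, x ≠ y → f x = 0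

/-- The total weight on a shell. -/
noncomputable def shellWeight (B : Finset (Finset (Fin 22))) (v : Finset (Fin 22) → ℝ) (r : ℕ) :
    ℝ :=
  ∑ b ∈ B with #b = r, v b

/-- The reproducing kernel for functions of degree at most two, at a point of the shell `r₁`. -/
noncomputable def kernel (r₁ r₂ : ℕ) (W₁ W₂ : ℝ) (y x : Finset (Fin 22)) : ℝ :=
  (if #x = r₁ then linKer r₁ #(x ∩ y) / W₁ else 0) +
    209 * 420 / (W₁ * shellNorm r₁ + W₂ * shellNorm r₂) * hahn r₁ #x #(x ∩ y)

theorem shellNorm_pos {r : ℕ} (h : 2 ≤ r) (h' : r ≤ 20) : 0 < shellNorm r := by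
  have h1 : (2 : ℝ) ≤ r := by exact_mod_cast h
  have h2 : (r : ℝ) ≤ 20 := by exact_mod_cast h'
  have a : (0 : ℝ) < r - 1 := by linarith
  have b : (0 : ℝ) < 22 - r := by linarith
  have c : (0 : ℝ) < 21 - r := by linarith
  rw [shellNorm]; positivity

namespace TwoShell

variable {r₁ r₂ : ℕ} {B : Finset (Finset (Fin 22))} {v : Finset (Fin 22) → ℝ}

theorem symm (h : TwoShell r₁ r₂ B v) : TwoShell r₂ r₁ B v :=
  ⟨h.ne.symm, h.two_le₂, h.two_le₁, h.le₂, h.le₁, h.pos, by rw [h.sizes, pair_comm], h.bal, h.dual⟩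

theorem card_mem (h : TwoShell r₁ r₂ B v) {b : Finset (Fin 22)} (hb : b ∈ B) :
    #b = r₁ ∨ #b = r₂ := by
  have := mem_image_of_mem card hb
  rw [h.sizes] at this
  simpa using this

theorem exists_mem (h : TwoShell r₁ r₂ B v) : ∃ b ∈ B, #b = r₁ := by
  have : r₁ ∈ B.image card := by rw [h.sizes]; simp
  simpa using this

theorem shellWeight_pos (h : TwoShell r₁ r₂ B v) : 0 < shellWeight B v r₁ := by
  obtain ⟨b, hb, hr⟩ := h.exists_mem
  exact sum_pos (fun b hb => h.pos b (mem_filter.1 hb).1) ⟨b, mem_filter.2 ⟨hb, hr⟩⟩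

theorem sum_eq (h : TwoShell r₁ r₂ B v) (F : Finset (Fin 22) → ℝ) :
    ∑ b ∈ B, F b = ∑ b ∈ B with #b = r₁, F b + ∑ b ∈ B with #b = r₂, F b := by
  rw [← sum_filter_add_sum_filter_not B (fun b => #b = r₁)]
  congr 2
  ext b
  simp only [mem_filter]
  constructor
  · rintro ⟨hb, hne⟩; exact ⟨hb, (h.card_mem hb).resolve_left hne⟩
  · rintro ⟨hb, he⟩; exact ⟨hb, by rw [he]; exact h.ne.symm⟩

theorem sum_avg_eq (h : TwoShell r₁ r₂ B v) (f : Finset (Fin 22) → ℝ) :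
    ∑ b ∈ B, v b * avg #b f =
      shellWeight B v r₁ * avg r₁ f + shellWeight B v r₂ * avg r₂ f := by
  have e : ∀ r, ∑ b ∈ B with #b = r, v b * avg #b f = shellWeight B v r * avg r f := by
    intro r
    rw [shellWeight, sum_mul]
    exact sum_congr rfl fun b hb => by rw [(mem_filter.1 hb).2]
  rw [h.sum_eq, e, e]

theorem norm_pos (h : TwoShell r₁ r₂ B v) :
    0 < shellWeight B v r₁ * shellNorm r₁ + shellWeight B v r₂ * shellNorm r₂ :=
  add_pos (mul_pos h.shellWeight_pos (shellNorm_pos h.two_le₁ h.le₁))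
    (mul_pos h.symm.shellWeight_pos (shellNorm_pos h.two_le₂ h.le₂))

/-- The defect of the linear kernel arises on the shell of `y` only, while both shells contribute to
the Hahn pairing. Their total is proportional to `W₁ * shellNorm r₁ + W₂ * shellNorm r₂`, which
explains the denominator in `kernel`. -/
theorem avg_kernel_mul_inc (h : TwoShell r₁ r₂ B v) {y : Finset (Fin 22)} (hy : #y = r₁)
    {P : Finset (Fin 22)} (hP : #P ≤ 2) :
    shellWeight B v r₁ * avg r₁ (fun x =>
        kernel r₁ r₂ (shellWeight B v r₁) (shellWeight B v r₂) y x * inc P x) +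
      shellWeight B v r₂ * avg r₂ (fun x =>
        kernel r₁ r₂ (shellWeight B v r₁) (shellWeight B v r₂) y x * inc P x) = inc P y := by
  have hS := h.norm_pos
  have hW := h.shellWeight_pos
  set W₁ := shellWeight B v r₁
  set W₂ := shellWeight B v r₂
  set S := W₁ * shellNorm r₁ + W₂ * shellNorm r₂ with hSdef
  have e1 : avg r₁ (fun x => kernel r₁ r₂ W₁ W₂ y x * inc P x) =
      avg r₁ (W₁⁻¹ • (fun x => linKer #y #(x ∩ y) * inc P x) +
        (209 * 420 / S) • fun x => hahn #y r₁ #(x ∩ y) * inc P x) := by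
    refine avg_congr fun x hx => ?_
    simp only [kernel, hx, if_true, hy, Pi.add_apply, Pi.smul_apply, smul_eq_mul]
    ring
  have e2 : avg r₂ (fun x => kernel r₁ r₂ W₁ W₂ y x * inc P x) =
      avg r₂ ((209 * 420 / S) • fun x => hahn #y r₂ #(x ∩ y) * inc P x) := by
    refine avg_congr fun x hx => ?_
    simp only [kernel, hx, if_neg h.ne.symm, hy, Pi.smul_apply, smul_eq_mul]
    ring
  have h1 := h.two_le₁
  have h2 := h.le₁
  have h3 := avg_linKer_mul_inc (y := y) (by omega) (by omega) P hP
  rw [e1, e2, map_add, map_smul, map_smul, map_smul, avg_hahn_mul_inc (by omega) y P hP,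
    avg_hahn_mul_inc (by have := h.le₂; omega) y P hP, smul_eq_mul, smul_eq_mul, smul_eq_mul]
  rw [hy] at h3 ⊢
  rw [h3]
  generalize (if #(P ∩ y) = 2 then ((21 - r₁) * (22 - r₁) : ℝ) else _) = g
  have hS' : S ≠ 0 := hS.ne'
  have hW' : W₁ ≠ 0 := hW.ne'
  split_ifs with hp
  · field_simp
    rw [hSdef]; ring
  · simp [hW']

/-- The kernel times a function `f` of degree two has degree four, so the weighted sum over the
design reproduces `f y`. For `f` dual to `x` this sum has a single term. -/
theorem kernel_eq (h : TwoShell r₁ r₂ B v) {x y : Finset (Fin 22)} (hx : x ∈ B) (hy : y ∈ B)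
    (hyr : #y = r₁) :
    v x * kernel r₁ r₂ (shellWeight B v r₁) (shellWeight B v r₂) y x = if x = y then 1 else 0 := by
  set W₁ := shellWeight B v r₁
  set W₂ := shellWeight B v r₂
  obtain ⟨k, hk, hkv⟩ : ∃ k ∈ Pol 22 2, ∀ z : Finset (Fin 22), #z = r₁ ∨ #z = r₂ →
      k z = kernel r₁ r₂ W₁ W₂ y z := by
    -- The arguments below are the coefficients of the kernel as a polynomial in `#(z ∩ y)` on each
    -- shell. The leading coefficient `C` is common to both, as `exists_quadratic_mem_Pol` requires.
    set C := 209 * 420 / (W₁ * shellNorm r₁ + W₂ * shellNorm r₂) with hC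
    obtain ⟨k, hk, hkv⟩ := exists_quadratic_mem_Pol h.ne y C
      (21 * 22 / (r₁ * (22 - r₁)) / W₁ + C * (-1 - (r₁ - 1) * (r₁ - 1) / 10))
      (C * (-1 - (r₁ - 1) * (r₂ - 1) / 10))
      ((22 - 21 * r₁ * 22 / (r₁ * (22 - r₁))) / W₁ + C * (r₁ * (r₁ - 1) * r₁ * (r₁ - 1) / 420))
      (C * (r₁ * (r₁ - 1) * r₂ * (r₂ - 1) / 420))
    refine ⟨k, hk, fun z hz => ?_⟩
    rcases hz with hz | hz
    · rw [(hkv z).1 hz, kernel, if_pos hz, hz, ← hC, hahn, linKer]; ring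
    · rw [(hkv z).2 hz, kernel, if_neg (by rw [hz]; exact h.ne.symm), hz, ← hC, hahn]; ring
  have repr : ∀ f ∈ Pol 22 2, ∑ b ∈ B, v b * (k b * f b) = f y := by
    intro f hf
    have hm := h.bal (k * f) (mul_mem_Pol hk hf rfl)
    simp only [Pi.mul_apply] at hm
    rw [← hm, h.sum_avg_eq]
    have hle : Pol 22 2 ≤ LinearMap.eqLocus
        (W₁ • (avg r₁ ∘ₗ LinearMap.mulLeft ℝ k) + W₂ • (avg r₂ ∘ₗ LinearMap.mulLeft ℝ k))
        (LinearMap.proj y) := by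
      refine Submodule.span_le.2 ?_
      rintro _ ⟨P, hP, rfl⟩
      have := h.avg_kernel_mul_inc hyr (P := P) hP
      simp only [SetLike.mem_coe, LinearMap.mem_eqLocus, LinearMap.add_apply, LinearMap.smul_apply,
        LinearMap.comp_apply, LinearMap.mulLeft_apply, smul_eq_mul, LinearMap.proj_apply]
      rw [← this]
      congr 2
      · exact avg_congr fun z hz => by rw [Pi.mul_apply, hkv z (Or.inl hz)]
      · exact avg_congr fun z hz => by rw [Pi.mul_apply, hkv z (Or.inr hz)]
    have := hle hf
    simpa [LinearMap.mem_eqLocus] using this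
  obtain ⟨f, hf, hfx, hf0⟩ := h.dual x hx
  have := repr f hf
  rw [sum_eq_single_of_mem x hx fun b hb hne => by rw [hf0 b hb hne]; ring, hfx, mul_one,
    hkv x (h.card_mem hx)] at this
  rw [this]
  split_ifs with hxy
  · rw [← hxy, hfx]
  · exact hf0 y hy fun e => hxy e.symm

theorem hahn_self (q : ℝ) : hahn q q q = shellNorm q / 420 := by
  rw [hahn, shellNorm]; ring

/-- The diagonal of `kernel_eq`: 22 is the diagonal value of the linear kernel, and the rest is the
Hahn term. In particular the weight depends on the shell only. -/
theorem weight_mul (h : TwoShell r₁ r₂ B v) {y : Finset (Fin 22)} (hy : y ∈ B) (hyr : #y = r₁) :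
    v y * (22 / shellWeight B v r₁ + 209 * shellNorm r₁ /
      (shellWeight B v r₁ * shellNorm r₁ + shellWeight B v r₂ * shellNorm r₂)) = 1 := by
  have := h.kernel_eq hy hy hyr
  rw [if_pos rfl, kernel, if_pos hyr, inter_self, hyr, hahn_self, linKer] at this
  rw [← this]; ring

/-- The number of points on a shell. -/
theorem card_shell (h : TwoShell r₁ r₂ B v) :
    (#{b ∈ B | #b = r₁} : ℝ) = 22 + 209 * (shellWeight B v r₁ * shellNorm r₁) /
      (shellWeight B v r₁ * shellNorm r₁ + shellWeight B v r₂ * shellNorm r₂) := by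
  have hW := h.shellWeight_pos
  have hS := h.norm_pos
  have e : ∑ b ∈ B with #b = r₁, v b * (22 / shellWeight B v r₁ + 209 * shellNorm r₁ /
      (shellWeight B v r₁ * shellNorm r₁ + shellWeight B v r₂ * shellNorm r₂)) =
      #{b ∈ B | #b = r₁} := by
    rw [card_eq_sum_ones, Nat.cast_sum]
    refine sum_congr rfl fun b hb => ?_
    rw [h.weight_mul (mem_filter.1 hb).1 (mem_filter.1 hb).2, Nat.cast_one]
  rw [← e, ← sum_mul]
  change shellWeight B v r₁ * _ = _
  field_simp

theorem weight_eq (h : TwoShell r₁ r₂ B v) {y : Finset (Fin 22)} (hy : y ∈ B) (hyr : #y = r₁) :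
    v y * #{b ∈ B | #b = r₁} = shellWeight B v r₁ := by
  have hW := h.shellWeight_pos
  have := h.weight_mul hy hyr
  rw [h.card_shell]
  calc _ = (v y * (22 / shellWeight B v r₁ + 209 * shellNorm r₁ /
      (shellWeight B v r₁ * shellNorm r₁ + shellWeight B v r₂ * shellNorm r₂))) *
        shellWeight B v r₁ := by field_simp
    _ = _ := by rw [this, one_mul]

/-- Each shell contributes 22, and the fractions of 209 on the two shells add up to the whole. -/
theorem card_add_card (h : TwoShell r₁ r₂ B v) :
    #{b ∈ B | #b = r₁} + #{b ∈ B | #b = r₂} = 253 := by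
  have h1 := h.card_shell
  have h2 := h.symm.card_shell
  have hS := h.norm_pos
  rw [add_comm (shellWeight B v r₂ * _)] at h2
  have : (#{b ∈ B | #b = r₁} : ℝ) + #{b ∈ B | #b = r₂} = 253 := by
    rw [h1, h2]; field_simp; ring
  exact_mod_cast this

theorem lt_card (h : TwoShell r₁ r₂ B v) : 22 < #{b ∈ B | #b = r₁} := by
  have h1 := h.card_shell
  have hS := h.norm_pos
  have := mul_pos h.shellWeight_pos (shellNorm_pos h.two_le₁ h.le₁)
  have : (22 : ℝ) < #{b ∈ B | #b = r₁} := by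
    rw [h1]
    have : 0 < 209 * (shellWeight B v r₁ * shellNorm r₁) /
      (shellWeight B v r₁ * shellNorm r₁ + shellWeight B v r₂ * shellNorm r₂) := by positivity
    linarith
  exact_mod_cast this

/-- The intersection numbers within a shell. -/
theorem own_eq (h : TwoShell r₁ r₂ B v) {x y : Finset (Fin 22)} (hx : x ∈ B) (hy : y ∈ B)
    (hxr : #x = r₁) (hyr : #y = r₁) (hxy : x ≠ y) :
    22 * ((r₁ : ℤ) * (r₁ - 1) * (22 - r₁) * (21 - r₁)) -
      462 * (r₁ - #(x ∩ y)) * (r₁ - 1) * (21 - r₁) + (#{b ∈ B | #b = r₁} - 22) *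
        (420 * #(x ∩ y) * (#(x ∩ y) - 1) - 42 * (r₁ - 1) ^ 2 * #(x ∩ y) +
          r₁ ^ 2 * (r₁ - 1) ^ 2) = 0 := by
  have hk := h.kernel_eq hx hy hyr
  rw [if_neg hxy, mul_eq_zero, or_iff_right (h.pos x hx).ne', kernel, if_pos hxr, hxr] at hk
  have hW := h.shellWeight_pos
  have hS := h.norm_pos
  have hN : (#{b ∈ B | #b = r₁} : ℝ) - 22 = shellWeight B v r₁ * shellNorm r₁ * (209 /
      (shellWeight B v r₁ * shellNorm r₁ + shellWeight B v r₂ * shellNorm r₂)) := by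
    rw [h.card_shell]; ring
  have h1 : (2 : ℝ) ≤ r₁ := by exact_mod_cast h.two_le₁
  have h2 : (r₁ : ℝ) ≤ 20 := by exact_mod_cast h.le₁
  have h3 : (0 : ℝ) < 22 - r₁ := by linarith
  have h4 : (0 : ℝ) < r₁ := by linarith
  have e : (22 * ((r₁ : ℝ) * (r₁ - 1) * (22 - r₁) * (21 - r₁)) -
      462 * (r₁ - #(x ∩ y)) * (r₁ - 1) * (21 - r₁) + (#{b ∈ B | #b = r₁} - 22) *
        (420 * #(x ∩ y) * (#(x ∩ y) - 1) - 42 * (r₁ - 1) ^ 2 * #(x ∩ y) +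
          r₁ ^ 2 * (r₁ - 1) ^ 2)) = shellWeight B v r₁ * shellNorm r₁ *
      (linKer r₁ #(x ∩ y) / shellWeight B v r₁ + 209 * 420 /
      (shellWeight B v r₁ * shellNorm r₁ + shellWeight B v r₂ * shellNorm r₂) *
        hahn r₁ r₁ #(x ∩ y)) := by
    have : shellNorm r₁ * linKer r₁ #(x ∩ y) =
        22 * ((r₁ : ℝ) * (r₁ - 1) * (22 - r₁) * (21 - r₁)) -
          462 * (r₁ - #(x ∩ y)) * (r₁ - 1) * (21 - r₁) := by
      rw [shellNorm, linKer]; field_simp; ring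
    rw [hN, ← this, hahn]
    generalize shellNorm (r₁ : ℝ) = a at *
    field_simp
    ring
  rw [hk, mul_zero] at e
  exact_mod_cast e

/-- The intersection numbers between the shells. -/
theorem cross_eq (h : TwoShell r₁ r₂ B v) {x y : Finset (Fin 22)} (hx : x ∈ B) (hy : y ∈ B)
    (hxr : #x = r₂) (hyr : #y = r₁) :
    420 * (#(x ∩ y) : ℤ) * (#(x ∩ y) - 1) - 42 * (r₁ - 1) * (r₂ - 1) * #(x ∩ y) +
      r₁ * (r₁ - 1) * r₂ * (r₂ - 1) = 0 := by
  have hxy : x ≠ y := by rintro rfl; exact h.ne (hyr.symm.trans hxr)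
  have hk := h.kernel_eq hx hy hyr
  rw [if_neg hxy, mul_eq_zero, or_iff_right (h.pos x hx).ne', kernel,
    if_neg (by rw [hxr]; exact h.ne.symm), hxr, zero_add, mul_eq_zero,
    or_iff_right (div_pos (by norm_num) h.norm_pos).ne', hahn] at hk
  have : (420 * (#(x ∩ y) : ℝ) * (#(x ∩ y) - 1) - 42 * (r₁ - 1) * (r₂ - 1) * #(x ∩ y) +
      r₁ * (r₁ - 1) * r₂ * (r₂ - 1)) = 0 := by linear_combination 420 * hk
  exact_mod_cast this

/-- The test function equals `#(x ∩ y)` on shell `r₂` and zero on shell `r₁`. Its weighted sum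
becomes a plain sum because the weight is constant on a shell. -/
theorem sum_card_inter (h : TwoShell r₁ r₂ B v) (y : Finset (Fin 22)) :
    ∑ x ∈ B with #x = r₂, (#(x ∩ y) : ℝ) = #{b ∈ B | #b = r₂} * (#y * (r₂ / 22)) := by
  obtain ⟨f, hf, hfv⟩ := exists_quadratic_mem_Pol h.ne y 0 0 1 0 0
  have hb := h.bal f (Pol_mono (by norm_num) hf)
  have a1 : avg r₁ f = 0 := by
    rw [avg_congr (g := 0) fun x hx => by rw [(hfv x).1 hx]; simp, map_zero]
  have a2 : avg r₂ f = #y * (r₂ / 22) := by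
    have := avg_card_inter_mul_inc (n := 22) (r := r₂) (by have := h.le₂; omega) y ∅
    rw [avg_congr (g := fun x => (#(x ∩ y) : ℝ) * inc ∅ x)
      fun x hx => by rw [(hfv x).2 hx]; simp [inc], this]
    simp
  rw [h.sum_avg_eq, h.sum_eq, a1, a2, mul_zero, zero_add,
    sum_eq_zero (s := {b ∈ B | #b = r₁}) fun b hb => by
      rw [(hfv b).1 (mem_filter.1 hb).2]; simp, zero_add] at hb
  have hW := h.symm.shellWeight_pos
  have hN : (0 : ℝ) < #{b ∈ B | #b = r₂} := by
    have := h.symm.lt_card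
    exact_mod_cast (by omega : 0 < #{b ∈ B | #b = r₂})
  have e : ∀ b ∈ {b ∈ B | #b = r₂}, v b * f b =
      shellWeight B v r₂ / #{b ∈ B | #b = r₂} * #(b ∩ y) := by
    intro b hb
    have hb' := mem_filter.1 hb
    rw [(hfv b).2 hb'.2, ← h.symm.weight_eq hb'.1 hb'.2]
    field_simp; ring
  rw [sum_congr rfl e, ← mul_sum] at hb
  field_simp at hb ⊢
  linarith

/-- A single intersection number would equal its mean r₁r₂/22. There the cross quadratic takes the
value -(5/121) r₁r₂(22 - r₁)(22 - r₂), which is negative. -/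
theorem exists_two_cross (h : TwoShell r₁ r₂ B v) :
    ∃ x ∈ B, ∃ x' ∈ B, ∃ y ∈ B, #x = r₂ ∧ #x' = r₂ ∧ #y = r₁ ∧ #(x ∩ y) ≠ #(x' ∩ y) := by
  obtain ⟨y, hy, hyr⟩ := h.exists_mem
  obtain ⟨x, hx, hxr⟩ := h.symm.exists_mem
  by_contra! hc
  have hs := h.sum_card_inter y
  rw [sum_congr rfl (g := fun _ => (#(x ∩ y) : ℝ)) fun z hz => by
    rw [hc z (mem_filter.1 hz).1 x hx y hy (mem_filter.1 hz).2 hxr hyr], sum_const, nsmul_eq_mul,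
    hyr] at hs
  have hN : (#{b ∈ B | #b = r₂} : ℝ) ≠ 0 := by
    have := h.symm.lt_card
    exact_mod_cast (by omega : #{b ∈ B | #b = r₂} ≠ 0)
  have hu := mul_left_cancel₀ hN hs
  have he := h.cross_eq hx hy hxr hyr
  have he' : (420 * (#(x ∩ y) : ℝ) * (#(x ∩ y) - 1) - 42 * (r₁ - 1) * (r₂ - 1) * #(x ∩ y) +
      r₁ * (r₁ - 1) * r₂ * (r₂ - 1)) = 0 := by exact_mod_cast he
  rw [hu] at he'
  have hneg : (r₁ : ℝ) * r₂ * (22 - r₁) * (22 - r₂) = 0 := by linear_combination (-121 / 5) * he'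
  have h1 := h.two_le₁
  have h2 := h.two_le₂
  have h3 : (r₁ : ℝ) ≤ 20 := by exact_mod_cast h.le₁
  have h4 : (r₂ : ℝ) ≤ 20 := by exact_mod_cast h.le₂
  have : (0 : ℝ) < r₁ * r₂ * (22 - r₁) * (22 - r₂) := by
    have a : (0 : ℝ) < 22 - r₁ := by linarith
    have b : (0 : ℝ) < 22 - r₂ := by linarith
    positivity
  exact this.ne' hneg

end TwoShell

/-! ### Designs with the parameters of the Witt design -/

/-- Double counting of the pairs (U, b) with U a `k`-subset of `A ∩ b` and b a block through `T`.
Disjointness gives `T ∪ U` exactly `#T + k` points. -/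
theorem sum_choose_card_inter {V : Type*} [DecidableEq V] {W : Finset (Finset V)} {k l : ℕ}
    {T A : Finset V} (hTA : Disjoint T A)
    (h : ∀ U : Finset V, #U = #T + k → #{b ∈ W | U ⊆ b} = l) :
    ∑ b ∈ W with T ⊆ b, (#(A ∩ b)).choose k = (#A).choose k * l := by
  have := sum_card_bipartiteAbove_eq_sum_card_bipartiteBelow
      (s := powersetCard k A) (t := {b ∈ W | T ⊆ b}) (fun U b => U ⊆ b)
  simp only [bipartiteAbove, bipartiteBelow] at this
  have e1 : ∀ U ∈ powersetCard k A, #{b ∈ {b ∈ W | T ⊆ b} | U ⊆ b} = l := by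
    intro U hU
    rw [mem_powersetCard] at hU
    rw [← h (T ∪ U) (by rw [card_union_of_disjoint (disjoint_of_subset_right hU.1 hTA), hU.2]),
      filter_filter]
    congr 1
    ext b; simp [union_subset_iff]
  have e2 : ∀ b ∈ {b ∈ W | T ⊆ b}, #{U ∈ powersetCard k A | U ⊆ b} = (#(A ∩ b)).choose k := by
    intro b _
    rw [← card_powersetCard]
    congr 1
    ext U; simp only [mem_filter, mem_powersetCard, subset_inter_iff]; tauto
  rw [sum_congr rfl e1, sum_congr rfl e2, sum_const, card_powersetCard, smul_eq_mul] at this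
  exact this.symm

section Witt

variable {V : Type*} [Fintype V] [DecidableEq V] {W : Finset (Finset V)}

/-- `253` blocks of size `7` on `23` points that meet pairwise in at most three points form a
`4`-design. -/
theorem isDesign_of_card_inter_le (hV : Fintype.card V = 23) (hW : #W = 253)
    (hcard : ∀ b ∈ W, #b = 7) (hinter : ∀ b ∈ W, ∀ b' ∈ W, b ≠ b' → #(b ∩ b') ≤ 3) :
    IsDesign 4 23 7 1 W := by
  refine ⟨hV, hcard, ?_⟩
  have hle : ∀ T ∈ powersetCard 4 (univ : Finset V), #{b ∈ W | T ⊆ b} ≤ 1 := by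
    intro T hT
    rw [card_le_one]
    intro b hb b' hb'
    simp only [mem_filter] at hb hb'
    by_contra hne
    have h1 := hinter b hb.1 b' hb'.1 hne
    have h2 := card_le_card (subset_inter hb.2 hb'.2)
    rw [(mem_powersetCard.1 hT).2] at h2
    omega
  -- Since 253 · 35 = 8855 = C(23,4), the bound of one block per 4-subset is attained on average,
  -- hence everywhere.
  have hsum : ∑ T ∈ powersetCard 4 (univ : Finset V), #{b ∈ W | T ⊆ b} =
      ∑ T ∈ powersetCard 4 (univ : Finset V), 1 := by
    have := sum_card_bipartiteAbove_eq_sum_card_bipartiteBelow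
      (s := powersetCard 4 (univ : Finset V)) (t := W) (fun T b => T ⊆ b)
    simp only [bipartiteAbove, bipartiteBelow] at this
    rw [this]
    have e : ∀ b ∈ W, #{T ∈ powersetCard 4 (univ : Finset V) | T ⊆ b} = 35 := by
      intro b hb
      have : {T ∈ powersetCard 4 (univ : Finset V) | T ⊆ b} = powersetCard 4 b := by
        ext T; simp [mem_powersetCard, and_comm]
      rw [this, card_powersetCard, hcard b hb]; rfl
    rw [sum_congr rfl e, sum_const, hW, sum_const, card_powersetCard, card_univ, hV]
    rfl
  intro T hT
  exact (sum_eq_sum_iff_of_le hle).1 hsum T (mem_powersetCard.2 ⟨subset_univ _, hT⟩)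

/-- Counting pairs of a point outside `T` and a block through both. Iteration gives 5, 21, 77 and
253 blocks through 3, 2, 1 and 0 points. -/
theorem card_filter_subset_step (hcard : ∀ b ∈ W, #b = 7) (hV : Fintype.card V = 23) {i l : ℕ}
    (h : ∀ T : Finset V, #T = i + 1 → #{b ∈ W | T ⊆ b} = l) {T : Finset V} (hT : #T = i) :
    (7 - i) * #{b ∈ W | T ⊆ b} = (23 - i) * l := by
  have := sum_card_bipartiteAbove_eq_sum_card_bipartiteBelow
      (s := Tᶜ) (t := {b ∈ W | T ⊆ b}) (fun x b => x ∈ b)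
  simp only [bipartiteAbove, bipartiteBelow] at this
  have e1 : ∀ x ∈ Tᶜ, #{b ∈ {b ∈ W | T ⊆ b} | x ∈ b} = l := by
    intro x hx
    rw [← h (insert x T) (by rw [card_insert_of_notMem (mem_compl.1 hx), hT]), filter_filter]
    congr 1
    ext b; simp [insert_subset_iff, and_comm]
  have e2 : ∀ b ∈ {b ∈ W | T ⊆ b}, #{x ∈ Tᶜ | x ∈ b} = 7 - i := by
    intro b hb
    simp only [mem_filter] at hb
    have : {x ∈ Tᶜ | x ∈ b} = b \ T := by ext x; simp [and_comm]
    rw [this, card_sdiff_of_subset hb.2, hcard b hb.1, hT]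
  rw [sum_congr rfl e1, sum_congr rfl e2, sum_const, sum_const, card_compl, hV, hT, smul_eq_mul,
    smul_eq_mul] at this
  rw [this, mul_comm]

namespace IsDesign

theorem card_three (h : IsDesign 4 23 7 1 W) {T : Finset V} (hT : #T = 3) :
    #{b ∈ W | T ⊆ b} = 5 := by
  have := card_filter_subset_step h.card_block h.card_points h.balanced hT
  omega

theorem card_two (h : IsDesign 4 23 7 1 W) {T : Finset V} (hT : #T = 2) :
    #{b ∈ W | T ⊆ b} = 21 := by
  have := card_filter_subset_step h.card_block h.card_points (fun _ => h.card_three) hT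
  omega

theorem card_one (h : IsDesign 4 23 7 1 W) {T : Finset V} (hT : #T = 1) :
    #{b ∈ W | T ⊆ b} = 77 := by
  have := card_filter_subset_step h.card_block h.card_points (fun _ => h.card_two) hT
  omega

theorem card_eq (h : IsDesign 4 23 7 1 W) : #W = 253 := by
  have := card_filter_subset_step h.card_block h.card_points (fun _ => h.card_one)
    (T := ∅) rfl
  simp only [empty_subset, filter_true] at this
  omega

end IsDesign

namespace IsDesign

/-- Two blocks of the Witt design meet in one or three points. -/
theorem card_inter (h : IsDesign 4 23 7 1 W) {b b' : Finset V} (hb : b ∈ W) (hb' : b' ∈ W)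
    (hne : b' ≠ b) : #(b ∩ b') = 1 ∨ #(b ∩ b') = 3 := by
  have hc := h.card_block b hb
  have key : ∀ k l, (∀ U : Finset V, #U = k → #{b ∈ W | U ⊆ b} = l) →
      ∑ c ∈ W.erase b, (#(b ∩ c)).choose k + (7).choose k = (7).choose k * l := by
    intro k l hl
    have := sum_choose_card_inter (W := W) (k := k) (l := l) (T := ∅) (A := b) (by simp)
      (by simpa using hl)
    simp only [empty_subset, filter_true] at this
    rw [← sum_erase_add _ _ hb, inter_self, hc] at this
    exact this
  have k0 := key 0 253 (fun U hU => by
    rw [card_eq_zero] at hU; subst hU; simpa using h.card_eq)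
  have k1 := key 1 77 fun U hU => h.card_one hU
  have k2 := key 2 21 fun U hU => h.card_two hU
  have k3 := key 3 5 fun U hU => h.card_three hU
  have hle : ∀ c ∈ W.erase b, #(b ∩ c) ≤ 3 := by
    intro c hcm
    rw [mem_erase] at hcm
    by_contra! hgt
    obtain ⟨T, hT, hT4⟩ := exists_subset_card_eq (Nat.succ_le_of_lt hgt)
    have := h.balanced T hT4
    rw [card_eq_one] at this
    obtain ⟨d, hd⟩ := this
    have m1 : b ∈ {b ∈ W | T ⊆ b} := mem_filter.2 ⟨hb, hT.trans inter_subset_left⟩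
    have m2 : c ∈ {b ∈ W | T ⊆ b} := mem_filter.2 ⟨hcm.2, hT.trans inter_subset_right⟩
    rw [hd, mem_singleton] at m1 m2
    exact hcm.1 (m2.trans m1.symm)
  -- With u = #(b ∩ c) the summand is (3 - u)(u - 1)², written in binomial coefficients. It is
  -- nonnegative for u ≤ 3, vanishes there only at 1 and 3, and sums to 756 + 1680 - 1596 - 840 = 0.
  have hz : ∑ c ∈ W.erase b, (3 + 4 * ((#(b ∩ c)).choose 2 : ℤ) -
      3 * (#(b ∩ c)).choose 1 - 6 * (#(b ∩ c)).choose 3) = 0 := by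
    have hcard : #(W.erase b) = 252 := by rw [card_erase_of_mem hb, h.card_eq]
    simp only [sum_sub_distrib, sum_add_distrib, ← mul_sum, sum_const, hcard]
    zify at k1 k2 k3
    norm_num [Nat.choose] at k1 k2 k3 ⊢
    linarith
  have hnn : ∀ c ∈ W.erase b, 0 ≤ (3 + 4 * ((#(b ∩ c)).choose 2 : ℤ) -
      3 * (#(b ∩ c)).choose 1 - 6 * (#(b ∩ c)).choose 3) := by
    intro c hcm
    have := hle c hcm
    interval_cases #(b ∩ c) <;> simp [Nat.choose]
  have hm : b' ∈ W.erase b := mem_erase.2 ⟨hne, hb'⟩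
  have h0 := (sum_eq_zero_iff_of_nonneg hnn).1 hz b' hm
  have := hle b' hm
  interval_cases #(b ∩ b') <;> simp [Nat.choose] at h0 ⊢

end IsDesign

end Witt

/-! ### Sets as bit masks -/

/-- The set of positions of ones among the first `k` binary digits of `m`. -/
def bits (k m : ℕ) : Finset (Fin k) := {i | m.testBit i}

theorem mem_bits {k m : ℕ} {i : Fin k} : i ∈ bits k m ↔ m.testBit i := by simp [bits]

theorem bits_and (k m m' : ℕ) : bits k (m &&& m') = bits k m ∩ bits k m' := by
  ext i; simp [mem_bits]

/-- The number of ones among the first `k` binary digits of `m`. -/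
def bitCount : ℕ → ℕ → ℕ
  | 0, _ => 0
  | k + 1, m => m % 2 + bitCount k (m / 2)

theorem card_bits (k m : ℕ) : #(bits k m) = bitCount k m := by
  induction k generalizing m with
  | zero => rfl
  | succ k ih =>
    rw [bits, Fin.card_filter_univ_succ, bitCount, ← ih (m / 2), bits]
    simp only [Fin.val_zero, Fin.val_succ, Nat.testBit_succ, Nat.testBit_zero, decide_eq_true_eq]
    rcases Nat.mod_two_eq_zero_or_one m with h | h <;> simp [h]
    omega

theorem exists_bits_eq {k : ℕ} (t : Finset (Fin k)) : ∃ m < 2 ^ k, bits k m = t := by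
  refine ⟨Nat.ofBits fun i => decide (i ∈ t), Nat.ofBits_lt_two_pow _, ?_⟩
  ext i
  simp [mem_bits, Nat.testBit_ofBits_lt]

/-- Test of a property for all numbers whose leading digits are those of `m`, followed by `k`
more. -/
def allBits (p : ℕ → Bool) : ℕ → ℕ → Bool
  | 0, m => p m
  | k + 1, m => allBits p k (2 * m) && allBits p k (2 * m + 1)

theorem of_allBits {p : ℕ → Bool} {k m : ℕ} (h : allBits p k m = true) {a : ℕ}
    (h1 : 2 ^ k * m ≤ a) (h2 : a < 2 ^ k * (m + 1)) : p a = true := by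
  induction k generalizing m with
  | zero =>
    obtain rfl : a = m := by omega
    exact h
  | succ k ih =>
    rw [allBits, Bool.and_eq_true] at h
    rw [pow_succ, mul_assoc] at h1 h2
    rcases lt_or_ge a (2 ^ k * (2 * m + 1)) with hlt | hge
    · exact ih h.1 h1 hlt
    · exact ih h.2 hge (by linarith)

/-! ### The biplane with eleven points -/

/-- The blocks of the standard biplane, as bit masks. -/
def biplaneMask : Fin 11 → ℕ := ![31, 227, 364, 692, 1240, 1605, 905, 1329, 1414, 1578, 850]

/-- The blocks of the standard biplane on eleven points. -/
def biplane (i : Fin 11) : Finset (Fin 11) := bits 11 (biplaneMask i)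

/-- The first five blocks of the standard biplane. -/
abbrev firstBlocks : Finset (Fin 11) := {0, 1, 2, 3, 4}

theorem card_inter_biplane (m : ℕ) (k : Fin 11) :
    #(bits 11 m ∩ biplane k) = bitCount 11 (m &&& biplaneMask k) := by
  rw [biplane, ← bits_and, card_bits]

/-- Exhaustion over 2^11 masks: five standard blocks and either block 5 or block 8 leave only
standard candidates. -/
theorem mem_biplane_of_card_inter {t : Finset (Fin 11)} (ht : #t = 5)
    (h : ∀ k ∈ firstBlocks, #(t ∩ biplane k) = 2)
    (h' : #(t ∩ biplane 5) = 2 ∨ #(t ∩ biplane 8) = 2) : ∃ i, t = biplane i := by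
  obtain ⟨m, hm, rfl⟩ := exists_bits_eq t
  have key : allBits (fun m => decide (bitCount 11 m = 5 →
      (∀ k ∈ firstBlocks, bitCount 11 (m &&& biplaneMask k) = 2) →
      (bitCount 11 (m &&& biplaneMask 5) = 2 ∨ bitCount 11 (m &&& biplaneMask 8) = 2) →
      ∃ i, m = biplaneMask i)) 11 0 = true := by
    decide +kernel
  simp only [card_bits, card_inter_biplane] at ht h h'
  obtain ⟨i, hi⟩ :=
    of_decide_eq_true (of_allBits key (a := m) (by simp) (by simpa using hm)) ht h h'
  exact ⟨i, by rw [hi, biplane]⟩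

/-- Five standard blocks can be completed through the points 0 and 2 in two ways. The second becomes
standard after exchanging the labels 0 and 1. -/
theorem eq_of_card_inter_of_mem {t : Finset (Fin 11)} (ht : #t = 5)
    (h : ∀ k ∈ firstBlocks, #(t ∩ biplane k) = 2) (h0 : 0 ∈ t) (h2 : 2 ∈ t) :
    t = biplane 5 ∨ t = (biplane 8).map (Equiv.swap 0 1).toEmbedding := by
  obtain ⟨m, hm, rfl⟩ := exists_bits_eq t
  -- 1413 is the mask 1414 of block 8 with its two lowest digits exchanged.
  have key : allBits (fun m => decide (bitCount 11 m = 5 →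
      (∀ k ∈ firstBlocks, bitCount 11 (m &&& biplaneMask k) = 2) →
      m.testBit 0 → m.testBit 2 → m = biplaneMask 5 ∨ m = 1413)) 11 0 = true := by
    decide +kernel
  simp only [card_bits, card_inter_biplane] at ht h
  rcases of_decide_eq_true (of_allBits key (a := m) (by simp) (by simpa using hm)) ht h
    (mem_bits.1 h0) (mem_bits.1 h2) with h | h
  · left; rw [h, biplane]
  · right; rw [h]; decide +kernel

section Biplane

variable {E F : Type*} [Fintype E] [Fintype F] [DecidableEq E] [DecidableEq F] {β : F → Finset E}

/-- A family of blocks that attains the first five blocks of the standard biplane, and one more, is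
the standard biplane. -/
theorem exists_equiv_biplane (hF : Fintype.card F = 11) {γ : F → Finset (Fin 11)}
    (h5 : ∀ i, #(γ i) = 5) (h2 : ∀ i j, i ≠ j → #(γ i ∩ γ j) = 2)
    (hk : ∀ k ∈ firstBlocks, ∃ i, γ i = biplane k)
    (hk' : ∃ i, γ i = biplane 5 ∨ γ i = biplane 8) :
    ∃ q : Fin 11 ≃ F, ∀ i, γ (q i) = biplane i := by
  have hinj : Function.Injective γ := by
    intro i j hij
    by_contra hne
    have := h2 i j hne
    rw [hij, inter_self, h5] at this
    omega
  have hmem : ∀ i, ∃ j, γ i = biplane j := by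
    intro i
    by_cases hi : ∃ j, γ i = biplane j
    · exact hi
    · refine mem_biplane_of_card_inter (h5 i) (fun k hkm => ?_) ?_
      · obtain ⟨j, hj⟩ := hk k hkm
        rw [← hj]
        exact h2 i j fun e => hi ⟨k, e ▸ hj⟩
      · obtain ⟨j, hj | hj⟩ := hk'
        · left; rw [← hj]; exact h2 i j fun e => hi ⟨5, e ▸ hj⟩
        · right; rw [← hj]; exact h2 i j fun e => hi ⟨8, e ▸ hj⟩
  choose p hp using hmem
  have hpinj : Function.Injective p := fun i j hij => hinj (by rw [hp, hp, hij])
  have hbij : Function.Bijective p :=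
    (Fintype.bijective_iff_injective_and_card p).2 ⟨hpinj, by rw [hF, Fintype.card_fin]⟩
  refine ⟨(Equiv.ofBijective p hbij).symm, fun i => ?_⟩
  rw [hp]
  congr 1
  exact (Equiv.ofBijective p hbij).apply_symm_apply i

theorem sum_ite_mem_mul (s t : Finset E) :
    ∑ x, (if x ∈ s then (1 : ℤ) else 0) * (if x ∈ t then 1 else 0) = #(s ∩ t) := by
  simp only [ite_zero_mul_ite_zero, mul_one]
  rw [sum_boole]
  congr 2
  ext x; simp

/-- Equality in the counting bound: eleven `5`-subsets of an eleven-set that pairwise meet in at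
most two points form a symmetric design. -/
theorem biplane_counts (hE : Fintype.card E = 11) (hF : Fintype.card F = 11)
    (h5 : ∀ i, #(β i) = 5) (h2 : ∀ i j, i ≠ j → #(β i ∩ β j) ≤ 2) :
    (∀ i j, i ≠ j → #(β i ∩ β j) = 2) ∧ ∀ x y, x ≠ y → #{i | x ∈ β i ∧ y ∈ β i} = 2 := by
  let M : E → F → ℤ := fun x i => if x ∈ β i then 1 else 0
  have hcol : ∀ i, ∑ x, M x i = 5 := by
    intro i
    simp only [M, sum_boole]
    rw [filter_univ_mem, h5]; rfl
  have hin : ∀ i j, ∑ x, M x i * M x j = #(β i ∩ β j) := fun i j => sum_ite_mem_mul _ _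
  have hle : ∀ i j, (#(β i ∩ β j) : ℤ) ≤ if i = j then 5 else 2 := by
    intro i j
    split_ifs with h
    · rw [h, inter_self, h5]; rfl
    · exact_mod_cast h2 i j h
  have htot : ∑ x, ∑ i, M x i = 55 := by
    rw [sum_comm]; simp [hcol, hF]
  have hsq : ∑ x, (∑ i, M x i) ^ 2 = ∑ i, ∑ j, (#(β i ∩ β j) : ℤ) := by
    simp only [sq, sum_mul_sum, ← hin]
    rw [sum_comm]
    exact sum_congr rfl fun i _ => sum_comm
  have hT : ∑ i : F, ∑ j : F, (if i = j then (5 : ℤ) else 2) = 275 := by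
    have : ∀ i : F, ∑ j : F, (if i = j then (5 : ℤ) else 2) = 25 := by
      intro i
      have : ∀ j, (if i = j then (5 : ℤ) else 2) = 2 + if i = j then 3 else 0 := by
        intro j; split_ifs <;> rfl
      simp [this, sum_add_distrib, hF]
    simp [this, hF]
  have hub : ∑ i, ∑ j, (#(β i ∩ β j) : ℤ) ≤ 275 := by
    rw [← hT]
    exact sum_le_sum fun i _ => sum_le_sum fun j _ => hle i j
  -- The row sums of the incidence matrix total 55. Their squared deviation from 5 is the Gram total
  -- minus 2 · 5 · 55 - 11 · 25 = 275, hence at most zero; equality follows in every bound.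
  have hvar : ∑ x, ((∑ i, M x i) - 5) ^ 2 = ∑ i, ∑ j, (#(β i ∩ β j) : ℤ) - 275 := by
    simp only [sub_sq, sum_add_distrib, sum_sub_distrib, hsq, ← sum_mul, ← mul_sum, htot]
    simp [hE]; ring
  have hvar0 : 0 ≤ ∑ x, ((∑ i, M x i) - 5) ^ 2 := sum_nonneg fun x _ => sq_nonneg _
  have heq : ∑ i, ∑ j, (#(β i ∩ β j) : ℤ) = 275 := by linarith
  have hrow : ∀ x, ∑ i, M x i = 5 := by
    intro x
    have := (sum_eq_zero_iff_of_nonneg fun x _ => sq_nonneg ((∑ i, M x i) - 5)).1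
      (by rw [hvar, heq]; rfl) x (mem_univ x)
    have := pow_eq_zero_iff (two_ne_zero) |>.1 this
    linarith
  have hbl : ∀ i j, (#(β i ∩ β j) : ℤ) = if i = j then 5 else 2 := by
    rw [← hT] at heq
    intro i j
    have h1 := (sum_eq_sum_iff_of_le fun i _ => sum_le_sum fun j _ => hle i j).1 heq i (mem_univ i)
    exact (sum_eq_sum_iff_of_le fun j _ => hle i j).1 h1 j (mem_univ j)
  refine ⟨fun i j hij => by have := hbl i j; rw [if_neg hij] at this; exact_mod_cast this, ?_⟩
  let L : E → E → ℤ := fun x y => ∑ i, M x i * M y i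
  have hL : ∀ x y, L x y = #{i | x ∈ β i ∧ y ∈ β i} := by
    intro x y
    simp only [L, M, ite_zero_mul_ite_zero, mul_one]
    rw [sum_boole]
  have hdiag : ∀ x, L x x = 5 := by
    intro x
    rw [← hrow x]
    exact sum_congr rfl fun i _ => by simp only [M]; split_ifs <;> rfl
  have hLs : ∑ x, ∑ y, L x y = 275 := by
    have : ∀ x, ∑ y, L x y = 25 := by
      intro x
      simp only [L]
      rw [sum_comm]
      simp only [← mul_sum, hcol, ← sum_mul, hrow]; rfl
    simp [this, hE]
  -- M Mᵀ and Mᵀ M have equal sums of squared entries, here 11 · 25 + 110 · 4 = 715. This makes the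
  -- squared deviation of `L` from its expected entries vanish.
  have hLsq : ∑ x, ∑ y, L x y ^ 2 = 715 := by
    have e : ∀ x y, L x y ^ 2 = ∑ i, ∑ j, (M x i * M x j) * (M y i * M y j) := by
      intro x y
      simp only [L, sq, sum_mul_sum]
      exact sum_congr rfl fun i _ => sum_congr rfl fun j _ => by ring
    have e2 : ∑ x, ∑ y, L x y ^ 2 = ∑ i, ∑ j, (#(β i ∩ β j) : ℤ) ^ 2 := by
      simp only [e, ← hin, sq, sum_mul_sum]
      rw [sum_congr rfl fun x _ => sum_comm, sum_comm]
      refine sum_congr rfl fun i _ => ?_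
      rw [sum_congr rfl fun x _ => sum_comm, sum_comm]
    rw [e2]
    have : ∀ i j, (#(β i ∩ β j) : ℤ) ^ 2 = 4 + if i = j then 21 else 0 := by
      intro i j; rw [hbl]; split_ifs <;> rfl
    simp [this, sum_add_distrib, hF]
  have hz : ∑ x, ∑ y, (L x y - if x = y then 5 else 2) ^ 2 = 0 := by
    have e : ∀ x y, (L x y - if x = y then 5 else 2) ^ 2 =
        L x y ^ 2 - 4 * L x y + 4 + if x = y then -9 else 0 := by
      intro x y
      split_ifs with h
      · rw [← h, hdiag]; rfl
      · ring
    simp only [e, sum_add_distrib, sum_sub_distrib, ← mul_sum, hLsq, hLs]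
    simp [hE]
  intro x y hxy
  have h1 := (sum_eq_zero_iff_of_nonneg fun x _ => sum_nonneg fun y _ =>
    sq_nonneg (L x y - if x = y then 5 else 2)).1 hz x (mem_univ x)
  have h2 := (sum_eq_zero_iff_of_nonneg fun y _ =>
    sq_nonneg (L x y - if x = y then 5 else 2)).1 h1 y (mem_univ y)
  have h3 := pow_eq_zero_iff (two_ne_zero) |>.1 h2
  rw [if_neg hxy, hL] at h3
  have : (#{i | x ∈ β i ∧ y ∈ β i} : ℤ) = 2 := by linarith
  exact_mod_cast this

end Biplane

theorem exists_other_block {E F : Type*} [DecidableEq E] [Fintype F]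
    {β : F → Finset E} (hd : ∀ x y, x ≠ y → #{i | x ∈ β i ∧ y ∈ β i} = 2)
    {x y : E} (hxy : x ≠ y) (i : F) : ∃ j, j ≠ i ∧ x ∈ β j ∧ y ∈ β j := by
  have h := hd x y hxy
  obtain ⟨j, hj, hji⟩ := exists_mem_ne (by omega : 1 < #{i | x ∈ β i ∧ y ∈ β i}) i
  exact ⟨j, hji, by simpa using hj⟩

theorem inter_eq_pair {E F : Type*} [DecidableEq E] {β : F → Finset E}
    (h2 : ∀ i j, i ≠ j → #(β i ∩ β j) = 2) {i j : F} (hij : i ≠ j) {x y : E}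
    (hxy : x ≠ y) (hx : x ∈ β i) (hx' : x ∈ β j) (hy : y ∈ β i) (hy' : y ∈ β j) :
    ∀ z, z ∈ β i → z ∈ β j → z = x ∨ z = y := by
  have : {x, y} = β i ∩ β j := eq_of_subset_of_card_le
    (by simp [insert_subset_iff, hx, hx', hy, hy']) (by rw [h2 i j hij, card_pair hxy])
  intro z hz hz'
  have hm : z ∈ ({x, y} : Finset E) := this ▸ mem_inter.2 ⟨hz, hz'⟩
  simpa using hm

section Biplane

variable {E F : Type*} [DecidableEq E] {β : F → Finset E}

/-- The two points that `β i₁` shares with `β i₀` differ from the two it shares with `β j`, so one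
of its five points is left over. -/
theorem exists_missing (h5 : ∀ i, #(β i) = 5) (h2 : ∀ i j, i ≠ j → #(β i ∩ β j) = 2) {i₀ i₁ j : F}
    (h01 : i₀ ≠ i₁) (h1j : i₁ ≠ j) (h : ∀ z, z ∈ β i₀ → z ∈ β j → z ∉ β i₁) :
    ∃ c, c ∈ β i₁ ∧ c ∉ β i₀ ∧ c ∉ β j ∧ ∀ z, z ∈ β i₁ → z ∉ β i₀ → z ∉ β j → z = c := by
  have e : #((β i₁ \ β i₀) \ β j) = 1 := by
    have a1 : #(β i₁ \ β i₀) = 3 := by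
      have := card_sdiff_add_card_inter (β i₁) (β i₀)
      rw [h5, h2 _ _ h01.symm] at this; omega
    have a2 : (β i₁ \ β i₀) ∩ β j = β i₁ ∩ β j := by
      ext z
      simp only [mem_inter, mem_sdiff]
      constructor
      · rintro ⟨⟨a, b⟩, c⟩; exact ⟨a, c⟩
      · rintro ⟨a, c⟩; exact ⟨⟨a, fun hb => h z hb c a⟩, c⟩
    have := card_sdiff_add_card_inter (β i₁ \ β i₀) (β j)
    rw [a1, a2, h2 _ _ h1j] at this; omega
  obtain ⟨c, hc⟩ := card_eq_one.1 e
  have hm : ∀ z, z ∈ (β i₁ \ β i₀) \ β j ↔ z = c := fun z => by rw [hc, mem_singleton]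
  simp only [mem_sdiff] at hm
  have := (hm c).2 rfl
  exact ⟨c, this.1.1, this.1.2, this.2, fun z a b d => (hm z).1 ⟨⟨a, b⟩, d⟩⟩

/-- If `c = d`, the other two points of `β i₁ \ β i₀` lie in both `β j` and `β k`. Together with `x`
these blocks would share three points. -/
theorem ne_of_missing (h5 : ∀ i, #(β i) = 5) (h2 : ∀ i j, i ≠ j → #(β i ∩ β j) = 2)
    {i₀ i₁ j k : F} (h01 : i₀ ≠ i₁) (hjk : j ≠ k) {x c d : E} (hx0 : x ∈ β i₀) (hxj : x ∈ β j)
    (hxk : x ∈ β k) (hc : ∀ z, z ∈ β i₁ → z ∉ β i₀ → z ∉ β j → z = c)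
    (hd : ∀ z, z ∈ β i₁ → z ∉ β i₀ → z ∉ β k → z = d) : c ≠ d := by
  rintro rfl
  have a1 : #(β i₁ \ β i₀) = 3 := by
    have := card_sdiff_add_card_inter (β i₁) (β i₀)
    rw [h5, h2 _ _ h01.symm] at this; omega
  have hsub : insert x ((β i₁ \ β i₀).erase c) ⊆ β j ∩ β k := by
    rw [insert_subset_iff]
    refine ⟨mem_inter.2 ⟨hxj, hxk⟩, fun z hz => ?_⟩
    simp only [mem_erase, mem_sdiff] at hz
    rw [mem_inter]
    exact ⟨by_contra fun hn => hz.1 (hc z hz.2.1 hz.2.2 hn),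
      by_contra fun hn => hz.1 (hd z hz.2.1 hz.2.2 hn)⟩
  have := card_le_card hsub
  rw [h2 _ _ hjk, card_insert_of_notMem (by simp [hx0])] at this
  have := pred_card_le_card_erase (s := β i₁ \ β i₀) (a := c)
  omega

theorem exists_fifth {s : Finset E} (hs : #s = 5) (a b c d : E) :
    ∃ x ∈ s, x ≠ a ∧ x ≠ b ∧ x ≠ c ∧ x ≠ d := by
  have : #({a, b, c, d} : Finset E) < #s := by rw [hs]; exact Nat.lt_succ_of_le card_le_four
  obtain ⟨x, hx, hn⟩ := exists_mem_notMem_of_card_lt_card this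
  simp only [mem_insert, mem_singleton, not_or] at hn
  exact ⟨x, hx, hn⟩

variable [Fintype E] [Fintype F]

/-- Labels for the points of a biplane such that five of its blocks are standard. -/
theorem exists_labels (hE : Fintype.card E = 11) (hF : Fintype.card F = 11)
    (h5 : ∀ i, #(β i) = 5) (h2 : ∀ i j, i ≠ j → #(β i ∩ β j) = 2)
    (hd : ∀ x y, x ≠ y → #{i | x ∈ β i ∧ y ∈ β i} = 2) :
    ∃ p : Fin 11 ≃ E, ∀ k ∈ firstBlocks, ∃ i, ∀ j, p j ∈ β i ↔ j ∈ biplane k := by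
  obtain ⟨i₀, i₁, h01⟩ := Fintype.exists_pair_of_one_lt_card (by omega : 1 < Fintype.card F)
  obtain ⟨x₁, x₂, h12, e12⟩ := card_eq_two.1 (h2 i₀ i₁ h01)
  have e3 : #(β i₀ \ β i₁) = 3 := by
    have := card_sdiff_add_card_inter (β i₀) (β i₁)
    rw [h5, h2 _ _ h01] at this; omega
  obtain ⟨x₃, x₄, x₅, h34, h35, h45, e345⟩ := card_eq_three.1 e3
  have m12 : ∀ z, (z ∈ β i₀ ∧ z ∈ β i₁) ↔ z = x₁ ∨ z = x₂ := fun z => by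
    rw [← mem_inter, e12]; simp
  have m345 : ∀ z, (z ∈ β i₀ ∧ z ∉ β i₁) ↔ z = x₃ ∨ z = x₄ ∨ z = x₅ := fun z => by
    rw [← mem_sdiff, e345]; simp
  obtain ⟨h10, h11⟩ := (m12 x₁).2 (by simp)
  obtain ⟨h20, h21⟩ := (m12 x₂).2 (by simp)
  obtain ⟨h30, h31⟩ := (m345 x₃).2 (by simp)
  obtain ⟨h40, h41⟩ := (m345 x₄).2 (by simp)
  obtain ⟨h50, h51⟩ := (m345 x₅).2 (by simp)
  -- Each pair among `x₃`, `x₄`, `x₅` lies in one more block besides `i₀`. These blocks `k`, `l`,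
  -- `m` join `i₀` and `i₁` as the five standard ones.
  obtain ⟨k, hk0, h3k, h4k⟩ := exists_other_block hd h34 i₀
  obtain ⟨l, hl0, h3l, h5l⟩ := exists_other_block hd h35 i₀
  obtain ⟨m, hm0, h4m, h5m⟩ := exists_other_block hd h45 i₀
  have zk := inter_eq_pair h2 hk0.symm h34 h30 h3k h40 h4k
  have zl := inter_eq_pair h2 hl0.symm h35 h30 h3l h50 h5l
  have zm := inter_eq_pair h2 hm0.symm h45 h40 h4m h50 h5m
  have hk1 : i₁ ≠ k := by rintro rfl; exact h31 h3k
  have hl1 : i₁ ≠ l := by rintro rfl; exact h31 h3l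
  have hm1 : i₁ ≠ m := by rintro rfl; exact h41 h4m
  have h1k : x₁ ∉ β k := by grind
  have h2k : x₂ ∉ β k := by grind
  have h5k : x₅ ∉ β k := by grind
  have h1l : x₁ ∉ β l := by grind
  have h2l : x₂ ∉ β l := by grind
  have h4l : x₄ ∉ β l := by grind
  have h1m : x₁ ∉ β m := by grind
  have h2m : x₂ ∉ β m := by grind
  have h3m : x₃ ∉ β m := by grind
  have hkl : k ≠ l := by rintro rfl; exact h5k h5l
  have hkm : k ≠ m := by rintro rfl; exact h5k h5m
  have hlm : l ≠ m := by rintro rfl; exact h4l h4m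
  -- The three points of `β i₁` outside `β i₀` are labelled by the block among `m`, `l`, `k` that
  -- misses them.
  obtain ⟨c, hc1, hc0, hck, hc⟩ := exists_missing h5 h2 h01 hk1 (by grind)
  obtain ⟨b, hb1, hb0, hbl, hb⟩ := exists_missing h5 h2 h01 hl1 (by grind)
  obtain ⟨a, ha1, ha0, ham, ha⟩ := exists_missing h5 h2 h01 hm1 (by grind)
  have hcb := ne_of_missing h5 h2 h01 hkl h30 h3k h3l hc hb
  have hca := ne_of_missing h5 h2 h01 hkm h40 h4k h4m hc ha
  have hba := ne_of_missing h5 h2 h01 hlm h50 h5l h5m hb ha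
  have hak : a ∈ β k := by_contra fun hn => hca (hc a ha1 ha0 hn).symm
  have hal : a ∈ β l := by_contra fun hn => hba (hb a ha1 ha0 hn).symm
  have hbk : b ∈ β k := by_contra fun hn => hcb (hc b hb1 hb0 hn).symm
  have hbm : b ∈ β m := by_contra fun hn => hba (ha b hb1 hb0 hn)
  have hcl : c ∈ β l := by_contra fun hn => hcb (hb c hc1 hc0 hn)
  have hcm : c ∈ β m := by_contra fun hn => hca (ha c hc1 hc0 hn)
  have z1k := inter_eq_pair h2 hk1 hba.symm ha1 hak hb1 hbk
  have z1l := inter_eq_pair h2 hl1 hca.symm ha1 hal hc1 hcl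
  have z1m := inter_eq_pair h2 hm1 hcb.symm hb1 hbm hc1 hcm
  have zkl := inter_eq_pair h2 hkl (by rintro rfl; exact ha0 h30) h3k h3l hak hal
  have zkm := inter_eq_pair h2 hkm (by rintro rfl; exact hb0 h40) h4k h4m hbk hbm
  have zlm := inter_eq_pair h2 hlm (by rintro rfl; exact hc0 h50) h5l h5m hcl hcm
  -- The fifth points of `k`, `l` and `m` lie on none of the other four blocks.
  obtain ⟨d, hdk, hd3, hd4, hda, hdb⟩ := exists_fifth (h5 k) x₃ x₄ a b
  obtain ⟨e, hel, he3, he5, hea, hec⟩ := exists_fifth (h5 l) x₃ x₅ a c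
  obtain ⟨f, hfm, hf4, hf5, hfb, hfc⟩ := exists_fifth (h5 m) x₄ x₅ b c
  have hd0 : d ∉ β i₀ := fun hn => (zk d hn hdk).elim hd3 hd4
  have hd1 : d ∉ β i₁ := fun hn => (z1k d hn hdk).elim hda hdb
  have hdl : d ∉ β l := fun hn => (zkl d hdk hn).elim hd3 hda
  have hdm : d ∉ β m := fun hn => (zkm d hdk hn).elim hd4 hdb
  have he0 : e ∉ β i₀ := fun hn => (zl e hn hel).elim he3 he5
  have he1 : e ∉ β i₁ := fun hn => (z1l e hn hel).elim hea hec
  have hek : e ∉ β k := fun hn => (zkl e hn hel).elim he3 hea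
  have hem : e ∉ β m := fun hn => (zlm e hel hn).elim he5 hec
  have hf0 : f ∉ β i₀ := fun hn => (zm f hn hfm).elim hf4 hf5
  have hf1 : f ∉ β i₁ := fun hn => (z1m f hn hfm).elim hfb hfc
  have hfk : f ∉ β k := fun hn => (zkm f hn hfm).elim hf4 hfb
  have hfl : f ∉ β l := fun hn => (zlm f hn hfm).elim hf5 hfc
  let p : Fin 11 → E := ![x₁, x₂, x₃, x₄, x₅, a, b, c, d, e, f]
  have T : ∀ {P Q : Prop}, P → Q → (P ↔ Q) := fun hp hq => iff_of_true hp hq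
  have N : ∀ {P Q : Prop}, ¬P → ¬Q → (P ↔ Q) := fun hp hq => iff_of_false hp hq
  have q0 : ∀ j, p j ∈ β i₀ ↔ j ∈ biplane 0 := by
    intro j; fin_cases j
    exacts [T h10 (by decide), T h20 (by decide), T h30 (by decide), T h40 (by decide),
      T h50 (by decide), N ha0 (by decide), N hb0 (by decide), N hc0 (by decide),
      N hd0 (by decide), N he0 (by decide), N hf0 (by decide)]
  have q1 : ∀ j, p j ∈ β i₁ ↔ j ∈ biplane 1 := by
    intro j; fin_cases j
    exacts [T h11 (by decide), T h21 (by decide), N h31 (by decide), N h41 (by decide),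
      N h51 (by decide), T ha1 (by decide), T hb1 (by decide), T hc1 (by decide),
      N hd1 (by decide), N he1 (by decide), N hf1 (by decide)]
  have q2 : ∀ j, p j ∈ β k ↔ j ∈ biplane 2 := by
    intro j; fin_cases j
    exacts [N h1k (by decide), N h2k (by decide), T h3k (by decide), T h4k (by decide),
      N h5k (by decide), T hak (by decide), T hbk (by decide), N hck (by decide),
      T hdk (by decide), N hek (by decide), N hfk (by decide)]
  have q3 : ∀ j, p j ∈ β l ↔ j ∈ biplane 3 := by
    intro j; fin_cases j
    exacts [N h1l (by decide), N h2l (by decide), T h3l (by decide), N h4l (by decide),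
      T h5l (by decide), T hal (by decide), N hbl (by decide), T hcl (by decide),
      N hdl (by decide), T hel (by decide), N hfl (by decide)]
  have q4 : ∀ j, p j ∈ β m ↔ j ∈ biplane 4 := by
    intro j; fin_cases j
    exacts [N h1m (by decide), N h2m (by decide), N h3m (by decide), T h4m (by decide),
      T h5m (by decide), N ham (by decide), T hbm (by decide), T hcm (by decide),
      N hdm (by decide), N hem (by decide), T hfm (by decide)]
  have hp : Function.Injective p := by
    intro s t hst
    -- The five blocks separate all labels except 0 and 1, whose points `x₁` and `x₂` are distinct
    -- by choice.
    have hsep : ∀ s t : Fin 11, (s ∈ biplane 0 ↔ t ∈ biplane 0) → (s ∈ biplane 1 ↔ t ∈ biplane 1) →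
        (s ∈ biplane 2 ↔ t ∈ biplane 2) → (s ∈ biplane 3 ↔ t ∈ biplane 3) →
        (s ∈ biplane 4 ↔ t ∈ biplane 4) → s = t ∨ (s = 0 ∧ t = 1) ∨ (s = 1 ∧ t = 0) := by
      decide +kernel
    rcases hsep s t (by rw [← q0, ← q0, hst]) (by rw [← q1, ← q1, hst]) (by rw [← q2, ← q2, hst])
      (by rw [← q3, ← q3, hst]) (by rw [← q4, ← q4, hst]) with h | ⟨rfl, rfl⟩ | ⟨rfl, rfl⟩
    · exact h
    · exact absurd hst h12
    · exact absurd hst h12.symm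
  refine ⟨Equiv.ofBijective p ((Fintype.bijective_iff_injective_and_card p).2
    ⟨hp, by rw [hE, Fintype.card_fin]⟩), ?_⟩
  simp only [firstBlocks, mem_insert, mem_singleton, forall_eq_or_imp, forall_eq]
  exact ⟨⟨i₀, q0⟩, ⟨i₁, q1⟩, ⟨k, q2⟩, ⟨l, q3⟩, ⟨m, q4⟩⟩

variable [DecidableEq F]

/-- The biplane on eleven points is unique. -/
theorem biplane_unique (hE : Fintype.card E = 11) (hF : Fintype.card F = 11)
    (h5 : ∀ i, #(β i) = 5) (hle : ∀ i j, i ≠ j → #(β i ∩ β j) ≤ 2) :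
    ∃ (p : Fin 11 ≃ E) (q : Fin 11 ≃ F), ∀ i j, p j ∈ β (q i) ↔ j ∈ biplane i := by
  obtain ⟨h2, hd⟩ := biplane_counts hE hF h5 hle
  obtain ⟨p, hp⟩ := exists_labels hE hF h5 h2 hd
  let γ : (Fin 11 ≃ E) → F → Finset (Fin 11) := fun p i => (β i).map p.symm.toEmbedding
  have hγ : ∀ p i j, j ∈ γ p i ↔ p j ∈ β i := by
    intro p i j; simp [γ]
  have g5 : ∀ p i, #(γ p i) = 5 := fun p i => by rw [card_map, h5]
  have g2 : ∀ p i j, i ≠ j → #(γ p i ∩ γ p j) = 2 := fun p i j hij => by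
    rw [← map_inter, card_map, h2 i j hij]
  have hk : ∀ k ∈ firstBlocks, ∃ i, γ p i = biplane k := by
    intro k hkm
    obtain ⟨i, hi⟩ := hp k hkm
    exact ⟨i, by ext j; rw [hγ, hi]⟩
  obtain ⟨i₀, hi₀⟩ := hk 0 (by simp)
  -- Among the first five blocks only block 0 contains both points 0 and 2. A second block through
  -- them is therefore new, and it tells the labels 0 and 1 apart.
  obtain ⟨i, hi, hi0, hi2⟩ :=
    exists_other_block hd (p.injective.ne (by decide : (0 : Fin 11) ≠ 2)) i₀
  have hik : ∀ k ∈ firstBlocks, #(γ p i ∩ biplane k) = 2 := by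
    intro k hkm
    obtain ⟨j, hj⟩ := hk k hkm
    rw [← hj]
    refine g2 p i j ?_
    rintro rfl
    rw [← hγ, hj] at hi0 hi2
    have : ∀ k ∈ firstBlocks, 0 ∈ biplane k → 2 ∈ biplane k → k = 0 := by decide +kernel
    have := this k hkm hi0 hi2
    subst this
    refine hi ?_
    by_contra hne
    have := g2 p i i₀ hne
    rw [hj, hi₀, inter_self] at this
    exact absurd this (by decide +kernel)
  rcases eq_of_card_inter_of_mem (g5 p i) hik ((hγ _ _ _).2 hi0) ((hγ _ _ _).2 hi2) with h | h
  · obtain ⟨q, hq⟩ := exists_equiv_biplane hF (g5 p) (g2 p) hk ⟨i, Or.inl h⟩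
    exact ⟨p, q, fun i j => by rw [← hγ, hq]⟩
  -- Exchanging the labels 0 and 1 fixes the first five blocks and turns the sixth into block 8.
  · let p' := (Equiv.swap 0 1).trans p
    have hγ' : ∀ i, γ p' i = (γ p i).map (Equiv.swap 0 1).toEmbedding := by
      intro i
      ext j
      rw [hγ, mem_map_equiv, hγ]
      simp [p']
    have hk' : ∀ k ∈ firstBlocks, ∃ i, γ p' i = biplane k := by
      intro k hkm
      obtain ⟨i, hi⟩ := hk k hkm
      refine ⟨i, ?_⟩
      rw [hγ', hi]
      revert k
      have : ∀ k ∈ firstBlocks, (biplane k).map (Equiv.swap 0 1).toEmbedding = biplane k := by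
        decide +kernel
      exact fun k hkm _ => this k hkm
    have h8 : γ p' i = biplane 8 := by
      rw [hγ', h]
      decide +kernel
    obtain ⟨q, hq⟩ := exists_equiv_biplane hF (g5 p') (g2 p') hk' ⟨i, Or.inr h8⟩
    exact ⟨p', q, fun i j => by rw [← hγ, hq]⟩

end Biplane

/-! ### The standard Witt design -/

/-- The words of the binary Golay code of length `23`, on the points and the blocks of the biplane
and one further point. -/
def codeword (A : Finset (Fin 11)) (ε : Bool) : Finset (Option (Fin 11 ⊕ Fin 11)) :=
  {x | x.elim ε (Sum.elim (fun j => decide (j ∈ A))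
    fun i => decide (Odd (#(A \ biplane i) + ε.toNat))) = true}

section codeword

variable {A A' : Finset (Fin 11)} {ε ε' : Bool}

theorem none_mem_codeword : none ∈ codeword A ε ↔ ε = true := by simp [codeword]

theorem inl_mem_codeword {j : Fin 11} : some (Sum.inl j) ∈ codeword A ε ↔ j ∈ A := by
  simp [codeword]

theorem inr_mem_codeword {i : Fin 11} :
    some (Sum.inr i) ∈ codeword A ε ↔ Odd (#(A \ biplane i) + ε.toNat) := by
  simp [codeword]

theorem codeword_injective (h : codeword A ε = codeword A' ε') : A = A' ∧ ε = ε' := by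
  constructor
  · ext j; rw [← inl_mem_codeword (ε := ε), h, inl_mem_codeword]
  · rw [Bool.eq_iff_iff, ← none_mem_codeword (A := A), h, none_mem_codeword]

end codeword

theorem card_symmDiff_add {α : Type*} [DecidableEq α] (s t : Finset α) :
    #(symmDiff s t) + 2 * #(s ∩ t) = #s + #t := by
  have h1 : #(symmDiff s t) = #(s \ t) + #(t \ s) := by
    rw [symmDiff_def, sup_eq_union, card_union_of_disjoint disjoint_sdiff_sdiff]
  have h2 := card_sdiff_add_card_inter s t
  have h3 := card_sdiff_add_card_inter t s
  rw [inter_comm t s] at h3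
  omega

/-- The code is linear, because the parity of `#(A \ biplane i)` is additive under symmetric
difference. -/
theorem symmDiff_codeword (A A' : Finset (Fin 11)) (ε ε' : Bool) :
    symmDiff (codeword A ε) (codeword A' ε') = codeword (symmDiff A A') (xor ε ε') := by
  ext x
  rcases x with _ | j | i
  · simp only [mem_symmDiff, none_mem_codeword]
    cases ε <;> cases ε' <;> simp
  · simp only [mem_symmDiff, inl_mem_codeword]
  · simp only [mem_symmDiff, inr_mem_codeword]
    have e : symmDiff A A' \ biplane i = symmDiff (A \ biplane i) (A' \ biplane i) := by
      ext j; simp only [mem_sdiff, mem_symmDiff]; tauto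
    have := card_symmDiff_add (A \ biplane i) (A' \ biplane i)
    rw [e]
    simp only [Nat.odd_iff]
    cases ε <;> cases ε' <;> simp <;> omega

/-! ### Weights of the words of the Golay code -/

/-- The parity of the number of ones of a number below `2 ^ 12`. -/
def bitParity (m : ℕ) : ℕ := (27030 >>> ((m ^^^ (m >>> 4) ^^^ (m >>> 8)) &&& 15)) % 2

/-- In hexadecimal 27030 is 6996, whose binary digit number j is the parity of the nibble j. Adding
the three nibbles modulo two preserves the parity. -/
theorem bitParity_eq {m : ℕ} (hm : m < 2048) : bitParity m = bitCount 11 m % 2 := by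
  have key : allBits (fun m => bitParity m == bitCount 11 m % 2) 11 0 = true := by decide +kernel
  exact beq_iff_eq.1 (of_allBits key (a := m) (by simp) (by simpa using hm))

theorem card_codeword (a : ℕ) (ε : Bool) :
    #(codeword (bits 11 a) ε) = ε.toNat + (bitCount 11 a +
      ∑ i, (bitParity (a &&& (2047 - biplaneMask i)) + ε.toNat) % 2) := by
  have hc : ∀ i, bits 11 a \ biplane i = bits 11 (a &&& (2047 - biplaneMask i)) := by
    intro i
    have : ∀ i j : Fin 11, (2047 - biplaneMask i).testBit j = !(biplaneMask i).testBit j := by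
      decide +kernel
    ext j
    simp [biplane, mem_bits, this]
  rw [card_eq_sum_ones, codeword, sum_filter, Fintype.sum_option, Fintype.sum_sum_type]
  refine congrArg₂ (· + ·) (by cases ε <;> rfl) (congrArg₂ (· + ·) ?_ ?_)
  · rw [← card_bits, card_eq_sum_ones, ← sum_filter]
    simp
  · refine sum_congr rfl fun i _ => ?_
    have hlt : a &&& (2047 - biplaneMask i) < 2048 :=
      Nat.lt_succ_of_le (Nat.and_le_right.trans (Nat.sub_le _ _))
    rw [bitParity_eq hlt]
    simp only [Option.elim_some, Sum.elim_inr, hc, card_bits, Nat.odd_iff, decide_eq_true_eq]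
    split_ifs with h <;> omega

/-- The weight of a code word, computed from a bit mask. -/
def wordWeight (a e : ℕ) : ℕ :=
  e + (bitCount 11 a + (bitParity (a &&& 2016) + e) % 2 + (bitParity (a &&& 1820) + e) % 2 +
    (bitParity (a &&& 1683) + e) % 2 + (bitParity (a &&& 1355) + e) % 2 +
    (bitParity (a &&& 807) + e) % 2 + (bitParity (a &&& 442) + e) % 2 +
    (bitParity (a &&& 1142) + e) % 2 + (bitParity (a &&& 718) + e) % 2 +
    (bitParity (a &&& 633) + e) % 2 + (bitParity (a &&& 469) + e) % 2 +
    (bitParity (a &&& 1197) + e) % 2)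

/-- The literals in `wordWeight` are the complements 2047 - `biplaneMask i`. -/
theorem card_codeword_eq (a : ℕ) (ε : Bool) :
    #(codeword (bits 11 a) ε) = wordWeight a ε.toNat := by
  rw [card_codeword, wordWeight]
  simp only [Fin.sum_univ_succ, biplaneMask]
  simp
  ring

/-- The number of `m` with given leading digits and `k` more that have a property. -/
def countBits (p : ℕ → Bool) : ℕ → ℕ → ℕ
  | 0, m => (p m).toNat
  | k + 1, m => countBits p k (2 * m) + countBits p k (2 * m + 1)

theorem countBits_eq (p : ℕ → Bool) (k m : ℕ) :
    countBits p k m = #{a ∈ Ico (2 ^ k * m) (2 ^ k * (m + 1)) | p a} := by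
  induction k generalizing m with
  | zero =>
    rw [countBits, pow_zero, one_mul, one_mul, Nat.Ico_succ_singleton, filter_singleton]
    cases p m <;> rfl
  | succ k ih =>
    rw [countBits, ih, ih, ← card_union_of_disjoint, ← filter_union,
      Ico_union_Ico_eq_Ico (Nat.mul_le_mul_left _ (by omega)) (Nat.mul_le_mul_left _ (by omega))]
    · rw [pow_succ]; ring_nf
    · exact disjoint_filter_filter (Ico_disjoint_Ico_consecutive _ _ _)

/-- The minimum weight of the code, checked on all 2^12 words. Weight zero is excluded by
nonemptiness. -/
theorem seven_le_card_codeword {A : Finset (Fin 11)} {ε : Bool}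
    (h : (codeword A ε).Nonempty) : 7 ≤ #(codeword A ε) := by
  obtain ⟨a, ha, rfl⟩ := exists_bits_eq A
  rw [← card_pos] at h
  rw [card_codeword_eq] at *
  have key : allBits (fun a => decide ((wordWeight a 0 = 0 ∨ 7 ≤ wordWeight a 0) ∧
      7 ≤ wordWeight a 1)) 11 0 = true := by decide +kernel
  have := of_decide_eq_true (of_allBits key (a := a) (by simp) (by simpa using ha))
  cases ε
  · exact this.1.resolve_left h.ne'
  · exact this.2

/-- The standard Witt design: the words of weight seven. -/
def wittDesign : Finset (Finset (Option (Fin 11 ⊕ Fin 11))) :=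
  ({x | #(codeword x.1 x.2) = 7} : Finset (Finset (Fin 11) × Bool)).image fun x => codeword x.1 x.2

theorem mem_wittDesign {b : Finset (Option (Fin 11 ⊕ Fin 11))} :
    b ∈ wittDesign ↔ #b = 7 ∧ ∃ A ε, codeword A ε = b := by
  simp only [wittDesign, mem_image, mem_filter, mem_univ, true_and, Prod.exists]
  constructor
  · rintro ⟨A, ε, h, rfl⟩; exact ⟨h, A, ε, rfl⟩
  · rintro ⟨h, A, ε, rfl⟩; exact ⟨A, ε, h, rfl⟩

theorem card_wittDesign : #wittDesign = 253 := by
  rw [wittDesign, card_image_of_injective]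
  swap
  · rintro ⟨A, ε⟩ ⟨A', ε'⟩ h
    obtain ⟨rfl, rfl⟩ := codeword_injective h
    rfl
  have h1 : ∀ ε : Bool, #{A : Finset (Fin 11) | #(codeword A ε) = 7} =
      countBits (fun a => decide (wordWeight a ε.toNat = 7)) 11 0 := by
    intro ε
    rw [countBits_eq]
    symm
    refine card_bij (fun a _ => bits 11 a) ?_ ?_ ?_
    · intro a ha
      simp only [mem_filter, decide_eq_true_eq, mem_univ, true_and] at ha ⊢
      rw [card_codeword_eq, ha.2]
    · intro a ha a' ha' h
      simp only [mem_filter, mem_Ico] at ha ha'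
      refine Nat.eq_of_testBit_eq fun i => ?_
      rcases lt_or_ge i 11 with hi | hi
      · have := Finset.ext_iff.1 h ⟨i, hi⟩
        rw [mem_bits, mem_bits] at this
        exact Bool.eq_iff_iff.2 this
      · have hp : 2 ^ 11 ≤ 2 ^ i := Nat.pow_le_pow_right two_pos hi
        rw [Nat.testBit_lt_two_pow (by omega), Nat.testBit_lt_two_pow (by omega)]
    · intro A hA
      obtain ⟨a, ha, rfl⟩ := exists_bits_eq A
      refine ⟨a, ?_, rfl⟩
      simp only [mem_filter, mem_univ, true_and, card_codeword_eq] at hA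
      simp only [mem_filter, mem_Ico, decide_eq_true_eq]
      exact ⟨⟨by simp, by simpa using ha⟩, hA⟩
  have h2 : #{x : Finset (Fin 11) × Bool | #(codeword x.1 x.2) = 7} =
      ∑ ε : Bool, #{A : Finset (Fin 11) | #(codeword A ε) = 7} := by
    simp only [card_filter]
    rw [Fintype.sum_prod_type_right]
  rw [h2]
  simp only [h1]
  decide +kernel

attribute [irreducible] wittDesign

/-- The symmetric difference is a nonzero word of weight 14 - 2 `#(b ∩ b')`, which is at least 7. -/
theorem card_inter_wittDesign {b b' : Finset (Option (Fin 11 ⊕ Fin 11))} (hb : b ∈ wittDesign)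
    (hb' : b' ∈ wittDesign) (hne : b ≠ b') : #(b ∩ b') ≤ 3 := by
  obtain ⟨h7, A, ε, rfl⟩ := mem_wittDesign.1 hb
  obtain ⟨h7', A', ε', rfl⟩ := mem_wittDesign.1 hb'
  have h1 := card_symmDiff_add (codeword A ε) (codeword A' ε')
  have h2 : (symmDiff (codeword A ε) (codeword A' ε')).Nonempty := by
    rw [nonempty_iff_ne_empty]
    intro h0
    exact hne (symmDiff_eq_bot.1 h0)
  rw [symmDiff_codeword] at h1 h2
  have := seven_le_card_codeword h2
  omega

/-! ### Uniqueness of the Witt design -/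

section Uniqueness

variable {V : Type*} [Fintype V] [DecidableEq V] {W : Finset (Finset (Option V))}

theorem card_preimage_add {D : Finset (Option V)} (s : Finset (Option V)) :
    #{e : {v : V // ¬ some v ∈ D} | some e.1 ∈ s} + #(s ∩ (insert none D)) = #s := by
  have : #{e : {v : V // ¬ some v ∈ D} | some e.1 ∈ s} = #(s \ insert none D) := by
    refine card_bij (fun e _ => some e.1) ?_ ?_ ?_
    · rintro ⟨e, he⟩ h
      simpa [he] using h
    · rintro ⟨e, he⟩ _ ⟨e', he'⟩ _ h
      simpa using h
    · rintro (_ | v) hv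
      · simp at hv
      · simp only [mem_sdiff, mem_insert, not_or] at hv
        exact ⟨⟨v, hv.2.2⟩, by simpa using hv.1, rfl⟩
  rw [this, card_sdiff_add_card_inter]

theorem odd_card_inter (h : IsDesign 4 23 7 1 W) {b b' : Finset (Option V)} (hb : b ∈ W)
    (hb' : b' ∈ W) : Odd #(b ∩ b') := by
  by_cases e : b' = b
  · rw [e, inter_self, h.card_block b hb]; decide
  · rcases h.card_inter hb hb' e with h | h <;> rw [h] <;> decide

theorem even_card_inter_symmDiff (h : IsDesign 4 23 7 1 W) {x b b' : Finset (Option V)}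
    (hx : x ∈ W) (hb : b ∈ W) (hb' : b' ∈ W) : Even #(x ∩ symmDiff b b') := by
  have e : x ∩ symmDiff b b' = symmDiff (x ∩ b) (x ∩ b') := by
    ext j; simp only [mem_inter, mem_symmDiff]; tauto
  have h1 := card_symmDiff_add (x ∩ b) (x ∩ b')
  have h2 := odd_card_inter h hx hb
  have h3 := odd_card_inter h hx hb'
  rw [← e] at h1
  rw [Nat.odd_iff] at h2 h3
  rw [Nat.even_iff]
  omega

/-- Two blocks meeting in one point, of which exactly the first contains a given point. -/
theorem exists_blocks (h : IsDesign 4 23 7 1 W) :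
    ∃ b₁ ∈ W, ∃ b₂ ∈ W, none ∈ b₁ ∧ none ∉ b₂ ∧ #(b₁ ∩ b₂) = 1 := by
  have h77 := h.card_one (T := {none}) (card_singleton _)
  obtain ⟨b₁, hb₁⟩ := card_pos.1 (by omega : 0 < #{b ∈ W | {none} ⊆ b})
  simp only [mem_filter, singleton_subset_iff] at hb₁
  refine ⟨b₁, hb₁.1, ?_⟩
  -- Otherwise all 176 blocks missing ∞ meet `b₁` in three points. Counting incidences with the six
  -- other points of `b₁` would give 6 · 77 = 6 · 21 + 3 · 176.
  by_contra! hc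
  have hc3 : ∀ b ∈ W, none ∉ b → #(b₁ ∩ b) = 3 := fun b hb hn =>
    (h.card_inter hb₁.1 hb (fun e => hn (e ▸ hb₁.2))).resolve_left (hc b hb hb₁.2 hn)
  have hA : #(b₁.erase none) = 6 := by rw [card_erase_of_mem hb₁.2, h.card_block _ hb₁.1]
  have s1 := sum_choose_card_inter (W := W) (k := 1) (l := 77) (T := ∅) (A := b₁.erase none)
    (by simp) (fun U hU => h.card_one (by simpa using hU))
  have s2 := sum_choose_card_inter (W := W) (k := 1) (l := 21) (T := {none}) (A := b₁.erase none)
    (by simp) (fun U hU => h.card_two (by simpa using hU))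
  simp only [empty_subset, filter_true, Nat.choose_one_right, hA, singleton_subset_iff] at s1 s2
  rw [← sum_filter_add_sum_filter_not W (fun b => none ∈ b), s2] at s1
  have e : ∀ b ∈ {b ∈ W | none ∉ b}, #(b₁.erase none ∩ b) = 3 := by
    intro b hb
    simp only [mem_filter] at hb
    rw [← hc3 b hb.1 hb.2]
    congr 1
    ext v
    simp only [mem_inter, mem_erase]
    constructor
    · rintro ⟨⟨_, a⟩, b⟩; exact ⟨a, b⟩
    · rintro ⟨a, c⟩; exact ⟨⟨fun hv => hb.2 (hv ▸ c), a⟩, c⟩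
  have hn := card_filter_add_card_filter_not (s := W) (fun b => none ∈ b)
  simp only [singleton_subset_iff] at h77
  rw [h.card_eq, h77] at hn
  rw [sum_congr rfl e, sum_const, smul_eq_mul] at s1
  omega

/-- The 21 blocks through ∞ and `v` meet the other ten points of `D` in an even number u of points,
with Σ u = 50 and Σ C(u,2) = 45. Hence Σ (u - 2)(u - 4) = 90 - 250 + 168 = 8, whereas the sum would
be zero if u were always 2 or 4. So u = 0 occurs. -/
theorem exists_block_inter_eq (h : IsDesign 4 23 7 1 W) {D : Finset (Option V)} (hD : #D = 12)
    (heven : ∀ x ∈ W, Even #(x ∩ D)) (hn : none ∈ D) {v : V} (hv : some v ∈ D) :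
    ∃ b ∈ W, b ∩ D = {none, some v} := by
  have hT : #({none, some v} : Finset (Option V)) = 2 := card_pair (by simp)
  have hTD : ({none, some v} : Finset (Option V)) ⊆ D := by simp [insert_subset_iff, hn, hv]
  have hA : #(D \ {none, some v}) = 10 := by rw [card_sdiff_of_subset hTD, hD, hT]
  have hdis : Disjoint ({none, some v} : Finset (Option V)) (D \ {none, some v}) := disjoint_sdiff
  have s0 := h.card_two hT
  have s1 := sum_choose_card_inter (W := W) (k := 1) (l := 5) hdis
    (fun U hU => h.card_three (by rw [hU, hT]))
  have s2 := sum_choose_card_inter (W := W) (k := 2) (l := 1) hdis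
    (fun U hU => h.balanced U (by rw [hU, hT]))
  rw [hA] at s1 s2
  have hsplit : ∀ b, {none, some v} ⊆ b → #(b ∩ D) = #((D \ {none, some v}) ∩ b) + 2 := by
    intro b hb
    rw [← hT, ← card_union_of_disjoint
      (disjoint_of_subset_left inter_subset_left disjoint_sdiff_self_left)]
    congr 1
    ext z
    simp only [mem_inter, mem_union, mem_sdiff]
    constructor
    · rintro ⟨a, c⟩; by_cases hz : z ∈ ({none, some v} : Finset (Option V)) <;> tauto
    · rintro (⟨⟨a, _⟩, c⟩ | a)
      · exact ⟨c, a⟩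
      · exact ⟨hb a, hTD a⟩
  by_contra! hc
  have hval : ∀ b ∈ {b ∈ W | {none, some v} ⊆ b},
      2 * ((#((D \ {none, some v}) ∩ b)).choose 2 : ℤ) -
        5 * (#((D \ {none, some v}) ∩ b)).choose 1 + 8 = 0 := by
    intro b hb
    simp only [mem_filter] at hb
    have h1 := hsplit b hb.2
    have h2 := heven b hb.1
    have h3 : #(b ∩ D) ≤ 7 := h.card_block b hb.1 ▸ card_le_card inter_subset_left
    rw [h1, Nat.even_iff] at h2
    have h4 : #((D \ {none, some v}) ∩ b) ≠ 0 := by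
      intro h0
      refine hc b hb.1 (eq_of_subset_of_card_le (subset_inter hb.2 hTD) ?_).symm
      rw [h1, h0, hT]
    have h5 : #((D \ {none, some v}) ∩ b) ≤ 5 := by omega
    generalize #((D \ {none, some v}) ∩ b) = j at *
    interval_cases j <;> simp_all [Nat.choose]
  have hs := sum_eq_zero hval
  rw [sum_add_distrib, sum_sub_distrib, ← mul_sum, ← mul_sum, sum_const, s0] at hs
  zify at s1 s2
  rw [s1, s2] at hs
  norm_num [Nat.choose] at hs

/-- Every Witt design on `V ∪ {∞}` is the standard one, for a suitable labelling of `V`. -/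
theorem exists_equiv_wittDesign (h : IsDesign 4 23 7 1 W) : ∃ φ : Fin 11 ⊕ Fin 11 ≃ V,
    W = wittDesign.image fun b => b.map (Equiv.optionCongr φ).toEmbedding := by
  obtain ⟨b₁, hb₁, b₂, hb₂, hn₁, hn₂, h12⟩ := exists_blocks h
  -- A 12-set through ∞ that meets every block evenly. It splits the remaining 22 points into eleven
  -- inside and eleven outside.
  set D := symmDiff b₁ b₂ with hDdef
  have hD : #D = 12 := by
    have := card_symmDiff_add b₁ b₂
    rw [← hDdef, h12, h.card_block _ hb₁, h.card_block _ hb₂] at this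
    omega
  have heven : ∀ x ∈ W, Even #(x ∩ D) := fun x hx => even_card_inter_symmDiff h hx hb₁ hb₂
  have hn : none ∈ D := mem_symmDiff.2 (Or.inl ⟨hn₁, hn₂⟩)
  have hpre : ∀ s : Finset (Option V),
      #{e : {v : V // ¬ some v ∈ D} | some e.1 ∈ s} + #(s ∩ D) = #s := fun s => by
    have := card_preimage_add (D := D) s
    rwa [insert_eq_of_mem hn] at this
  have hE : Fintype.card {v : V // ¬ some v ∈ D} = 11 := by
    have := hpre univ
    rw [univ_inter, hD, card_univ, h.card_points] at this
    simp only [mem_univ, filter_true, card_univ] at this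
    omega
  have hF : Fintype.card {v : V // some v ∈ D} = 11 := by
    have h1 := Fintype.card_subtype_compl (fun v : V => some v ∈ D)
    have h2 := Fintype.card_subtype_le (fun v : V => some v ∈ D)
    have h3 := h.card_points
    rw [Fintype.card_option] at h3
    omega
  have hblk : ∀ v : {v : V // some v ∈ D}, ∃ b ∈ W, b ∩ D = {none, some v.1} := fun v =>
    exists_block_inter_eq h hD heven hn v.2
  choose blk hblkW hblkD using hblk
  -- The point `v` of `D` other than ∞ becomes a biplane block: the five points of `blk v` outside
  -- `D`. Two of these blocks share ∞ and at most three points in all, hence at most two outside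
  -- `D`.
  let β : {v : V // some v ∈ D} → Finset {v : V // ¬ some v ∈ D} :=
    fun v => {e | some e.1 ∈ blk v}
  have h5 : ∀ v, #(β v) = 5 := by
    intro v
    have := hpre (blk v)
    rw [hblkD, card_pair (by simp), h.card_block _ (hblkW v)] at this
    simp only [β]
    omega
  have h2 : ∀ v v', v ≠ v' → #(β v ∩ β v') ≤ 2 := by
    intro v v' hne
    have hbne : blk v' ≠ blk v := by
      intro e
      have : some v.1 ∈ ({none, some v'.1} : Finset (Option V)) := by
        rw [← hblkD, e, hblkD]; simp
      simp only [mem_insert, mem_singleton, reduceCtorEq, Option.some.injEq, false_or] at this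
      exact hne (Subtype.ext this)
    have h1 := h.card_inter (hblkW v) (hblkW v') hbne
    have h2 := hpre (blk v ∩ blk v')
    have h3 : 0 < #(blk v ∩ blk v' ∩ D) := by
      rw [card_pos]
      have m : ∀ v, none ∈ blk v := fun v => by
        have : none ∈ blk v ∩ D := by rw [hblkD]; simp
        exact (mem_inter.1 this).1
      exact ⟨none, by simp [m, hn]⟩
    have h4 : β v ∩ β v' =
        ({e | some e.1 ∈ blk v ∩ blk v'} : Finset {v : V // ¬ some v ∈ D}) := by
      ext e; simp [β]
    rw [h4]
    omega
  obtain ⟨p, q, hpq⟩ := biplane_unique hE hF h5 h2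
  let φ : Fin 11 ⊕ Fin 11 ≃ V := ((Equiv.sumCongr p q).trans (Equiv.sumComm _ _)).trans
    (Equiv.sumCompl fun v : V => some v ∈ D)
  have hφl : ∀ j, φ (Sum.inl j) = (p j).1 := fun j => by simp [φ]
  have hφr : ∀ i, φ (Sum.inr i) = (q i).1 := fun i => by simp [φ]
  -- Both families have 253 blocks, so one inclusion is enough.
  refine ⟨φ, eq_of_subset_of_card_le ?_ ?_⟩
  swap
  · rw [h.card_eq, ← card_wittDesign]; exact card_image_le
  intro x hx
  refine mem_image.2 ⟨x.map (Equiv.optionCongr φ).symm.toEmbedding, ?_, ?_⟩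
  swap
  · rw [map_map]
    convert map_refl
    ext; simp
  rw [mem_wittDesign, card_map]
  refine ⟨h.card_block x hx, univ.filter fun j => some (p j).1 ∈ x, decide (none ∈ x), ?_⟩
  have hcardA : ∀ s : Finset (Option V), #{j | some (p j).1 ∈ s} + #(s ∩ D) = #s := by
    intro s
    rw [← hpre s]
    congr 1
    refine card_bij (fun j _ => p j) ?_ ?_ ?_
    · intro j hj; simpa using hj
    · intro j _ j' _ hjj; exact p.injective hjj
    · intro e he; exact ⟨p.symm e, by simpa using he, by simp⟩
  ext y
  rcases y with _ | j | i
  · rw [none_mem_codeword, mem_map_equiv]; simp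
  · rw [inl_mem_codeword, mem_map_equiv]; simp [hφl]
  · rw [inr_mem_codeword, mem_map_equiv]
    simp only [Equiv.symm_symm, Equiv.optionCongr_apply, Option.map_some, hφr]
    -- Let A be the trace of `x` outside `D`. Its size is odd, since `x` has seven points and meets
    -- `D` evenly. As `x` meets `blk (q i)` in an odd number of points, `#(A ∩ biplane i)` + [∞ ∈ x]
    -- + [q i ∈ x] is odd. Hence `#(A \ biplane i)` + [∞ ∈ x] has the parity of [q i ∈ x], which is
    -- the rule of `codeword`.
    have c1 := hcardA x
    have c2 := hcardA (x ∩ blk (q i))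
    have e1 := heven x hx
    have e2 := odd_card_inter h hx (hblkW (q i))
    have e3 : #(x ∩ blk (q i) ∩ D) =
        (decide (none ∈ x)).toNat + (decide (some (q i).1 ∈ x)).toNat := by
      rw [inter_assoc, hblkD]
      by_cases a : none ∈ x <;> by_cases b : some (q i).1 ∈ x <;> simp [a, b]
    have e4 := card_sdiff_add_card_inter (univ.filter fun j => some (p j).1 ∈ x) (biplane i)
    have e5 : (univ.filter fun j => some (p j).1 ∈ x) ∩ biplane i =
        univ.filter fun j => some (p j).1 ∈ x ∩ blk (q i) := by
      ext j
      simp only [mem_inter, mem_filter, mem_univ, true_and]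
      rw [← hpq]
      simp [β]
    rw [e5] at e4
    rw [e3] at c2
    rw [h.card_block x hx] at c1
    rw [Nat.even_iff] at e1
    rw [Nat.odd_iff] at e2 ⊢
    by_cases b : some (q i).1 ∈ x
    · simp only [b, decide_true, Bool.toNat_true, iff_true] at c2 ⊢
      omega
    · simp only [b, decide_false, Bool.toNat_false, iff_false] at c2 ⊢
      omega

/-- The standard Witt design, with labels from a set of `22` points. -/
theorem isDesign_image_wittDesign (φ : Fin 11 ⊕ Fin 11 ≃ V) :
    IsDesign 4 23 7 1 (wittDesign.image fun b => b.map (Equiv.optionCongr φ).toEmbedding) := by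
  have hV : Fintype.card V = 22 := by rw [← Fintype.card_congr φ]; simp
  refine isDesign_of_card_inter_le (by rw [Fintype.card_option, hV]) ?_ ?_ ?_
  · rw [card_image_of_injective _ (map_injective _), card_wittDesign]
  · simp only [mem_image, forall_exists_index, and_imp, forall_apply_eq_imp_iff₂, card_map]
    exact fun b hb => (mem_wittDesign.1 hb).1
  · simp only [mem_image, forall_exists_index, and_imp, forall_apply_eq_imp_iff₂]
    intro b hb b' hb' hne
    rw [← map_inter, card_map]
    exact card_inter_wittDesign hb hb' fun e => hne (by rw [e])

end Uniqueness

theorem exists_isDesign : ∃ W : Finset (Finset (Option (Fin 22))), IsDesign 4 23 7 1 W :=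
  ⟨_, isDesign_image_wittDesign finSumFinEquiv⟩

/-- Any two Witt designs are isomorphic by a map that fixes a given point. -/
theorem exists_perm_of_isDesign {W W' : Finset (Finset (Option (Fin 22)))}
    (h : IsDesign 4 23 7 1 W) (h' : IsDesign 4 23 7 1 W') : ∃ σ : Equiv.Perm (Fin 22),
      W' = W.image fun b => b.map (Equiv.optionCongr σ).toEmbedding := by
  obtain ⟨φ, rfl⟩ := exists_equiv_wittDesign h
  obtain ⟨φ', rfl⟩ := exists_equiv_wittDesign h'
  refine ⟨φ.symm.trans φ', ?_⟩
  rw [image_image]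
  refine image_congr fun b _ => ?_
  simp only [Function.comp_apply, map_map]
  congr 1
  ext x : 1
  rcases x with _ | x <;> simp [-Equiv.optionCongr_symm]

/-! ### The parameters of tight relative designs -/

theorem card_inter_bounds {x y : Finset (Fin 22)} {r : ℕ} (hx : #x = r) (hy : #y = r)
    (hne : x ≠ y) : #(x ∩ y) < r ∧ 2 * r ≤ #(x ∩ y) + 22 := by
  have h1 := card_union_add_card_inter x y
  have h2 : #(x ∪ y) ≤ 22 := by simpa using card_le_univ (x ∪ y)
  have h3 : #(x ∩ y) ≤ r := hx ▸ card_le_card inter_subset_left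
  refine ⟨lt_of_le_of_ne h3 fun he => hne ?_, by omega⟩
  have e1 := eq_of_subset_of_card_le (inter_subset_left (s₁ := x) (s₂ := y)) (by omega)
  have e2 := eq_of_subset_of_card_le (inter_subset_right (s₁ := x) (s₂ := y)) (by omega)
  rw [← e1, e2]

/-- A finite check. The divisibility comes from the sum of two integral roots, and the equation is
arranged without negative terms; truncated subtraction is harmless because `r₁` and `r₂` are at
least 2. -/
theorem shells_of_cross_roots {r₁ r₂ u : ℕ} (h₁ : r₁ < 21) (h₂ : r₂ < 21) (hu : u < 21)
    (h : 2 ≤ r₁ ∧ r₁ < r₂ ∧ 10 ∣ (r₁ - 1) * (r₂ - 1) ∧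
      420 * u * u + r₁ * (r₁ - 1) * (r₂ * (r₂ - 1)) =
        420 * u + 42 * ((r₁ - 1) * (r₂ - 1)) * u) :
    (r₁ = 6 ∧ r₂ = 7) ∨ (r₁ = 6 ∧ r₂ = 15) ∨ (r₁ = 7 ∧ r₂ = 16) ∨ (r₁ = 15 ∧ r₂ = 16) := by
  have key : ∀ r₁ r₂ u : Fin 21, (2 ≤ r₁.val ∧ r₁.val < r₂.val ∧
      10 ∣ (r₁.val - 1) * (r₂.val - 1) ∧
      420 * u.val * u.val + r₁.val * (r₁.val - 1) * (r₂.val * (r₂.val - 1)) =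
        420 * u.val + 42 * ((r₁.val - 1) * (r₂.val - 1)) * u.val) →
      (r₁.val = 6 ∧ r₂.val = 7) ∨ (r₁.val = 6 ∧ r₂.val = 15) ∨ (r₁.val = 7 ∧ r₂.val = 16) ∨
        (r₁.val = 15 ∧ r₂.val = 16) := by
    decide +kernel
  exact key ⟨r₁, h₁⟩ ⟨r₂, h₂⟩ ⟨u, hu⟩ h

/-- Replace a large subset by its complement. -/
def smaller (b : Finset (Fin 22)) : Finset (Fin 22) := if 11 < #b then bᶜ else b

namespace TwoShell

variable {r₁ r₂ : ℕ} {B : Finset (Finset (Fin 22))} {v : Finset (Fin 22) → ℝ}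

/-- The shells of a tight relative `4`-design. -/
theorem shells (h : TwoShell r₁ r₂ B v) (hlt : r₁ < r₂) :
    (r₁ = 6 ∧ r₂ = 7) ∨ (r₁ = 6 ∧ r₂ = 15) ∨ (r₁ = 7 ∧ r₂ = 16) ∨ (r₁ = 15 ∧ r₂ = 16) := by
  obtain ⟨x, hx, x', hx', y, hy, hxr, hxr', hyr, hne⟩ := h.exists_two_cross
  have e1 := h.cross_eq hx hy hxr hyr
  have e2 := h.cross_eq hx' hy hxr' hyr
  have hu : #(x ∩ y) ≤ r₁ := hyr ▸ card_le_card inter_subset_right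
  generalize #(x ∩ y) = u at *
  generalize #(x' ∩ y) = u' at *
  have h1 := h.two_le₁
  have h2 := h.two_le₂
  have h3 := h.le₁
  have h4 := h.le₂
  have hne' : ((u : ℤ) - u') ≠ 0 := sub_ne_zero.2 (by exact_mod_cast hne)
  -- The sum of the two roots: the two equations are subtracted and `u - u'` is cancelled.
  have hsum : 10 * ((u : ℤ) + u' - 1) = (r₁ - 1) * (r₂ - 1) := by
    refine mul_left_cancel₀ hne' ?_
    linarith [e1, e2, (by ring : (42 : ℤ) * ((u - u') * (10 * (u + u' - 1))) -
      42 * ((u - u') * ((r₁ - 1) * (r₂ - 1))) =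
      (420 * (u : ℤ) * (u - 1) - 42 * (r₁ - 1) * (r₂ - 1) * u + r₁ * (r₁ - 1) * r₂ * (r₂ - 1)) -
      (420 * (u' : ℤ) * (u' - 1) - 42 * (r₁ - 1) * (r₂ - 1) * u' + r₁ * (r₁ - 1) * r₂ * (r₂ - 1)))]
  have c1 : ((r₁ - 1 : ℕ) : ℤ) = r₁ - 1 := by push_cast [show 1 ≤ r₁ by omega]; ring
  have c2 : ((r₂ - 1 : ℕ) : ℤ) = r₂ - 1 := by push_cast [show 1 ≤ r₂ by omega]; ring
  refine shells_of_cross_roots (u := u) (by omega) (by omega) (by omega) ⟨h1, hlt, ?_, ?_⟩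
  · zify
    rw [c1, c2, ← hsum]
    exact dvd_mul_right _ _
  · zify
    rw [c1, c2]
    linarith

theorem exists_ne (h : TwoShell r₁ r₂ B v) : ∃ x ∈ B, ∃ y ∈ B, #x = r₁ ∧ #y = r₁ ∧ x ≠ y := by
  have := h.lt_card
  obtain ⟨x, hx, y, hy, hxy⟩ := one_lt_card.1 (by omega : 1 < #{b ∈ B | #b = r₁})
  simp only [mem_filter] at hx hy
  exact ⟨x, hx.1, y, hy.1, hx.2, hy.2, hxy⟩

/-- The numbers of points on the shells. -/
theorem card_shells (h : TwoShell r₁ r₂ B v) (h₁ : r₁ = 6 ∨ r₁ = 16) (h₂ : r₂ = 7 ∨ r₂ = 15) :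
    #{b ∈ B | #b = r₁} = 77 ∧ #{b ∈ B | #b = r₂} = 176 := by
  obtain ⟨x, hx, y, hy, hxr, hyr, hxy⟩ := h.exists_ne
  obtain ⟨x', hx', y', hy', hxr', hyr', hxy'⟩ := h.symm.exists_ne
  have e1 := h.own_eq hx hy hxr hyr hxy
  have e2 := h.symm.own_eq hx' hy' hxr' hyr' hxy'
  have b1 := card_inter_bounds hxr hyr hxy
  have b2 := card_inter_bounds hxr' hyr' hxy'
  have hs := h.card_add_card
  generalize #(x ∩ y) = u at *
  generalize #(x' ∩ y') = u' at *
  generalize #{b ∈ B | #b = r₁} = N₁ at *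
  generalize #{b ∈ B | #b = r₂} = N₂ at *
  -- Complementation turns shell 16 into 6 and shell 15 into 7, lowers the intersection numbers by
  -- 10 and 8, and preserves the equation. The constants are 7200 = 6 · 5 · 16 · 15 and, below, 8820
  -- = 7 · 6 · 15 · 14.
  have k1 : ∃ t : ℕ, t < 6 ∧ 22 * (7200 : ℤ) - 462 * (6 - t) * 5 * 15 + (N₁ - 22) *
      (420 * t * (t - 1) - 1050 * t + 900) = 0 := by
    rcases h₁ with rfl | rfl
    · exact ⟨u, by omega, by push_cast at e1; linarith⟩
    · refine ⟨u - 10, by omega, ?_⟩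
      rw [Nat.cast_sub (by omega)]
      push_cast at e1 ⊢; linarith
  have k2 : ∃ t : ℕ, t < 7 ∧ 22 * (8820 : ℤ) - 462 * (7 - t) * 6 * 14 + (N₂ - 22) *
      (420 * t * (t - 1) - 1512 * t + 1764) = 0 := by
    rcases h₂ with rfl | rfl
    · exact ⟨u', by omega, by push_cast at e2; linarith⟩
    · refine ⟨u' - 8, by omega, ?_⟩
      rw [Nat.cast_sub (by omega)]
      push_cast at e2 ⊢; linarith
  obtain ⟨t, ht, k1⟩ := k1
  obtain ⟨t', ht', k2⟩ := k2
  clear e1 e2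
  interval_cases t <;> interval_cases t' <;> push_cast at k1 k2 <;> omega

/-- The weight of a tight relative `4`-design is constant. -/
theorem weight_const (h : TwoShell r₁ r₂ B v) (h₁ : r₁ = 6 ∨ r₁ = 16) (h₂ : r₂ = 7 ∨ r₂ = 15) :
    ∃ c, ∀ b ∈ B, v b = c := by
  obtain ⟨hN₁, hN₂⟩ := h.card_shells h₁ h₂
  have w1 : ∀ b ∈ B, #b = r₁ → v b * 77 = shellWeight B v r₁ := fun b hb hr => by
    have := h.weight_eq hb hr
    rw [hN₁] at this
    exact_mod_cast this
  have w2 : ∀ b ∈ B, #b = r₂ → v b * 176 = shellWeight B v r₂ := fun b hb hr => by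
    have := h.symm.weight_eq hb hr
    rw [hN₂] at this
    exact_mod_cast this
  have hc := h.card_shell
  have hS := h.norm_pos
  have a1 : shellNorm r₁ = 7200 := by rcases h₁ with rfl | rfl <;> norm_num [shellNorm]
  have a2 : shellNorm r₂ = 8820 := by rcases h₂ with rfl | rfl <;> norm_num [shellNorm]
  rw [hN₁, a1, a2] at hc
  rw [a1, a2] at hS
  -- `card_shell` with 77 points reads 55 (7200 W₁ + 8820 W₂) = 209 · 7200 W₁, that is W₂ : W₁ = 176
  -- : 77. The weight per point is then the same on both shells.
  have hW : shellWeight B v r₂ * 77 = shellWeight B v r₁ * 176 := by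
    have := hS.ne'
    field_simp at hc
    push_cast at hc
    linarith
  refine ⟨shellWeight B v r₁ / 77, fun b hb => ?_⟩
  rcases h.card_mem hb with hr | hr
  · rw [← w1 b hb hr]; ring
  · have := w2 b hb hr
    linarith

/-- The extra 1 accounts for the point ∞ that both sets will receive. For the sets reduced by
`smaller`, the quadratics have the roots 0 and 2 within the `r₁`-shell, and 1 and 3 within the other
shell and across. -/
theorem card_inter_smaller (h : TwoShell r₁ r₂ B v) (h₁ : r₁ = 6 ∨ r₁ = 16)
    (h₂ : r₂ = 7 ∨ r₂ = 15) {x y : Finset (Fin 22)} (hx : x ∈ B) (hy : y ∈ B) (hxy : x ≠ y) :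
    #(smaller x ∩ smaller y) + (if #x = r₁ ∧ #y = r₁ then 1 else 0) ≤ 3 := by
  obtain ⟨hN₁, hN₂⟩ := h.card_shells h₁ h₂
  have cc : ∀ x y : Finset (Fin 22), #(xᶜ ∩ yᶜ) + #x + #y = 22 + #(x ∩ y) := by
    intro x y
    have e1 := card_union_add_card_inter x y
    have e2 := card_compl_add_card (x ∪ y)
    rw [compl_union, Fintype.card_fin] at e2
    omega
  have ci : ∀ x y : Finset (Fin 22), #(xᶜ ∩ y) + #(x ∩ y) = #y := by
    intro x y
    rw [inter_comm, ← sdiff_eq_inter_compl, inter_comm x, card_sdiff_add_card_inter]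
  have ic : ∀ x y : Finset (Fin 22), #(x ∩ yᶜ) + #(x ∩ y) = #x := by
    intro x y
    rw [← sdiff_eq_inter_compl, card_sdiff_add_card_inter]
  have cross : ∀ {x y : Finset (Fin 22)}, x ∈ B → y ∈ B → #x = r₂ → #y = r₁ →
      #(smaller x ∩ smaller y) ≤ 3 := by
    intro x y hx hy hxr hyr
    have e := h.cross_eq hx hy hxr hyr
    have c1 := cc x y
    have c2 := ci x y
    have c3 := ic x y
    have b1 : #(x ∩ y) ≤ #y := card_le_card inter_subset_right
    rw [smaller, smaller, hxr, hyr]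
    rw [hxr, hyr] at c1
    rw [hyr] at c2 b1
    rw [hxr] at c3
    rcases h₁ with rfl | rfl <;> rcases h₂ with rfl | rfl <;> norm_num <;>
      generalize #(x ∩ y) = u at * <;> interval_cases u <;> norm_num at e <;> omega
  have own₁ : ∀ {x y : Finset (Fin 22)}, x ∈ B → y ∈ B → #x = r₁ → #y = r₁ → x ≠ y →
      #(smaller x ∩ smaller y) + 1 ≤ 3 := by
    intro x y hx hy hxr hyr hxy
    have e := h.own_eq hx hy hxr hyr hxy
    have b := card_inter_bounds hxr hyr hxy
    have c1 := cc x y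
    rw [smaller, smaller, hxr, hyr]
    rw [hN₁] at e
    rw [hxr, hyr] at c1
    rcases h₁ with rfl | rfl <;> norm_num <;> obtain ⟨b1, b2⟩ := b <;>
      generalize #(x ∩ y) = u at * <;> interval_cases u <;> norm_num at e <;> omega
  have own₂ : ∀ {x y : Finset (Fin 22)}, x ∈ B → y ∈ B → #x = r₂ → #y = r₂ → x ≠ y →
      #(smaller x ∩ smaller y) ≤ 3 := by
    intro x y hx hy hxr hyr hxy
    have e := h.symm.own_eq hx hy hxr hyr hxy
    have b := card_inter_bounds hxr hyr hxy
    have c1 := cc x y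
    rw [smaller, smaller, hxr, hyr]
    rw [hN₂] at e
    rw [hxr, hyr] at c1
    rcases h₂ with rfl | rfl <;> norm_num <;> obtain ⟨b1, b2⟩ := b <;>
      generalize #(x ∩ y) = u at * <;> interval_cases u <;> norm_num at e <;> omega
  have hne := h.ne
  rcases h.card_mem hx with hxr | hxr <;> rcases h.card_mem hy with hyr | hyr
  · rw [if_pos ⟨hxr, hyr⟩]; exact own₁ hx hy hxr hyr hxy
  · rw [if_neg (by omega), inter_comm]; exact cross hy hx hyr hxr
  · rw [if_neg (by omega)]; exact cross hx hy hxr hyr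
  · rw [if_neg (by omega)]; exact own₂ hx hy hxr hyr hxy

end TwoShell

/-! ### The Witt design of a tight relative design -/

/-- The block of the Witt design that belongs to a point of a tight relative design. -/
def extend (r : ℕ) (b : Finset (Fin 22)) : Finset (Option (Fin 22)) :=
  if #b = r then insertNone (smaller b) else (smaller b).map Function.Embedding.some

theorem none_mem_extend {r : ℕ} {b : Finset (Fin 22)} : none ∈ extend r b ↔ #b = r := by
  rw [extend]; split_ifs with h <;> simp [h]

theorem eraseNone_extend {r : ℕ} {b : Finset (Fin 22)} : eraseNone (extend r b) = smaller b := by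
  rw [extend]; split_ifs <;> ext <;> simp

theorem card_eraseNone_add {V : Type*} [DecidableEq V] (s : Finset (Option V)) :
    #(eraseNone s) + (if none ∈ s then 1 else 0) = #s := by
  have := card_map Function.Embedding.some (s := eraseNone s)
  rw [map_some_eraseNone] at this
  rw [← this]
  split_ifs with h
  · exact card_erase_add_one h
  · rw [erase_eq_of_notMem h, add_zero]

theorem eraseNone_inter {V : Type*} [DecidableEq V] (s t : Finset (Option V)) :
    eraseNone (s ∩ t) = eraseNone s ∩ eraseNone t := by
  ext; simp

namespace TwoShell

variable {r₁ r₂ : ℕ} {B : Finset (Finset (Fin 22))} {v : Finset (Fin 22) → ℝ}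

theorem eq_union (h : TwoShell r₁ r₂ B v) : B = {b ∈ B | #b = r₁} ∪ {b ∈ B | #b = r₂} := by
  rw [← filter_or]
  exact (filter_true_of_mem fun b hb => h.card_mem hb).symm

theorem card_extend (h : TwoShell r₁ r₂ B v) (h₁ : r₁ = 6 ∨ r₁ = 16) (h₂ : r₂ = 7 ∨ r₂ = 15)
    {b : Finset (Fin 22)} (hb : b ∈ B) : #(extend r₁ b) = 7 := by
  rw [← card_eraseNone_add, eraseNone_extend, if_congr none_mem_extend rfl rfl, smaller]
  have e : #(bᶜ) = 22 - #b := by rw [card_compl, Fintype.card_fin]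
  have := h.card_mem hb
  split_ifs <;> omega

theorem card_inter_extend (h : TwoShell r₁ r₂ B v) (h₁ : r₁ = 6 ∨ r₁ = 16)
    (h₂ : r₂ = 7 ∨ r₂ = 15) {x y : Finset (Fin 22)} (hx : x ∈ B) (hy : y ∈ B) (hxy : x ≠ y) :
    #(extend r₁ x ∩ extend r₁ y) ≤ 3 := by
  have := h.card_inter_smaller h₁ h₂ hx hy hxy
  rw [← card_eraseNone_add, eraseNone_inter, eraseNone_extend, eraseNone_extend]
  simpa only [mem_inter, none_mem_extend] using this

theorem isDesign (h : TwoShell r₁ r₂ B v) (h₁ : r₁ = 6 ∨ r₁ = 16) (h₂ : r₂ = 7 ∨ r₂ = 15) :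
    IsDesign 4 23 7 1 (B.image (extend r₁)) := by
  have hinj : Set.InjOn (extend r₁) B := by
    intro x hx y hy hxy
    by_contra hne
    have h3 := h.card_inter_extend h₁ h₂ hx hy hne
    rw [hxy, inter_self, h.card_extend h₁ h₂ hy] at h3
    omega
  have hB : #B = 253 := by
    rw [h.eq_union, card_union_of_disjoint, h.card_add_card]
    exact disjoint_filter.2 fun b _ h1 h2 => h.ne (h1.symm.trans h2)
  refine isDesign_of_card_inter_le (by simp) (by rw [card_image_of_injOn hinj, hB]) ?_ ?_
  · simp only [mem_image, forall_exists_index, and_imp, forall_apply_eq_imp_iff₂]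
    exact fun b hb => h.card_extend h₁ h₂ hb
  · simp only [mem_image, forall_exists_index, and_imp, forall_apply_eq_imp_iff₂]
    intro b hb b' hb' hne
    exact h.card_inter_extend h₁ h₂ hb hb' fun e => hne (by rw [e])

theorem derived_image_extend :
    derived (B.image (extend r₁)) = {b ∈ B | #b = r₁}.image smaller := by
  rw [derived, filter_image, image_image]
  simp only [none_mem_extend]
  exact image_congr fun b _ => eraseNone_extend

theorem residual_image_extend (h : TwoShell r₁ r₂ B v) :
    residual (B.image (extend r₁)) = {b ∈ B | #b = r₂}.image smaller := by
  rw [residual, filter_image, image_image]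
  simp only [none_mem_extend]
  have : {b ∈ B | ¬ #b = r₁} = {b ∈ B | #b = r₂} := by
    ext b
    simp only [mem_filter]
    have := h.ne
    constructor
    · rintro ⟨hb, hn⟩; exact ⟨hb, (h.card_mem hb).resolve_left hn⟩
    · rintro ⟨hb, hn⟩; exact ⟨hb, by omega⟩
  rw [this]
  exact image_congr fun b _ => eraseNone_extend

end TwoShell

theorem image_smaller_of_le {B : Finset (Finset (Fin 22))} {r : ℕ} (hr : r ≤ 11) :
    {b ∈ B | #b = r}.image smaller = {b ∈ B | #b = r} := by
  conv_rhs => rw [← image_id (s := {b ∈ B | #b = r})]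
  refine image_congr fun b hb => ?_
  have := (mem_filter.1 hb).2
  simp only [smaller, id]
  rw [if_neg (by omega)]

theorem complementary_image_smaller {B : Finset (Finset (Fin 22))} {r : ℕ} (hr : 11 < r) :
    complementary ({b ∈ B | #b = r}.image smaller) = {b ∈ B | #b = r} := by
  rw [complementary, image_image]
  conv_rhs => rw [← image_id (s := {b ∈ B | #b = r})]
  refine image_congr fun b hb => ?_
  have := (mem_filter.1 hb).2
  simp only [smaller, id, Function.comp_apply]
  rw [if_pos (by omega), compl_compl]

/-! ### Isomorphisms -/

section Isomorphic

variable (σ : Equiv.Perm (Fin 22))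

theorem permute_verticesOf {n : ℕ} (σ : Equiv.Perm (Fin n)) (A : Finset (Finset (Fin n))) :
    permute σ (verticesOf A) = verticesOf (A.image fun b => b.map σ.toEmbedding) := by
  rw [permute, verticesOf, verticesOf, image_image, image_image]
  refine image_congr fun b _ => ?_
  ext i
  simp only [Function.comp_apply, vertexOf, mem_map_equiv]

theorem derived_image_map (W : Finset (Finset (Option (Fin 22)))) :
    derived (W.image fun b => b.map (Equiv.optionCongr σ).toEmbedding) =
      (derived W).image fun b => b.map σ.toEmbedding := by
  rw [derived, derived, filter_image, image_image, image_image]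
  have : ∀ b : Finset (Option (Fin 22)),
      none ∈ b.map (Equiv.optionCongr σ).toEmbedding ↔ none ∈ b := fun b => by
    rw [mem_map_equiv]; rfl
  simp only [this]
  refine image_congr fun b _ => ?_
  ext i
  simp only [Function.comp_apply, mem_eraseNone, mem_map_equiv]
  rfl

theorem residual_image_map (W : Finset (Finset (Option (Fin 22)))) :
    residual (W.image fun b => b.map (Equiv.optionCongr σ).toEmbedding) =
      (residual W).image fun b => b.map σ.toEmbedding := by
  rw [residual, residual, filter_image, image_image, image_image]
  have : ∀ b : Finset (Option (Fin 22)),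
      none ∈ b.map (Equiv.optionCongr σ).toEmbedding ↔ none ∈ b := fun b => by
    rw [mem_map_equiv]; rfl
  simp only [this]
  refine image_congr fun b _ => ?_
  ext i
  simp only [Function.comp_apply, mem_eraseNone, mem_map_equiv]
  rfl

theorem complementary_image_map (A : Finset (Finset (Fin 22))) :
    complementary (A.image fun b => b.map σ.toEmbedding) =
      (complementary A).image fun b => b.map σ.toEmbedding := by
  rw [complementary, complementary, image_image, image_image]
  refine image_congr fun b _ => ?_
  ext i
  simp only [Function.comp_apply, mem_compl, mem_map_equiv]

end Isomorphic

/-- A tight relative `4`-design is determined up to isomorphism by its shells. -/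
theorem TwoShell.isomorphic {r₁ r₂ : ℕ} {B : Finset (Finset (Fin 22))}
    {v : Finset (Fin 22) → ℝ} (h : TwoShell r₁ r₂ B v) (hlt : r₁ < r₂)
    {W : Finset (Finset (Option (Fin 22)))} (hW : IsDesign 4 23 7 1 W) :
    (r₁ = 6 ∧ r₂ = 7 ∧ Isomorphic (verticesOf (derived W ∪ residual W)) (verticesOf B)) ∨
    (r₁ = 6 ∧ r₂ = 15 ∧
      Isomorphic (verticesOf (derived W ∪ complementary (residual W))) (verticesOf B)) ∨
    (r₁ = 7 ∧ r₂ = 16 ∧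
      Isomorphic (verticesOf (residual W ∪ complementary (derived W))) (verticesOf B)) ∨
    (r₁ = 15 ∧ r₂ = 16 ∧ Isomorphic
      (verticesOf (complementary (residual W) ∪ complementary (derived W))) (verticesOf B)) := by
  -- Here `s₁` is the shell whose sets receive ∞. It is the larger one when 16 occurs, which is why
  -- `h.symm` is used below.
  have main : ∀ {s₁ s₂ : ℕ}, TwoShell s₁ s₂ B v → (s₁ = 6 ∨ s₁ = 16) → (s₂ = 7 ∨ s₂ = 15) →
      ∃ σ : Equiv.Perm (Fin 22),
        {b ∈ B | #b = s₁}.image smaller = (derived W).image (fun b => b.map σ.toEmbedding) ∧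
        {b ∈ B | #b = s₂}.image smaller = (residual W).image (fun b => b.map σ.toEmbedding) := by
    intro s₁ s₂ h h₁ h₂
    obtain ⟨σ, hσ⟩ := exists_perm_of_isDesign hW (h.isDesign h₁ h₂)
    refine ⟨σ, ?_, ?_⟩
    · rw [← derived_image_map, ← hσ, derived_image_extend]
    · rw [← residual_image_map, ← hσ, h.residual_image_extend]
  have hB := h.eq_union
  rcases h.shells hlt with ⟨rfl, rfl⟩ | ⟨rfl, rfl⟩ | ⟨rfl, rfl⟩ | ⟨rfl, rfl⟩
  · obtain ⟨σ, hd, hr⟩ := main h (by simp) (by simp)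
    refine Or.inl ⟨rfl, rfl, σ, ?_⟩
    rw [permute_verticesOf, image_union, ← hd, ← hr, image_smaller_of_le (by simp),
      image_smaller_of_le (by simp), ← hB]
  · obtain ⟨σ, hd, hr⟩ := main h (by simp) (by simp)
    refine Or.inr (Or.inl ⟨rfl, rfl, σ, ?_⟩)
    rw [permute_verticesOf, image_union, ← complementary_image_map, ← hd, ← hr,
      image_smaller_of_le (by simp), complementary_image_smaller (by simp), ← hB]
  · obtain ⟨σ, hd, hr⟩ := main h.symm (by simp) (by simp)
    refine Or.inr (Or.inr (Or.inl ⟨rfl, rfl, σ, ?_⟩))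
    rw [permute_verticesOf, image_union, ← complementary_image_map, ← hd, ← hr,
      image_smaller_of_le (by simp), complementary_image_smaller (by simp), ← hB]
  · obtain ⟨σ, hd, hr⟩ := main h.symm (by simp) (by simp)
    refine Or.inr (Or.inr (Or.inr ⟨rfl, rfl, σ, ?_⟩))
    rw [permute_verticesOf, image_union, ← complementary_image_map, ← complementary_image_map,
      ← hd, ← hr, complementary_image_smaller (by simp), complementary_image_smaller (by simp),
      ← hB]

theorem twoShell_of_tight {r₁ r₂ : ℕ} {B : Finset (Finset (Fin 22))} {w : Cube 22 → ℝ}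
    (h1 : 2 ≤ r₁) (h12 : r₁ < r₂) (h2 : r₂ ≤ 20)
    (h : IsTightRelativeDesign (0 : Cube 22) 2 {r₁, r₂} (verticesOf B) w) :
    TwoShell r₁ r₂ B fun b => w (vertexOf b) := by
  obtain ⟨hpos, hR, hbal⟩ := isRelativeDesign_iff.1 h.isRelativeDesign
  exact ⟨h12.ne, h1, by omega, by omega, h2, hpos, hR, hbal, fun y hy => exists_dual_of_tight h hy⟩

/-! ### The tight relative designs of the Witt design -/

theorem compl_comp_sgn {n : ℕ} (T : Finset (Fin n)) :
    (fun b => sgn T bᶜ) = (-1 : ℝ) ^ #T • sgn T := by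
  ext b
  simp only [sgn, Pi.smul_apply, smul_eq_mul]
  rw [← prod_const, ← prod_mul_distrib]
  refine prod_congr rfl fun i _ => ?_
  by_cases h : i ∈ b <;> simp [h]

theorem compl_comp_mem_Pol {n t : ℕ} {f : Finset (Fin n) → ℝ} (hf : f ∈ Pol n t) :
    (fun b => f bᶜ) ∈ Pol n t := by
  have : Pol n t ≤ (Pol n t).comap (LinearMap.funLeft ℝ ℝ fun b => bᶜ) := by
    conv_lhs => rw [Pol_eq_span_sgn]
    refine Submodule.span_le.2 ?_
    rintro _ ⟨T, hT, rfl⟩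
    have e : LinearMap.funLeft ℝ ℝ (fun b => bᶜ) (sgn T) = (-1 : ℝ) ^ #T • sgn T :=
      compl_comp_sgn T
    simp only [SetLike.mem_coe, Submodule.mem_comap, e]
    exact Submodule.smul_mem _ _ (Pol_mono hT (sgn_mem_Pol T))
  exact this hf

/-- Complementation multiplies a character by (-1)^|T|, so those of weight four are unchanged and
only degree at most three remains. -/
theorem compl_comp_sub_mem_Pol {n : ℕ} {f : Finset (Fin n) → ℝ} (hf : f ∈ Pol n 4) :
    (fun b => f bᶜ) - f ∈ Pol n 3 := by
  have : Pol n 4 ≤ (Pol n 3).comap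
      (LinearMap.funLeft ℝ ℝ (fun b : Finset (Fin n) => bᶜ) - .id) := by
    rw [Pol_eq_span_sgn]
    refine Submodule.span_le.2 ?_
    rintro _ ⟨T, hT, rfl⟩
    have e : (fun b => sgn T bᶜ) - sgn T ∈ Pol n 3 := by
      rw [compl_comp_sgn]
      rcases (show #T ≤ 4 from hT).eq_or_lt with h | h
      · rw [h, show (-1 : ℝ) ^ 4 = 1 by norm_num, one_smul, sub_self]
        exact Submodule.zero_mem _
      · have := Pol_mono (Nat.le_of_lt_succ h) (sgn_mem_Pol T)
        exact Submodule.sub_mem _ (Submodule.smul_mem _ _ this) this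
    exact e
  exact this hf

theorem avg_compl {n r : ℕ} (hr : r ≤ n) (f : Finset (Fin n) → ℝ) :
    avg (n - r) f = avg r fun b => f bᶜ := by
  rw [avg_apply, avg_apply, Nat.choose_symm hr]
  congr 1
  refine sum_bij' (fun b _ => bᶜ) (fun b _ => bᶜ) ?_ ?_ ?_ ?_ ?_
  · intro b hb
    simp only [mem_powersetCard, subset_univ, true_and, card_compl, Fintype.card_fin] at hb ⊢
    omega
  · intro b hb
    simp only [mem_powersetCard, subset_univ, true_and, card_compl, Fintype.card_fin] at hb ⊢
    omega
  all_goals simp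

/-! ### Pairs of families balanced in degree four -/

/-- The error of the average of a function over `A`, as an approximation to its average over the
`r`-subsets, times `|A|`. -/
noncomputable def disc {n : ℕ} (r : ℕ) (A : Finset (Finset (Fin n))) :
    (Finset (Fin n) → ℝ) →ₗ[ℝ] ℝ :=
  ∑ b ∈ A, (LinearMap.proj b - avg r)

theorem disc_apply {n r : ℕ} {A : Finset (Finset (Fin n))} (f : Finset (Fin n) → ℝ) :
    disc r A f = ∑ b ∈ A, f b - #A * avg r f := by
  simp [disc]

theorem disc_compl {n r : ℕ} (hr : r ≤ n) {A : Finset (Finset (Fin n))} (f : Finset (Fin n) → ℝ) :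
    disc (n - r) (complementary A) f = disc r A fun b => f bᶜ := by
  rw [disc_apply, disc_apply, avg_compl hr, complementary,
    sum_image fun _ _ _ _ h => compl_injective h, card_image_of_injective _ compl_injective]

/-- Families `A₁`, `A₂` of `r₁`- and `r₂`-subsets of a `22`-set whose union is balanced in degree
four, with two intersection sizes within each family and between them. -/
structure ShellPair (r₁ r₂ : ℕ) (A₁ A₂ : Finset (Finset (Fin 22))) : Prop where
  size₁ : ∀ b ∈ A₁, #b = r₁
  size₂ : ∀ b ∈ A₂, #b = r₂
  nonempty₁ : A₁.Nonempty
  nonempty₂ : A₂.Nonempty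
  card_add_card : #A₁ + #A₂ = 253
  own₁ : ∃ α β : ℝ, (r₁ : ℝ) ≠ α ∧ (r₁ : ℝ) ≠ β ∧
    ∀ x ∈ A₁, ∀ y ∈ A₁, x ≠ y → (#(x ∩ y) : ℝ) = α ∨ (#(x ∩ y) : ℝ) = β
  own₂ : ∃ α β : ℝ, (r₂ : ℝ) ≠ α ∧ (r₂ : ℝ) ≠ β ∧
    ∀ x ∈ A₂, ∀ y ∈ A₂, x ≠ y → (#(x ∩ y) : ℝ) = α ∨ (#(x ∩ y) : ℝ) = β
  cross : ∃ γ δ : ℝ, ∀ x ∈ A₁, ∀ y ∈ A₂, (#(x ∩ y) : ℝ) = γ ∨ (#(x ∩ y) : ℝ) = δ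
  disc₁ : ∀ f ∈ Pol 22 3, disc r₁ A₁ f = 0
  disc₂ : ∀ f ∈ Pol 22 3, disc r₂ A₂ f = 0
  disc_add : ∀ f ∈ Pol 22 4, disc r₁ A₁ f + disc r₂ A₂ f = 0

namespace ShellPair

variable {r₁ r₂ : ℕ} {A₁ A₂ : Finset (Finset (Fin 22))}

theorem symm (h : ShellPair r₁ r₂ A₁ A₂) : ShellPair r₂ r₁ A₂ A₁ where
  size₁ := h.size₂
  size₂ := h.size₁
  nonempty₁ := h.nonempty₂
  nonempty₂ := h.nonempty₁
  card_add_card := by rw [add_comm, h.card_add_card]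
  own₁ := h.own₂
  own₂ := h.own₁
  cross := by
    obtain ⟨γ, δ, hγ⟩ := h.cross
    exact ⟨γ, δ, fun x hx y hy => by rw [inter_comm]; exact hγ y hy x hx⟩
  disc₁ := h.disc₂
  disc₂ := h.disc₁
  disc_add f hf := by rw [add_comm, h.disc_add f hf]

/-- Complementing `A₂` alters its error only by that of a function of degree three, which is zero.
The joint balance in degree four therefore survives, and the intersection sizes are shifted or
reflected. -/
theorem compl (h : ShellPair r₁ r₂ A₁ A₂) : ShellPair r₁ (22 - r₂) A₁ (complementary A₂) := by
  have hr₂ : r₂ ≤ 22 := by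
    obtain ⟨b, hb⟩ := h.nonempty₂
    rw [← h.size₂ b hb]; simpa using card_le_univ b
  have hdisc := fun f => disc_compl hr₂ (A := A₂) f
  refine
    { size₁ := h.size₁
      size₂ := ?_
      nonempty₁ := h.nonempty₁
      nonempty₂ := h.nonempty₂.image _
      card_add_card := ?_
      own₁ := h.own₁
      own₂ := ?_
      cross := ?_
      disc₁ := h.disc₁
      disc₂ := fun f hf => ?_
      disc_add := fun f hf => ?_ }
  · simp only [complementary, mem_image, forall_exists_index, and_imp, forall_apply_eq_imp_iff₂]
    intro b hb
    rw [card_compl, Fintype.card_fin, h.size₂ b hb]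
  · rw [complementary, card_image_of_injective _ compl_injective, h.card_add_card]
  · obtain ⟨α, β, hα, hβ, hαβ⟩ := h.own₂
    refine ⟨22 - 2 * r₂ + α, 22 - 2 * r₂ + β, ?_, ?_, ?_⟩
    · push_cast [hr₂]; intro he; exact hα (by linarith)
    · push_cast [hr₂]; intro he; exact hβ (by linarith)
    · simp only [complementary, mem_image, forall_exists_index, and_imp, forall_apply_eq_imp_iff₂]
      intro x hx y hy hne
      have e1 := card_union_add_card_inter x y
      have e2 := card_compl_add_card (x ∪ y)
      rw [compl_union, Fintype.card_fin] at e2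
      rw [h.size₂ x hx, h.size₂ y hy] at e1
      have : (#(xᶜ ∩ yᶜ) : ℝ) = 22 - 2 * r₂ + #(x ∩ y) := by
        have e3 : #(xᶜ ∩ yᶜ) + 2 * r₂ = 22 + #(x ∩ y) := by omega
        have e4 : (#(xᶜ ∩ yᶜ) : ℝ) + 2 * r₂ = 22 + #(x ∩ y) := by exact_mod_cast e3
        linarith
      rw [this, add_right_inj, add_right_inj]
      exact hαβ x hx y hy fun e => hne (by rw [e])
  · obtain ⟨γ, δ, hγ⟩ := h.cross
    refine ⟨r₁ - γ, r₁ - δ, ?_⟩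
    simp only [complementary, mem_image, forall_exists_index, and_imp, forall_apply_eq_imp_iff₂]
    intro x hx y hy
    have e := card_sdiff_add_card_inter x y
    rw [sdiff_eq_inter_compl, h.size₁ x hx] at e
    have : (#(x ∩ yᶜ) : ℝ) = r₁ - #(x ∩ y) := by
      rw [← e]; push_cast; ring
    rw [this, sub_right_inj, sub_right_inj]
    exact hγ x hx y hy
  · rw [hdisc]
    exact h.disc₂ _ (compl_comp_mem_Pol hf)
  · have h1 := h.disc₂ _ (compl_comp_sub_mem_Pol hf)
    have h2 := h.disc_add f hf
    rw [map_sub] at h1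
    rw [hdisc]
    linarith

/-- With u = #(x ∩ y), take (u - α)(u - β) on the shell of `y` and (u - γ)(u - δ) on the other.
Equal leading coefficients keep the degree at two. -/
theorem exists_dual (h : ShellPair r₁ r₂ A₁ A₂) (hne : r₁ ≠ r₂) {y : Finset (Fin 22)}
    (hy : y ∈ A₁) : ∃ f ∈ Pol 22 2, f y ≠ 0 ∧ ∀ x ∈ A₁ ∪ A₂, x ≠ y → f x = 0 := by
  obtain ⟨α, β, hα, hβ, hαβ⟩ := h.own₁
  obtain ⟨γ, δ, hγ⟩ := h.cross
  obtain ⟨f, hf, hfv⟩ := exists_quadratic_mem_Pol hne y 1 (-(α + β)) (-(γ + δ)) (α * β) (γ * δ)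
  refine ⟨f, hf, ?_, fun x hx hxy => ?_⟩
  · rw [(hfv y).1 (h.size₁ y hy), inter_self, h.size₁ y hy]
    have : (1 : ℝ) * r₁ ^ 2 + -(α + β) * r₁ + α * β = (r₁ - α) * (r₁ - β) := by ring
    rw [this]
    exact mul_ne_zero (sub_ne_zero.2 hα) (sub_ne_zero.2 hβ)
  · rcases mem_union.1 hx with hx | hx
    · rw [(hfv x).1 (h.size₁ x hx)]
      rcases hαβ x hx y hy hxy with e | e <;> rw [e] <;> ring
    · rw [(hfv x).2 (h.size₂ x hx)]
      rw [inter_comm]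
      rcases hγ y hy x hx with e | e <;> rw [e] <;> ring

theorem isTightRelativeDesign (h : ShellPair r₁ r₂ A₁ A₂) (hne : r₁ ≠ r₂)
    (hc : (22 : ℝ) + (22 - 2 * r₁) * (22 - 2 * r₂) ≠ 0) {c : ℝ} (hpos : 0 < c) :
    IsTightRelativeDesign (0 : Cube 22) 2 {r₁, r₂} (verticesOf (A₁ ∪ A₂)) fun _ => c := by
  have hdisj : Disjoint A₁ A₂ := disjoint_left.2 fun b h1 h2 =>
    hne ((h.size₁ b h1).symm.trans (h.size₂ b h2))
  have hR : (A₁ ∪ A₂).image card = {r₁, r₂} := by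
    rw [image_union, image_congr (g := fun _ => r₁) fun b hb => h.size₁ b hb,
      image_congr (g := fun _ => r₂) fun b hb => h.size₂ b hb, image_const h.nonempty₁,
      image_const h.nonempty₂]
    rfl
  refine ⟨isRelativeDesign_iff.2 ⟨fun _ _ => hpos, hR, fun f hf => ?_⟩, ?_⟩
  · have e := h.disc_add f hf
    rw [disc_apply, disc_apply] at e
    rw [← mul_sum, ← mul_sum, sum_union hdisj, sum_union hdisj,
      sum_congr rfl fun b hb => by rw [h.size₁ b hb],
      sum_congr (s₁ := A₂) rfl fun b hb => by rw [h.size₂ b hb], sum_const, sum_const,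
      nsmul_eq_mul, nsmul_eq_mul]
    congr 1
    linarith
  · refine card_eq_finrank hne (by exact_mod_cast hc) ?_ hR fun y hy => ?_
    · rw [card_union_of_disjoint hdisj, h.card_add_card]; rfl
    · rcases mem_union.1 hy with hy | hy
      · exact h.exists_dual hne hy
      · rw [union_comm]; exact h.symm.exists_dual hne.symm hy

end ShellPair

/-! ### The derived and the residual design of the Witt design -/

theorem mem_derived {V : Type*} [DecidableEq V] {W : Finset (Finset (Option V))} {d : Finset V} :
    d ∈ derived W ↔ insertNone d ∈ W := by
  simp only [derived, mem_image, mem_filter]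
  constructor
  · rintro ⟨b, ⟨hb, hn⟩, rfl⟩
    rwa [insertNone_eraseNone, insert_eq_of_mem hn]
  · intro h
    exact ⟨_, ⟨h, by simp⟩, by simp⟩

theorem mem_residual {V : Type*} [DecidableEq V] {W : Finset (Finset (Option V))} {d : Finset V} :
    d ∈ residual W ↔ d.map Function.Embedding.some ∈ W := by
  simp only [residual, mem_image, mem_filter]
  constructor
  · rintro ⟨b, ⟨hb, hn⟩, rfl⟩
    rwa [map_some_eraseNone, erase_eq_of_notMem hn]
  · intro h
    exact ⟨_, ⟨h, by simp⟩, by simp⟩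

theorem card_derived_filter {V : Type*} [DecidableEq V] (W : Finset (Finset (Option V)))
    (U : Finset V) : #{d ∈ derived W | U ⊆ d} = #{b ∈ W | insertNone U ⊆ b} := by
  refine card_bij' (fun d _ => insertNone d) (fun b _ => eraseNone b) ?_ ?_ ?_ ?_
  · intro d hd
    rw [mem_filter, mem_derived] at hd
    exact mem_filter.2 ⟨hd.1, insertNone.monotone hd.2⟩
  · intro b hb
    have hb' := mem_filter.1 hb
    have hn : none ∈ b := hb'.2 (by simp)
    rw [mem_filter, mem_derived, insertNone_eraseNone, insert_eq_of_mem hn]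
    exact ⟨hb'.1, fun i hi => by simpa using hb'.2 (by simpa using hi)⟩
  · simp
  · intro b hb
    have hn : none ∈ b := (mem_filter.1 hb).2 (by simp)
    simp only [insertNone_eraseNone, insert_eq_of_mem hn]

theorem card_residual_filter {V : Type*} [DecidableEq V] (W : Finset (Finset (Option V)))
    (U : Finset V) :
    #{d ∈ residual W | U ⊆ d} + #{b ∈ W | insertNone U ⊆ b} =
      #{b ∈ W | U.map Function.Embedding.some ⊆ b} := by
  rw [← card_filter_add_card_filter_not (s := {b ∈ W | U.map Function.Embedding.some ⊆ b})
    (none ∈ ·), add_comm]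
  congr 1
  · rw [filter_filter]
    congr 1
    ext b
    simp only [mem_filter, and_congr_right_iff]
    intro _
    constructor
    · intro h
      refine ⟨fun i hi => h ?_, h (by simp)⟩
      obtain ⟨j, hj, rfl⟩ := mem_map.1 hi
      simpa using hj
    · rintro ⟨h, hn⟩ i hi
      rcases i with _ | i
      · exact hn
      · exact h (by simpa using hi)
  · refine card_bij' (fun d _ => d.map Function.Embedding.some) (fun b _ => eraseNone b) ?_ ?_ ?_ ?_
    · intro d hd
      rw [mem_filter, mem_residual] at hd
      simp only [mem_filter, map_subset_map]
      exact ⟨hd, by simp⟩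
    · intro b hb
      have hb' := mem_filter.1 hb
      have hb2 := mem_filter.1 hb'.1
      rw [mem_filter, mem_residual, map_some_eraseNone, erase_eq_of_notMem hb'.2]
      exact ⟨hb2.1, fun i hi => by simpa using hb2.2 (mem_map_of_mem _ hi)⟩
    · simp
    · intro b hb
      have hn : none ∉ b := (mem_filter.1 hb).2
      simp only [map_some_eraseNone, erase_eq_of_notMem hn]

theorem disc_eq_zero {n r t : ℕ} (hr : r ≤ n) {A : Finset (Finset (Fin n))}
    (h : ∀ U : Finset (Fin n), #U ≤ t →
      (#{b ∈ A | U ⊆ b} : ℝ) = #A * (r.descFactorial #U / n.descFactorial #U))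
    {f : Finset (Fin n) → ℝ} (hf : f ∈ Pol n t) : disc r A f = 0 := by
  have : Pol n t ≤ LinearMap.ker (disc r A) := by
    refine Submodule.span_le.2 ?_
    rintro _ ⟨U, hU, rfl⟩
    rw [SetLike.mem_coe, LinearMap.mem_ker, disc_apply, avg_inc hr, ← h U hU, sub_eq_zero]
    simp only [inc]
    rw [sum_boole]
  exact this hf

namespace IsDesign

variable {W : Finset (Finset (Option (Fin 22)))}

theorem card_derived_filter (h : IsDesign 4 23 7 1 W) (U : Finset (Fin 22)) (hU : #U ≤ 3) :
    #{d ∈ derived W | U ⊆ d} = if #U = 0 then 77 else if #U = 1 then 21 else if #U = 2 then 5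
      else 1 := by
  rw [RelDesign.card_derived_filter]
  have hc : #(insertNone U) = #U + 1 := card_insertNone U
  split_ifs with h0 h1 h2
  · exact h.card_one (by omega)
  · exact h.card_two (by omega)
  · exact h.card_three (by omega)
  · exact h.balanced _ (by omega)

theorem card_residual_filter (h : IsDesign 4 23 7 1 W) (U : Finset (Fin 22)) (hU : #U ≤ 3) :
    #{d ∈ residual W | U ⊆ d} = if #U = 0 then 176 else if #U = 1 then 56 else if #U = 2 then 16
      else 4 := by
  have e := RelDesign.card_residual_filter W U
  rw [← RelDesign.card_derived_filter, h.card_derived_filter U hU] at e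
  have hc : #(U.map Function.Embedding.some) = #U := card_map _
  split_ifs at e ⊢ with h0 h1 h2
  · rw [h0, card_eq_zero] at hc
    rw [hc] at e
    simp only [empty_subset, filter_true, h.card_eq] at e
    omega
  · rw [h.card_one (by omega)] at e; omega
  · rw [h.card_two (by omega)] at e; omega
  · rw [h.card_three (by omega)] at e; omega

theorem card_derived (h : IsDesign 4 23 7 1 W) : #(derived W) = 77 := by
  simpa using h.card_derived_filter ∅ (by simp)

theorem card_residual (h : IsDesign 4 23 7 1 W) : #(residual W) = 176 := by
  simpa using h.card_residual_filter ∅ (by simp)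

theorem shellPair (h : IsDesign 4 23 7 1 W) : ShellPair 6 7 (derived W) (residual W) := by
  have hD := h.card_derived
  have hR := h.card_residual
  have iD : ∀ x y : Finset (Fin 22), #(insertNone x ∩ insertNone y) = #(x ∩ y) + 1 := fun x y => by
    rw [← card_eraseNone_add, eraseNone_inter]; simp
  have iR : ∀ x y : Finset (Fin 22), #(x.map Function.Embedding.some ∩
      y.map Function.Embedding.some) = #(x ∩ y) := fun x y => by
    rw [← map_inter, card_map]
  have iC : ∀ x y : Finset (Fin 22), #(insertNone x ∩ y.map Function.Embedding.some) = #(x ∩ y) :=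
    fun x y => by rw [← card_eraseNone_add, eraseNone_inter]; simp
  have d₁ : ∀ {f}, f ∈ Pol 22 3 → disc 6 (derived W) f = 0 := disc_eq_zero (by norm_num)
    fun U hU => by
      rw [h.card_derived_filter U hU, hD]
      generalize #U = k at hU
      interval_cases k <;> simp [cast_descFactorial_succ, -Nat.descFactorial_succ] <;> norm_num
  have d₂ : ∀ {f}, f ∈ Pol 22 3 → disc 7 (residual W) f = 0 := disc_eq_zero (by norm_num)
    fun U hU => by
      rw [h.card_residual_filter U hU, hR]
      generalize #U = k at hU
      interval_cases k <;> simp [cast_descFactorial_succ, -Nat.descFactorial_succ] <;> norm_num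
  refine
    { size₁ := fun b hb => ?_
      size₂ := fun b hb => ?_
      nonempty₁ := card_pos.1 (by omega)
      nonempty₂ := card_pos.1 (by omega)
      card_add_card := by omega
      own₁ := ⟨0, 2, by norm_num, by norm_num, fun x hx y hy hne => ?_⟩
      own₂ := ⟨1, 3, by norm_num, by norm_num, fun x hx y hy hne => ?_⟩
      cross := ⟨1, 3, fun x hx y hy => ?_⟩
      disc₁ := fun f => d₁
      disc₂ := fun f => d₂
      disc_add := fun f hf => ?_ }
  · have := h.card_block _ (mem_derived.1 hb)
    rw [card_insertNone] at this; omega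
  · have := h.card_block _ (mem_residual.1 hb)
    rwa [card_map] at this
  · have := h.card_inter (mem_derived.1 hx) (mem_derived.1 hy)
      fun e => hne (insertNone.injective e.symm)
    rw [iD] at this
    exact this.imp (fun e => by rw [show #(x ∩ y) = 0 by omega, Nat.cast_zero])
      fun e => by rw [show #(x ∩ y) = 2 by omega, Nat.cast_ofNat]
  · have := h.card_inter (mem_residual.1 hx) (mem_residual.1 hy)
      fun e => hne (map_injective _ e.symm)
    rw [iR] at this
    exact this.imp (fun e => by rw [e, Nat.cast_one]) fun e => by rw [e, Nat.cast_ofNat]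
  · have := h.card_inter (mem_derived.1 hx) (mem_residual.1 hy) fun e => by
      have : none ∈ y.map Function.Embedding.some := e ▸ by simp
      simp at this
    rw [iC] at this
    exact this.imp (fun e => by rw [e, Nat.cast_one]) fun e => by rw [e, Nat.cast_ofNat]
  · have : Pol 22 4 ≤ LinearMap.ker (disc 6 (derived W) + disc 7 (residual W)) := by
      refine Submodule.span_le.2 ?_
      rintro _ ⟨U, hU, rfl⟩
      rw [SetLike.mem_coe, LinearMap.mem_ker, LinearMap.add_apply]
      rcases (show #U ≤ 4 from hU).eq_or_lt with hU | hU
      -- A 4-subset of the 22 points lies in exactly one block, derived or residual. The averages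
      -- agree since 77 · 6·5·4·3 + 176 · 7·6·5·4 = 22·21·20·19.
      · have e := RelDesign.card_residual_filter W U
        rw [← RelDesign.card_derived_filter, h.balanced _ (by rw [card_map, hU])] at e
        have e' : (#{d ∈ residual W | U ⊆ d} : ℝ) + #{d ∈ derived W | U ⊆ d} = 1 := by
          exact_mod_cast e
        rw [disc_apply, disc_apply, avg_inc (by norm_num), avg_inc (by norm_num), hD, hR, hU]
        simp only [inc]
        rw [sum_boole, sum_boole]
        simp only [cast_descFactorial_succ, Nat.descFactorial_zero]
        norm_num
        linarith
      · rw [d₁ (inc_mem_Pol (Nat.le_of_lt_succ hU)), d₂ (inc_mem_Pol (Nat.le_of_lt_succ hU)),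
          add_zero]
    exact this hf

end IsDesign

/-! ### The classification -/

theorem IsDesign.isTightRelativeDesign {W : Finset (Finset (Option (Fin 22)))}
    (h : IsDesign 4 23 7 1 W) {c : ℝ} (hc : 0 < c) :
    IsTightRelativeDesign (0 : Cube 22) 2 {6, 7}
      (verticesOf (derived W ∪ residual W)) (fun _ => c) ∧
    IsTightRelativeDesign (0 : Cube 22) 2 {6, 15}
      (verticesOf (derived W ∪ complementary (residual W))) (fun _ => c) ∧
    IsTightRelativeDesign (0 : Cube 22) 2 {7, 16}
      (verticesOf (residual W ∪ complementary (derived W))) (fun _ => c) ∧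
    IsTightRelativeDesign (0 : Cube 22) 2 {15, 16}
      (verticesOf (complementary (residual W) ∪ complementary (derived W))) (fun _ => c) :=
  ⟨h.shellPair.isTightRelativeDesign (by norm_num) (by norm_num) hc,
    h.shellPair.compl.isTightRelativeDesign (by norm_num) (by norm_num) hc,
    h.shellPair.symm.compl.isTightRelativeDesign (by norm_num) (by norm_num) hc,
    h.shellPair.compl.symm.compl.isTightRelativeDesign (by norm_num) (by norm_num) hc⟩

theorem weight_const_of_tight {r₁ r₂ : ℕ} {B : Finset (Finset (Fin 22))} {w : Cube 22 → ℝ}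
    (h1 : 2 ≤ r₁) (h12 : r₁ < r₂) (h2 : r₂ ≤ 20)
    (h : IsTightRelativeDesign (0 : Cube 22) 2 {r₁, r₂} (verticesOf B) w) :
    ∃ c, ∀ y ∈ verticesOf B, w y = c := by
  have hT := twoShell_of_tight h1 h12 h2 h
  have key : ∃ c, ∀ b ∈ B, w (vertexOf b) = c := by
    rcases hT.shells h12 with ⟨rfl, rfl⟩ | ⟨rfl, rfl⟩ | ⟨rfl, rfl⟩ | ⟨rfl, rfl⟩
    · exact hT.weight_const (by simp) (by simp)
    · exact hT.weight_const (by simp) (by simp)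
    · exact hT.symm.weight_const (by simp) (by simp)
    · exact hT.symm.weight_const (by simp) (by simp)
  obtain ⟨c, hc⟩ := key
  refine ⟨c, fun y hy => ?_⟩
  obtain ⟨b, hb, rfl⟩ := mem_image.1 hy
  exact hc b hb

theorem image_hammingDist_permute {n : ℕ} (σ : Equiv.Perm (Fin n)) (Y : Finset (Cube n)) :
    (permute σ Y).image (fun y => hammingDist y 0) = Y.image fun y => hammingDist y 0 := by
  rw [permute, image_image]
  refine image_congr fun y _ => ?_
  simp only [Function.comp_apply, hammingDist_zero, supp]
  rw [← card_map σ.toEmbedding (s := ({i | y i = 1} : Finset (Fin n)))]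
  congr 1
  ext i
  simp only [mem_filter, mem_univ, true_and, mem_map_equiv]

/-- The set of shells met is invariant under permutations of the coordinates. -/
theorem mk_ne_mk_of_tight {n e e' : ℕ} {R R' : Finset ℕ} {Y Y' : Finset (Cube n)}
    {w w' : Cube n → ℝ} (h : IsTightRelativeDesign 0 e R Y w)
    (h' : IsTightRelativeDesign 0 e' R' Y' w') (hne : R ≠ R') :
    Quotient.mk (isoSetoid n) Y ≠ Quotient.mk (isoSetoid n) Y' := by
  intro he
  obtain ⟨σ, rfl⟩ : Isomorphic Y Y' := Quotient.exact he
  rw [← h.isRelativeDesign.shells, ← h'.isRelativeDesign.shells, image_hammingDist_permute] at hne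
  exact hne rfl

theorem isomorphic_of_tight {r₁ r₂ : ℕ} {Y : Finset (Cube 22)} {w : Cube 22 → ℝ}
    (h1 : 2 ≤ r₁) (h12 : r₁ < r₂) (h2 : r₂ ≤ 20)
    (h : IsTightRelativeDesign (0 : Cube 22) 2 {r₁, r₂} Y w)
    {W : Finset (Finset (Option (Fin 22)))} (hW : IsDesign 4 23 7 1 W) :
    (r₁ = 6 ∧ r₂ = 7 ∧ Isomorphic (verticesOf (derived W ∪ residual W)) Y) ∨
    (r₁ = 6 ∧ r₂ = 15 ∧ Isomorphic (verticesOf (derived W ∪ complementary (residual W))) Y) ∨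
    (r₁ = 7 ∧ r₂ = 16 ∧ Isomorphic (verticesOf (residual W ∪ complementary (derived W))) Y) ∨
    (r₁ = 15 ∧ r₂ = 16 ∧ Isomorphic
      (verticesOf (complementary (residual W) ∪ complementary (derived W))) Y) := by
  rw [← verticesOf_image_supp Y] at h ⊢
  exact (twoShell_of_tight h1 h12 h2 h).isomorphic h12 hW

theorem ncard_isConstantWeightTight {W : Finset (Finset (Option (Fin 22)))}
    (hW : IsDesign 4 23 7 1 W) :
    {q : Quotient (isoSetoid 22) |
      ∃ Y, IsConstantWeightTight Y ∧ Quotient.mk (isoSetoid 22) Y = q}.ncard = 4 := by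
  obtain ⟨t₁, t₂, t₃, t₄⟩ := hW.isTightRelativeDesign one_pos
  have e : {q : Quotient (isoSetoid 22) |
        ∃ Y, IsConstantWeightTight Y ∧ Quotient.mk (isoSetoid 22) Y = q} =
      {Quotient.mk _ (verticesOf (derived W ∪ residual W)),
        Quotient.mk _ (verticesOf (derived W ∪ complementary (residual W))),
        Quotient.mk _ (verticesOf (residual W ∪ complementary (derived W))),
        Quotient.mk _ (verticesOf (complementary (residual W) ∪ complementary (derived W)))} := by
    ext q
    simp only [Set.mem_ofPred_eq, Set.mem_insert_iff, Set.mem_singleton_iff]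
    constructor
    · rintro ⟨Y, ⟨r₁, r₂, h1, h12, h2, c, hY⟩, rfl⟩
      exact (isomorphic_of_tight h1 h12 h2 hY hW).imp
        (fun h => Quotient.sound ((isoSetoid 22).iseqv.symm h.2.2))
        (Or.imp (fun h => Quotient.sound ((isoSetoid 22).iseqv.symm h.2.2))
          (Or.imp (fun h => Quotient.sound ((isoSetoid 22).iseqv.symm h.2.2))
            fun h => Quotient.sound ((isoSetoid 22).iseqv.symm h.2.2)))
    · rintro (rfl | rfl | rfl | rfl)
      · exact ⟨_, ⟨6, 7, by norm_num, by norm_num, by norm_num, 1, t₁⟩, rfl⟩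
      · exact ⟨_, ⟨6, 15, by norm_num, by norm_num, by norm_num, 1, t₂⟩, rfl⟩
      · exact ⟨_, ⟨7, 16, by norm_num, by norm_num, by norm_num, 1, t₃⟩, rfl⟩
      · exact ⟨_, ⟨15, 16, by norm_num, by norm_num, by norm_num, 1, t₄⟩, rfl⟩
  have n12 := mk_ne_mk_of_tight t₁ t₂ (by decide)
  have n13 := mk_ne_mk_of_tight t₁ t₃ (by decide)
  have n14 := mk_ne_mk_of_tight t₁ t₄ (by decide)
  have n23 := mk_ne_mk_of_tight t₂ t₃ (by decide)
  have n24 := mk_ne_mk_of_tight t₂ t₄ (by decide)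
  have n34 := mk_ne_mk_of_tight t₃ t₄ (by decide)
  rw [e, Set.ncard_insert_of_notMem, Set.ncard_insert_of_notMem, Set.ncard_pair n34]
  · simp only [Set.mem_insert_iff, Set.mem_singleton_iff, not_or]
    exact ⟨n23, n24⟩
  · simp only [Set.mem_insert_iff, Set.mem_singleton_iff, not_or]
    exact ⟨n12, n13, n14⟩

end RelDesign

theorem mainTheorem6 :
    -- the Witt design exists
    (∃ W : Finset (Finset (Option (Fin 22))), IsDesign 4 23 7 1 W) ∧
    -- up to isomorphism there are exactly four designs with constant weight
    {q : Quotient (isoSetoid 22) |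
      ∃ Y, IsConstantWeightTight Y ∧ Quotient.mk (isoSetoid 22) Y = q}.ncard = 4 ∧
    -- they come from the derived and residual designs of the Witt design
    (∀ W : Finset (Finset (Option (Fin 22))), IsDesign 4 23 7 1 W →
      (∀ c : ℝ, 0 < c →
        IsTightRelativeDesign (0 : Cube 22) 2 {6, 7}
          (verticesOf (derived W ∪ residual W)) (fun _ => c) ∧
        IsTightRelativeDesign (0 : Cube 22) 2 {6, 15}
          (verticesOf (derived W ∪ complementary (residual W))) (fun _ => c) ∧
        IsTightRelativeDesign (0 : Cube 22) 2 {7, 16}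
          (verticesOf (residual W ∪ complementary (derived W))) (fun _ => c) ∧
        IsTightRelativeDesign (0 : Cube 22) 2 {15, 16}
          (verticesOf (complementary (residual W) ∪ complementary (derived W))) (fun _ => c)) ∧
      (∀ (r₁ r₂ : ℕ) (Y : Finset (Cube 22)) (c : ℝ), 2 ≤ r₁ → r₁ < r₂ → r₂ ≤ 20 →
        IsTightRelativeDesign (0 : Cube 22) 2 {r₁, r₂} Y (fun _ => c) →
          (r₁ = 6 ∧ r₂ = 7 ∧
            Isomorphic (verticesOf (derived W ∪ residual W)) Y) ∨
          (r₁ = 6 ∧ r₂ = 15 ∧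
            Isomorphic (verticesOf (derived W ∪ complementary (residual W))) Y) ∨
          (r₁ = 7 ∧ r₂ = 16 ∧
            Isomorphic (verticesOf (residual W ∪ complementary (derived W))) Y) ∨
          (r₁ = 15 ∧ r₂ = 16 ∧
            Isomorphic
              (verticesOf (complementary (residual W) ∪ complementary (derived W))) Y))) ∧
    -- there are no designs with non-constant weight
    (∀ (r₁ r₂ : ℕ) (Y : Finset (Cube 22)) (w : Cube 22 → ℝ), 2 ≤ r₁ → r₁ < r₂ → r₂ ≤ 20 →
      IsTightRelativeDesign (0 : Cube 22) 2 {r₁, r₂} Y w → ∃ c : ℝ, ∀ y ∈ Y, w y = c) := by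
  obtain ⟨W, hW⟩ := exists_isDesign
  refine ⟨⟨W, hW⟩, ncard_isConstantWeightTight hW, fun W hW => ⟨fun c hc =>
    hW.isTightRelativeDesign hc, fun r₁ r₂ Y c h1 h12 h2 h => isomorphic_of_tight h1 h12 h2 h hW⟩,
    fun r₁ r₂ Y w h1 h12 h2 h => ?_⟩
  rw [← verticesOf_image_supp Y] at h ⊢
  exact weight_const_of_tight h1 h12 h2 h
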